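/- Let $f$ be a polynomial over $\mathbb{F}_2$ of degree at most 3 in $n$ variables with no constant term (a sum of products of at most three distinct variables), and let $\mathrm{gap}(f)=\sum_{x\in\{0,1\}^n}(-1)^{f(x)}$. Consider quantum circuits on $\ell$ qubits that start and end with a column of Hadamard gates and whose internal part is a sequence of Hadamard, Z, CZ and CCZ gates with at least one gate acting on each qubit. The internal Hadamard gates divide the wires of the internal part into segments. Associate a distinct variable with each segment, and let the polynomial of the circuit be the sum over $\mathbb{F}_2$ of the following terms, one for each internal gate: for a Hadamard gate, the product of the variables of the two segments that it joins; for a Z, CZ or CCZ gate, the product of the variables of the one, two or three segments on which it acts. The circuit corresponds to $f$ if its polynomial, for some labelling of the segments by the $n$ variables, is $f$. The quantum circuit width $w(f)$ is the minimal number $\ell$ of qubits of a circuit that corresponds to $f$. Then the following problem is BQP-hard: given $f$ (as a list of monomials), output a rational number $a$ with $$|a-\mathrm{gap}(f)|\le \tfrac13\cdot 2^{(n+w(f))/2}.$$ That is, for every language $L$ in BQP there are two functions computable by deterministic Turing machines in polynomial time, the first mapping each binary string $x$ to such a polynomial $f_x$, the second mapping a pair $(x,a)$ to a bit, such that for every $x$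 and every rational $a$ with $|a-\mathrm{gap}(f_x)|\le \frac13\cdot 2^{(n+w(f_x))/2}$, where $n$ is the number of variables of $f_x$, the bit for $(x,a)$ is 1 if and only if $x\in L$. Here BQP is the class of languages $L\subseteq\{0,1\}^*$ for which a polynomial-time Turing machine maps each $x$ to a quantum circuit $U_x$ of Hadamard, phase ($|1\rangle\mapsto i|1\rangle$) and Toffoli gates such that measuring the first qubit of $U_x|0\cdots0\rangle$ gives 1 with probability at least $2/3$ if $x\in L$ and at most $1/3$ if $x\notin L$. -/

import Mathlib

namespace CubicGap

/-! ## Circuits over Hadamard, Z, CZ, CCZ and their polynomials -/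

/-- A gate from the set `{H, Z, CZ, CCZ}` on `l` qubits; multi-qubit gates act on distinct qubits. -/
inductive Gate (l : ℕ) : Type
  | H (i : Fin l)
  | Z (i : Fin l)
  | CZ (i j : Fin l) (hij : i ≠ j)
  | CCZ (i j k : Fin l) (hij : i ≠ j) (hik : i ≠ k) (hjk : j ≠ k)

namespace Gate

variable {l : ℕ}

/-- The gate acts on qubit `q`. -/
def ActsOn : Gate l → Fin l → Prop
  | H i, q => q = i
  | Z i, q => q = i
  | CZ i j _, q => q = i ∨ q = j
  | CCZ i j k _ _ _, q => q = i ∨ q = j ∨ q = k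

/-- The gate is a Hadamard gate on qubit `q`. -/
def IsHadamardOn : Gate l → Fin l → Bool
  | H i, q => decide (i = q)
  | Z _, _ => false
  | CZ _ _ _, _ => false
  | CCZ _ _ _ _ _ _, _ => false

end Gate

/-- The internal part of a quantum circuit on `l` qubits over `{H, Z, CZ, CCZ}`: the list of gates,
in order of application, between the initial and the final column of Hadamard gates. -/
abbrev InternalCircuit (l : ℕ) : Type := List (Gate l)

namespace InternalCircuit

variable {l : ℕ}

/-- The number of (internal) Hadamard gates on wire `q`. -/
def hadamards (C : InternalCircuit l) (q : Fin l) : ℕ := C.countP fun g => g.IsHadamardOn q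

/-- The segments into which the Hadamard gates divide the wires. The pair `(q, t)` is the segment
of wire `q` that is preceded by exactly `t` Hadamard gates on that wire. -/
def segments (C : InternalCircuit l) : Set (Fin l × ℕ) := {s | s.2 ≤ C.hadamards s.1}

open MvPolynomial in
/-- The sum of the terms of the gates of a circuit, where `(q, cur q)` is the segment of wire `q`
on which the circuit starts. A Hadamard gate contributes the product of the two segments that it
joins; a Z, CZ or CCZ gate contributes the product of the segments on which it acts. -/
noncomputable def segmentPolyFrom :
    (Fin l → ℕ) → InternalCircuit l → MvPolynomial (Fin l × ℕ) (ZMod 2)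
  | _, [] => 0
  | cur, Gate.H i :: C =>
      X (i, cur i) * X (i, cur i + 1) + segmentPolyFrom (Function.update cur i (cur i + 1)) C
  | cur, Gate.Z i :: C => X (i, cur i) + segmentPolyFrom cur C
  | cur, Gate.CZ i j _ :: C => X (i, cur i) * X (j, cur j) + segmentPolyFrom cur C
  | cur, Gate.CCZ i j k _ _ _ :: C =>
      X (i, cur i) * X (j, cur j) * X (k, cur k) + segmentPolyFrom cur C

/-- The polynomial of a circuit, with the segments of the wires as its variables. -/
noncomputable def segmentPoly (C : InternalCircuit l) : MvPolynomial (Fin l × ℕ) (ZMod 2) :=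
  segmentPolyFrom (fun _ => 0) C

/-- The circuit corresponds to the polynomial `f` in `n` variables: at least one internal gate acts
on each qubit, and for some labelling `e` of the segments by the `n` variables (one distinct
variable for each segment) the polynomial of the circuit is `f`. -/
def Corresponds (C : InternalCircuit l) {n : ℕ} (f : MvPolynomial (Fin n) (ZMod 2)) : Prop :=
  (∀ q : Fin l, ∃ g ∈ C, g.ActsOn q) ∧
    ∃ e : Fin n → Fin l × ℕ, Function.Injective e ∧ Set.range e = C.segments ∧
      MvPolynomial.rename e f = C.segmentPoly

end InternalCircuit

/-- The quantum circuit width: the minimal number of qubits of a circuit corresponding to `f`. -/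
noncomputable def circuitWidth {n : ℕ} (f : MvPolynomial (Fin n) (ZMod 2)) : ℕ :=
  sInf {l : ℕ | ∃ C : InternalCircuit l, C.Corresponds f}

/-- The number of zeroes minus the number of ones of `f` on `{0,1}^n`. -/
noncomputable def gap {n : ℕ} (f : MvPolynomial (Fin n) (ZMod 2)) : ℤ :=
  ∑ x : Fin n → ZMod 2, if MvPolynomial.eval x f = 0 then 1 else -1

/-! ## Degree-3 polynomials as inputs of an algorithm -/

/-- A polynomial of degree at most 3 over `ZMod 2` in `n` variables, without constant term, written
as a list of monomials, each of which is a product of one, two or three distinct variables. -/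
structure CubicPoly where
  /-- the number of variables -/
  n : ℕ
  /-- the monomials -/
  terms : List (List (Fin n))
  terms_ok : ∀ t ∈ terms, t ≠ [] ∧ t.length ≤ 3 ∧ t.Nodup

/-- The polynomial that is written down. -/
noncomputable def CubicPoly.poly (P : CubicPoly) : MvPolynomial (Fin P.n) (ZMod 2) :=
  (P.terms.map fun t => (t.map MvPolynomial.X).prod).sum

/-- Alphabet for polynomials. -/
inductive PolySym : Type
  | tick
  | comma
  | semicolon

/-- A number in unary, followed by a comma. -/
def PolySym.num (m : ℕ) : List PolySym := List.replicate m PolySym.tick ++ [PolySym.comma]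

/-- The string that describes a polynomial: the number of variables, and then, for each monomial,
its variables and a semicolon. -/
def CubicPoly.encode (P : CubicPoly) : List PolySym :=
  PolySym.num P.n ++
    P.terms.flatMap fun t => (t.flatMap fun i => PolySym.num i) ++ [PolySym.semicolon]

/-! ## Polynomial time and BQP -/

/-- `f` is computable by a deterministic Turing machine in time polynomial in the length of the
encoded input. -/
def PolyTime {α β A B : Type} (ea : α → List A) (eb : β → List B) (f : α → β) : Prop :=
  Nonempty (Turing.TM2ComputableInPolyTime ea eb f)

/-- A Hadamard, phase (`|1⟩ ↦ i|1⟩`) or Toffoli gate on `l` qubits. In `toffoli a b c` the qubits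
`a`, `b` are the controls and `c` is the target. -/
inductive QGate (l : ℕ) : Type
  | hadamard (a : Fin l)
  | phase (a : Fin l)
  | toffoli (a b c : Fin l) (hab : a ≠ b) (hac : a ≠ c) (hbc : b ≠ c)

/-- The amplitudes, in the computational basis, of a (pure) state of `l` qubits. -/
abbrev QState (l : ℕ) : Type := (Fin l → Bool) → ℂ

/-- The action of a gate on states. -/
noncomputable def QGate.apply {l : ℕ} : QGate l → QState l → QState l
  | QGate.hadamard a, ψ => fun x =>
      (1 / (Real.sqrt 2 : ℂ)) * (ψ (Function.update x a false) +
        (if x a then -1 else 1) * ψ (Function.update x a true))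
  | QGate.phase a, ψ => fun x => (if x a then Complex.I else 1) * ψ x
  | QGate.toffoli a b c _ _ _, ψ => fun x => ψ (Function.update x c (xor (x c) (x a && x b)))

/-- A quantum circuit on at least one qubit; the gates are listed in order of application. -/
structure QCircuit where
  /-- the number of qubits -/
  qubits : ℕ
  qubits_pos : 0 < qubits
  /-- the gates -/
  gates : List (QGate qubits)

/-- The state that the circuit produces from `|0…0⟩`. -/
noncomputable def QCircuit.output (C : QCircuit) : QState C.qubits :=
  C.gates.foldl (fun ψ g => g.apply ψ) (Pi.single (fun _ => false) 1)

/-- The probability that measuring the first qubit of the output state gives 1. -/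
noncomputable def QCircuit.acceptProb (C : QCircuit) : ℝ :=
  ∑ x : Fin C.qubits → Bool, if x ⟨0, C.qubits_pos⟩ then ‖C.output x‖ ^ 2 else 0

/-- Alphabet for quantum circuits. -/
inductive CircSym : Type
  | tick
  | comma
  | hadamard
  | phase
  | toffoli

/-- A number in unary, followed by a comma. -/
def CircSym.num (m : ℕ) : List CircSym := List.replicate m CircSym.tick ++ [CircSym.comma]

/-- The string that describes a gate: its kind and the qubits on which it acts. -/
def QGate.encode {l : ℕ} : QGate l → List CircSym
  | QGate.hadamard a => CircSym.hadamard :: CircSym.num a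
  | QGate.phase a => CircSym.phase :: CircSym.num a
  | QGate.toffoli a b c _ _ _ =>
      CircSym.toffoli :: (CircSym.num a ++ CircSym.num b ++ CircSym.num c)

/-- The string that describes a circuit: the number of qubits and then the gates. -/
def QCircuit.encode (C : QCircuit) : List CircSym :=
  CircSym.num C.qubits ++ C.gates.flatMap QGate.encode

/-- The class of decision problems that are solved with success probability at least 2/3 by
applying to `|0…0⟩` a quantum circuit generated from the input in polynomial time, and measuring the
first qubit. -/
def BQP : Set (Language Bool) :=
  {L | ∃ C : List Bool → QCircuit, PolyTime id QCircuit.encode C ∧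
    ∀ x : List Bool, (x ∈ L → 2 / 3 ≤ (C x).acceptProb) ∧ (x ∉ L → (C x).acceptProb ≤ 1 / 3)}

/-! ## Hardness of approximation problems -/

/-- The string that describes a binary string together with a rational number: the string, a
separator, the sign bit and the binary digits of the numerator, a separator, and the binary digits
of the denominator. -/
def encodeAnswer (p : List Bool × ℚ) : List (Option Bool) :=
  p.1.map some ++ none ::
    some (decide (p.2 < 0)) :: (Computability.encodeNat p.2.num.natAbs).map some ++
      none :: (Computability.encodeNat p.2.den).map some

/-- The problem "given (the description of) an instance `i`, output a rational number within `err i`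
of `val i`" is BQP-hard: each language in BQP reduces to it in polynomial time. The reduction
computes from the input `x` one instance, `query x`, and decides, from `x` and whatever valid answer
`a` it is given for this instance, whether `x` is in the language. -/
def EstimationBQPHard {ι S : Type} (enc : ι → List S) (val err : ι → ℝ) : Prop :=
  ∀ L ∈ BQP, ∃ (query : List Bool → ι) (answer : List Bool × ℚ → Bool),
    PolyTime id enc query ∧ PolyTime encodeAnswer Computability.encodeBool answer ∧
      ∀ (x : List Bool) (a : ℚ), |(a : ℝ) - val (query x)| ≤ err (query x) →
        (answer (x, a) = true ↔ x ∈ L)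

end CubicGap

/-! Let a BQP circuit accept with probability p, and put s = 1 - 2p. The reduction produces a
circuit whose gap is a positive number times (3s - s^3)/2. The normalisation is such that every
admissible estimate has the sign of s, and this sign decides membership.

The gap is a sum over paths. If each Hadamard gate introduces a new variable, the sum of (-1)^f over
all variables is ⟨1|C|1⟩, where Hadamard gates are not normalised and 1 is the all-ones vector, i.e.
a multiple of a column of Hadamard gates applied to |0…0⟩ (`sumVars_monomials`, `exists_cubicPoly`).

A complex state is stored as a real state with one more qubit, which separates real and imaginary
parts. Each given gate then becomes a product of H, CZ and CCZ gates, up to a power of √2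
(`evolve_realize`). The resulting real circuit R runs on three disjoint copies, CZ gates join the
three copies of the measured qubit, and R is applied again in reverse order, which is its transpose
because all gates are symmetric. An internal column of Hadamard gates at each end turns the all-ones
vector into a multiple of |0…0⟩, and also ensures that every qubit is acted on
(`QCircuit.sandwich`). Modulo 2, ab + bc + ca is the majority of three bits, so the CZ gates yield
the expectation of (-1)^majority, which is (3s - s^3)/2 (`sum_majority`).

With l qubits in total and h Hadamard gates in R, the gap is 4^l 8^h (3s - s^3)/2
(`QCircuit.sum_op_sandwich`). There are n = 3l + 6h variables and the width is at most l, so the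
permitted error is at most 4^l 8^h / 3. From |s| ≥ 1/3 follows |(3s - s^3)/2| ≥ 13/27 > 1/3. A
single run would only give |s| ≥ 1/3, which does not exclude the estimate 0; hence the three copies.

For polynomial time, machines are written as flow charts over stacks and compiled (`Flow.polyTime`).
One machine turns a quantum circuit into a string of gates (`polyTime_transpile`), another follows
the current variable of each wire and writes the monomials (`polyTime_assemble`), and
`PolyTime.comp` composes them with the machine that generates the quantum circuit. The answer is the
sign bit of the estimate (`polyTime_neg`). -/

namespace CubicGap

open Turing StateTransition Function

/-! ## Composition of polynomial-time stack machines -/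

section MapStmt

variable {K K' : Type} {Γ : K → Type} {Γ' : K' → Type} {Λ Λ' σ σ' : Type}

/-- Transport of a statement to a machine with more stacks, labels and states; `fin` replaces
`halt`. -/
def mapStmt (ι : K → K') (e : ∀ k, Γ k ≃ Γ' (ι k)) (get : σ' → σ) (mk : σ → σ') (lab : Λ → Λ')
    (fin : TM2.Stmt Γ' Λ' σ') : TM2.Stmt Γ Λ σ → TM2.Stmt Γ' Λ' σ'
  | .push k f q => .push (ι k) (fun v => e k (f (get v))) (mapStmt ι e get mk lab fin q)
  | .peek k f q => .peek (ι k) (fun v o => mk (f (get v) (o.map (e k).symm)))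
      (mapStmt ι e get mk lab fin q)
  | .pop k f q => .pop (ι k) (fun v o => mk (f (get v) (o.map (e k).symm)))
      (mapStmt ι e get mk lab fin q)
  | .load f q => .load (fun v => mk (f (get v))) (mapStmt ι e get mk lab fin q)
  | .branch f q₁ q₂ => .branch (fun v => f (get v)) (mapStmt ι e get mk lab fin q₁)
      (mapStmt ι e get mk lab fin q₂)
  | .goto f => .goto fun v => lab (f (get v))
  | .halt => fin

/-- The stacks of a machine, seen among the stacks of a machine with more stacks, which are
otherwise empty. -/
def StkRel (ι : K → K') (e : ∀ k, Γ k ≃ Γ' (ι k)) (S : ∀ k, List (Γ k))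
    (S' : ∀ k, List (Γ' k)) : Prop :=
  (∀ k, S' (ι k) = (S k).map (e k)) ∧ ∀ j, (∀ k, ι k ≠ j) → S' j = []

/-- A configuration and its image in a larger machine. -/
def CfgRel (ι : K → K') (e : ∀ k, Γ k ≃ Γ' (ι k)) (mk : σ → σ') (lab : Λ → Λ')
    (fl : Option Λ') (c : TM2.Cfg Γ Λ σ) (c' : TM2.Cfg Γ' Λ' σ') : Prop :=
  c'.l = c.l.elim fl (fun x => some (lab x)) ∧ c'.var = mk c.var ∧ StkRel ι e c.stk c'.stk

variable [DecidableEq K] [DecidableEq K'] {ι : K → K'} {e : ∀ k, Γ k ≃ Γ' (ι k)}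
  {get : σ' → σ} {mk : σ → σ'} {lab : Λ → Λ'} {fin : TM2.Stmt Γ' Λ' σ'} {fl : Option Λ'}

theorem StkRel.update (hι : Injective ι) {S : ∀ k, List (Γ k)} {S' : ∀ k, List (Γ' k)}
    (h : StkRel ι e S S') (k : K) (l : List (Γ k)) :
    StkRel ι e (update S k l) (update S' (ι k) (l.map (e k))) := by
  refine ⟨fun k' => ?_, fun j hj => ?_⟩
  · by_cases hk : k' = k
    · subst hk; simp
    · rw [update_of_ne hk, update_of_ne (fun h => hk (hι h)), h.1]
  · rw [update_of_ne (hj k).symm, h.2 j hj]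

/-- By `hfin`, the replacement of `halt` changes nothing but the label. One proof thus serves both
halves of a composition: in the first half `fin` jumps to the second machine, in the second half it
halts. -/
theorem stepAux_mapStmt (hι : Injective ι) (hget : ∀ v, get (mk v) = v)
    (hfin : ∀ v S, TM2.stepAux fin (mk v) S = ⟨fl, mk v, S⟩) (q : TM2.Stmt Γ Λ σ) :
    ∀ (v : σ) (S : ∀ k, List (Γ k)) (S' : ∀ k, List (Γ' k)), StkRel ι e S S' →
      CfgRel ι e mk lab fl (TM2.stepAux q v S)
        (TM2.stepAux (mapStmt ι e get mk lab fin q) (mk v) S') := by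
  induction q with
  | push k f q ih =>
    intro v S S' h
    simp only [mapStmt, TM2.stepAux, hget]
    apply ih
    have := h.update hι k (f v :: S k)
    rwa [List.map_cons, ← h.1 k] at this
  | peek k f q ih =>
    intro v S S' h
    simp only [mapStmt, TM2.stepAux, hget]
    have : ((S' (ι k)).head?.map (e k).symm) = (S k).head? := by
      rw [h.1 k]; cases S k <;> simp
    rw [this]
    exact ih _ _ _ h
  | pop k f q ih =>
    intro v S S' h
    simp only [mapStmt, TM2.stepAux, hget]
    have : ((S' (ι k)).head?.map (e k).symm) = (S k).head? := by
      rw [h.1 k]; cases S k <;> simp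
    rw [this]
    apply ih
    have := h.update hι k (S k).tail
    rwa [List.map_tail, ← h.1 k] at this
  | load f q ih =>
    intro v S S' h
    simp only [mapStmt, TM2.stepAux, hget]
    exact ih _ _ _ h
  | branch f q₁ q₂ ih₁ ih₂ =>
    intro v S S' h
    simp only [mapStmt, TM2.stepAux, hget]
    cases f v
    · exact ih₂ _ _ _ h
    · exact ih₁ _ _ _ h
  | goto f =>
    intro v S S' h
    simp only [mapStmt, TM2.stepAux, hget]
    exact ⟨rfl, rfl, h⟩
  | halt =>
    intro v S S' h
    simp only [mapStmt, TM2.stepAux, hfin]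
    exact ⟨rfl, rfl, h⟩

theorem iterate_bind_none {α : Type*} (f : α → Option α) (t : ℕ) :
    (flip bind f)^[t] none = none := by
  induction t with
  | zero => rfl
  | succ t ih => rw [iterate_succ_apply]; exact ih

theorem iterate_mapStmt (hι : Injective ι) (hget : ∀ v, get (mk v) = v)
    (hfin : ∀ v S, TM2.stepAux fin (mk v) S = ⟨fl, mk v, S⟩)
    {M : Λ → TM2.Stmt Γ Λ σ} {M' : Λ' → TM2.Stmt Γ' Λ' σ'}
    (hM : ∀ l, M' (lab l) = mapStmt ι e get mk lab fin (M l)) (t : ℕ) :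
    ∀ (c d : TM2.Cfg Γ Λ σ) (c' : TM2.Cfg Γ' Λ' σ'), CfgRel ι e mk lab fl c c' →
      (flip bind (TM2.step M))^[t] (some c) = some d →
      ∃ d', CfgRel ι e mk lab fl d d' ∧
        (flip bind (TM2.step M'))^[t] (some c') = some d' := by
  induction t with
  | zero =>
    intro c d c' h hd
    obtain rfl : c = d := by simpa using hd
    exact ⟨c', h, rfl⟩
  | succ t ih =>
    intro c d c' h hd
    rw [iterate_succ_apply] at hd
    obtain ⟨l, v, S⟩ := c
    obtain ⟨l', v', S'⟩ := c'
    obtain ⟨h1, h2, h3⟩ := h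
    cases l with
    | none =>
      have : flip bind (TM2.step M) (some (⟨none, v, S⟩ : TM2.Cfg Γ Λ σ)) = none := rfl
      rw [this, iterate_bind_none] at hd
      cases hd
    | some l =>
      simp only [Option.elim] at h1 h2 h3
      subst h1 h2
      have := stepAux_mapStmt (lab := lab) hι hget hfin (M l) v S S' h3
      rw [← hM] at this
      obtain ⟨d', h4, h5⟩ := ih _ _ _ this hd
      exact ⟨d', h4, by rw [iterate_succ_apply]; exact h5⟩

end MapStmt

/-! ### Growth of the stacks in a run -/

section Length

variable {K : Type} [DecidableEq K] {Γ : K → Type} {Λ σ : Type}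

/-- A bound for the number of symbols that a statement pushes. -/
def pushBound : TM2.Stmt Γ Λ σ → ℕ
  | .push _ _ q => pushBound q + 1
  | .peek _ _ q => pushBound q
  | .pop _ _ q => pushBound q
  | .load _ q => pushBound q
  | .branch _ q₁ q₂ => pushBound q₁ + pushBound q₂
  | .goto _ => 0
  | .halt => 0

theorem length_stepAux_le (q : TM2.Stmt Γ Λ σ) (k : K) : ∀ (v : σ) (S : ∀ k, List (Γ k)),
    ((TM2.stepAux q v S).stk k).length ≤ (S k).length + pushBound q := by
  induction q with
  | push k' f q ih =>
    intro v S
    refine (ih _ _).trans ?_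
    by_cases h : k = k'
    · subst h; simp [pushBound]; lia
    · simp [update_of_ne h, pushBound]
  | pop k' f q ih =>
    intro v S
    refine (ih _ _).trans ?_
    by_cases h : k = k'
    · subst h; simp [pushBound]
    · simp [update_of_ne h, pushBound]
  | peek k' f q ih => intro v S; exact ih _ _
  | load f q ih => intro v S; exact ih _ _
  | branch f q₁ q₂ ih₁ ih₂ =>
    intro v S
    simp only [TM2.stepAux, pushBound]
    cases f v
    · exact (ih₂ _ _).trans (by lia)
    · exact (ih₁ _ _).trans (by lia)
  | goto f => intro v S; simp
  | halt => intro v S; simp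

/-- The running time of a second machine is measured in the length of the output of the first. This
bounds that length by the time the first machine takes. -/
theorem length_iterate_le {M : Λ → TM2.Stmt Γ Λ σ} {b : ℕ} (hb : ∀ l, pushBound (M l) ≤ b)
    (k : K) (t : ℕ) : ∀ (c d : TM2.Cfg Γ Λ σ),
      (flip bind (TM2.step M))^[t] (some c) = some d →
        (d.stk k).length ≤ (c.stk k).length + t * b := by
  induction t with
  | zero =>
    intro c d hd
    obtain rfl : c = d := by simpa using hd
    simp
  | succ t ih =>
    intro c d hd
    rw [iterate_succ_apply] at hd
    obtain ⟨l, v, S⟩ := c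
    cases l with
    | none =>
      have : flip bind (TM2.step M) (some (⟨none, v, S⟩ : TM2.Cfg Γ Λ σ)) = none := rfl
      rw [this, iterate_bind_none] at hd
      cases hd
    | some l =>
      refine (ih _ _ hd).trans ?_
      have := length_stepAux_le (M l) k v S
      have := hb l
      dsimp only
      rw [add_mul]
      lia

end Length

theorem eval_mono_nat (p : Polynomial ℕ) {a b : ℕ} (h : a ≤ b) : p.eval a ≤ p.eval b := by
  rw [Polynomial.eval_eq_sum, Polynomial.eval_eq_sum]
  exact Finset.sum_le_sum fun i _ => Nat.mul_le_mul_left _ (Nat.pow_le_pow_left h i)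

theorem initList_stk_self (tm : FinTM2) (s : List (tm.Γ tm.k₀)) :
    (initList tm s).stk tm.k₀ = s := by
  simp [initList]

theorem initList_stk_of_ne (tm : FinTM2) (s : List (tm.Γ tm.k₀)) {k : tm.K} (h : k ≠ tm.k₀) :
    (initList tm s).stk k = [] := by
  simp [initList, h]

theorem haltList_stk_self (tm : FinTM2) (s : List (tm.Γ tm.k₁)) :
    (haltList tm s).stk tm.k₁ = s := by
  simp [haltList]

theorem haltList_stk_of_ne (tm : FinTM2) (s : List (tm.Γ tm.k₁)) {k : tm.K} (h : k ≠ tm.k₁) :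
    (haltList tm s).stk k = [] := by
  simp [haltList, h]

/-! ### The machine that runs two machines in succession -/

section Comp

variable (M₁ M₂ : FinTM2) (e₀ : M₂.Γ M₂.k₀ ≃ M₁.Γ M₁.k₁)

/-- The stacks of the second machine: its input stack is the output stack of the first one. -/
def compStk (k : M₂.K) : M₁.K ⊕ M₂.K := if k = M₂.k₀ then Sum.inl M₁.k₁ else Sum.inr k

theorem compStk_injective : Injective (compStk M₁ M₂) := by
  intro a b h
  unfold compStk at h
  split_ifs at h with h1 h2 h2
  · rw [h1, h2]
  · exact Sum.inr_injective h

/-- The identification of the alphabets of the stacks of the second machine. -/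
def compEquiv (k : M₂.K) : M₂.Γ k ≃ Sum.elim M₁.Γ M₂.Γ (compStk M₁ M₂ k) :=
  if h : k = M₂.k₀ then
    ((Equiv.cast (by rw [h])).trans e₀).trans (Equiv.cast (by simp [compStk, h]))
  else Equiv.cast (by simp [compStk, h])

theorem compEquiv_heq (x : M₂.Γ M₂.k₀) : HEq (compEquiv M₁ M₂ e₀ M₂.k₀ x) (e₀ x) := by
  simp [compEquiv]

/-- The machine that runs `M₁` and then `M₂` on the output of `M₁`. -/
def compTM : FinTM2 :=
  letI := M₁.kDecidableEq
  letI := M₂.kDecidableEq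
  letI := M₁.kFin
  letI := M₂.kFin
  letI := M₁.ΛFin
  letI := M₂.ΛFin
  letI := M₁.σFin
  letI := M₂.σFin
  { K := M₁.K ⊕ M₂.K
    k₀ := Sum.inl M₁.k₀
    k₁ := compStk M₁ M₂ M₂.k₁
    Γ := Sum.elim M₁.Γ M₂.Γ
    Λ := M₁.Λ ⊕ M₂.Λ
    main := Sum.inl M₁.main
    σ := M₁.σ × M₂.σ
    initialState := (M₁.initialState, M₂.initialState)
    Γk₀Fin := M₁.Γk₀Fin
    m := Sum.elim
      (fun l => mapStmt Sum.inl (fun _ => Equiv.refl _) Prod.fst (fun v => (v, M₂.initialState))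
        Sum.inl (.goto fun _ => Sum.inr M₂.main) (M₁.m l))
      (fun l => mapStmt (compStk M₁ M₂) (compEquiv M₁ M₂ e₀) Prod.snd
        (fun v => (M₁.initialState, v)) Sum.inr .halt (M₂.m l)) }

/-- A configuration `haltList` has the initial state and no nonempty stack besides the output. At
the handover the configuration therefore looks to `M₂` like an initial one whose input is the output
of `M₁`. The jump to `M₂` is part of the step in which `M₁` would halt, so the numbers of steps
simply add. The stack `Sum.inr M₂.k₀` stays empty throughout. -/
theorem compTM_evals {s : List (M₁.Γ M₁.k₀)} {u : List (M₂.Γ M₂.k₀)} {w : List (M₂.Γ M₂.k₁)}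
    {t₁ t₂ : ℕ}
    (h₁ : (flip bind M₁.step)^[t₁] (some (initList M₁ s)) = some (haltList M₁ (u.map e₀)))
    (h₂ : (flip bind M₂.step)^[t₂] (some (initList M₂ u)) = some (haltList M₂ w)) :
    (flip bind (compTM M₁ M₂ e₀).step)^[t₂ + t₁] (some (initList (compTM M₁ M₂ e₀) s)) =
      some (haltList (compTM M₁ M₂ e₀) (w.map (compEquiv M₁ M₂ e₀ M₂.k₁))) := by
  let := M₁.kDecidableEq
  let := M₂.kDecidableEq
  have hi : CfgRel (σ' := M₁.σ × M₂.σ) (Γ' := Sum.elim M₁.Γ M₂.Γ) (Λ' := M₁.Λ ⊕ M₂.Λ) Sum.inl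
      (fun _ => Equiv.refl _) (fun v => (v, M₂.initialState)) Sum.inl (some (Sum.inr M₂.main))
      (initList M₁ s) (initList (compTM M₁ M₂ e₀) s) := by
    refine ⟨rfl, rfl, fun k => ?_, fun j hj => ?_⟩
    · by_cases hk : k = M₁.k₀
      · subst hk
        rw [initList_stk_self]
        exact (initList_stk_self (compTM M₁ M₂ e₀) s).trans (List.map_id _).symm
      · rw [initList_stk_of_ne _ _ hk]
        exact initList_stk_of_ne (compTM M₁ M₂ e₀) s (fun h => hk (Sum.inl_injective h))
    · exact initList_stk_of_ne (compTM M₁ M₂ e₀) s (hj _).symm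
  obtain ⟨d, ⟨hd1, hd2, hd3⟩, hd⟩ := iterate_mapStmt (M := M₁.m) (M' := (compTM M₁ M₂ e₀).m)
    (get := Prod.fst) (mk := fun v => (v, M₂.initialState)) (fin := .goto fun _ => Sum.inr M₂.main)
    Sum.inl_injective (fun _ => rfl) (fun _ _ => rfl) (fun _ => rfl) t₁ _ _ _ hi h₁
  have hm : CfgRel (σ' := M₁.σ × M₂.σ) (Γ' := Sum.elim M₁.Γ M₂.Γ) (Λ' := M₁.Λ ⊕ M₂.Λ)
      (compStk M₁ M₂) (compEquiv M₁ M₂ e₀) (fun v => (M₁.initialState, v)) Sum.inr none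
      (initList M₂ u) d := by
    refine ⟨hd1, hd2, fun k => ?_, fun j hj => ?_⟩
    · by_cases hk : k = M₂.k₀
      · subst hk
        rw [initList_stk_self]
        have h3 := hd3.1 M₁.k₁
        rw [haltList_stk_self] at h3
        have hk0 : compStk M₁ M₂ M₂.k₀ = Sum.inl M₁.k₁ := if_pos rfl
        -- The two stack indices are equal but not definitionally so, hence the contents have to be
        -- compared across types.
        apply eq_of_heq
        have : HEq (d.stk (compStk M₁ M₂ M₂.k₀)) (d.stk (Sum.inl M₁.k₁)) := by rw [hk0]
        refine this.trans ?_
        rw [h3]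
        simp only [List.map_map]
        have h4 : ∀ (T : Type) (hT : T = M₁.Γ M₁.k₁) (f : M₂.Γ M₂.k₀ → T),
            (∀ x, HEq (f x) (e₀ x)) →
              HEq (List.map ((fun x => x) ∘ e₀) u) (List.map f u) := by
          rintro T rfl f hf
          have : f = e₀ := funext fun x => eq_of_heq (hf x)
          rw [this]; rfl
        exact h4 _ (by rw [hk0]; rfl) _ (compEquiv_heq M₁ M₂ e₀)
      · rw [initList_stk_of_ne _ _ hk]
        have : compStk M₁ M₂ k = Sum.inr k := if_neg hk
        exact hd3.2 _ (by simp [this])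
    · cases j with
      | inl j =>
        have h3 := hd3.1 j
        rw [haltList_stk_of_ne] at h3
        · exact h3
        · rintro rfl
          exact hj M₂.k₀ (if_pos rfl)
      | inr j => exact hd3.2 _ (by simp)
  obtain ⟨c, ⟨hc1, hc2, hc3⟩, hc⟩ := iterate_mapStmt (M := M₂.m) (M' := (compTM M₁ M₂ e₀).m)
    (get := Prod.snd) (mk := fun v => (M₁.initialState, v)) (fin := .halt)
    (compStk_injective M₁ M₂) (fun _ => rfl) (fun _ _ => rfl) (fun _ => rfl) t₂ _ _ _ hm h₂
  have hfin : c = haltList (compTM M₁ M₂ e₀) (w.map (compEquiv M₁ M₂ e₀ M₂.k₁)) := by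
    obtain ⟨l, v, S⟩ := c
    dsimp only at hc1 hc2 hc3
    have hS : S = (haltList (compTM M₁ M₂ e₀) (w.map (compEquiv M₁ M₂ e₀ M₂.k₁))).stk := by
      funext j
      by_cases hj : j = compStk M₁ M₂ M₂.k₁
      · subst hj
        rw [hc3.1, haltList_stk_self]
        exact (haltList_stk_self (compTM M₁ M₂ e₀) _).symm
      · refine Eq.trans ?_ (haltList_stk_of_ne (compTM M₁ M₂ e₀) _ hj).symm
        by_cases hr : ∃ k, compStk M₁ M₂ k = j
        · obtain ⟨k, rfl⟩ := hr
          rw [hc3.1, haltList_stk_of_ne, List.map_nil]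
          rintro rfl; exact hj rfl
        · exact hc3.2 _ (fun k hk => hr ⟨k, hk⟩)
    have h1 : l = none := hc1
    have h2 : v = (M₁.initialState, M₂.initialState) := hc2
    subst h1 h2 hS
    rfl
  rw [iterate_add_apply]
  have hd' : (flip bind (compTM M₁ M₂ e₀).step)^[t₁] (some (initList (compTM M₁ M₂ e₀) s)) =
    some d := hd
  rw [hd', ← hfin]
  exact hc

end Comp

theorem PolyTime.comp {α β γ A B C : Type} {ea : α → List A} {eb : β → List B} {ec : γ → List C}
    {f : α → β} {g : β → γ} (hf : PolyTime ea eb f) (hg : PolyTime eb ec g) :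
    PolyTime ea ec (g ∘ f) := by
  classical
  obtain ⟨h₁⟩ := hf
  obtain ⟨h₂⟩ := hg
  let := h₁.tm.ΛFin
  let b := ∑ l, pushBound (h₁.tm.m l)
  have hb : ∀ l, pushBound (h₁.tm.m l) ≤ b := fun l =>
    Finset.single_le_sum (f := fun l => pushBound (h₁.tm.m l)) (fun _ _ => Nat.zero_le _)
      (Finset.mem_univ l)
  let e₀ := h₂.inputAlphabet.trans h₁.outputAlphabet.symm
  -- Each step of the first machine pushes at most `b` symbols, so an input of length m gives an
  -- output of length at most m + p₁(m) b, at which the second time bound is evaluated.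
  refine ⟨⟨⟨compTM h₁.tm h₂.tm e₀, h₁.inputAlphabet,
    (compEquiv h₁.tm h₂.tm e₀ h₂.tm.k₁).symm.trans h₂.outputAlphabet⟩,
    h₂.time.comp (Polynomial.X + h₁.time * Polynomial.C b) + h₁.time, fun a => ?_⟩⟩
  obtain ⟨⟨t₁, ht₁⟩, hle₁⟩ := h₁.outputsFun a
  obtain ⟨⟨t₂, ht₂⟩, hle₂⟩ := h₂.outputsFun (f a)
  dsimp only at hle₁ hle₂
  refine ⟨⟨t₂ + t₁, ?_⟩, ?_⟩
  · have he : List.map h₁.outputAlphabet.invFun (eb (f a)) =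
        (List.map h₂.inputAlphabet.invFun (eb (f a))).map e₀ := by
      rw [List.map_map]
      congr 1
      funext x
      simp [e₀]
    have := compTM_evals h₁.tm h₂.tm e₀ (by rw [← he]; exact ht₁) ht₂
    exact this.trans (congrArg (fun l => some (haltList (compTM h₁.tm h₂.tm e₀) l)) List.map_map)
  · have hlen := length_iterate_le hb h₁.tm.k₁ t₁ _ _ ht₁
    have h1 : (eb (f a)).length ≤ (ea a).length + h₁.time.eval (ea a).length * b := by
      have h2 : ((initList h₁.tm (List.map h₁.inputAlphabet.invFun (ea a))).stk
          h₁.tm.k₁).length ≤ (ea a).length := by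
        -- If the output stack is also the input stack, it starts with the input instead of being
        -- empty.
        by_cases hk : h₁.tm.k₁ = h₁.tm.k₀
        · rw [initList]
          simp only [hk, dite_true]
          have : ∀ (k : h₁.tm.K) (hk : k = h₁.tm.k₀) (s : List (h₁.tm.Γ h₁.tm.k₀))
              (hT : List (h₁.tm.Γ h₁.tm.k₀) = List (h₁.tm.Γ k)),
              (cast hT s).length = s.length := by
            rintro k rfl s hT; rfl
          exact (this _ hk _ _).le.trans (by simp)
        · rw [initList_stk_of_ne _ _ hk]; simp
      have h3 : ((haltList h₁.tm (List.map h₁.outputAlphabet.invFun (eb (f a)))).stk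
          h₁.tm.k₁).length = (eb (f a)).length := by
        rw [haltList_stk_self]; simp
      have h4 : t₁ * b ≤ h₁.time.eval (ea a).length * b := Nat.mul_le_mul_right _ hle₁
      refine h3.symm.le.trans (hlen.trans ?_)
      lia
    have h5 := eval_mono_nat h₂.time h1
    simp only [Polynomial.eval_add, Polynomial.eval_comp, Polynomial.eval_X,
      Polynomial.eval_mul, Polynomial.eval_C]
    lia

end CubicGap

namespace CubicGap

open Turing StateTransition Function

/-! ## Flow charts over stacks -/

/-- The contents of the stacks. -/
abbrev Stk {K : Type} (Γ : K → Type) : Type := ∀ k, List (Γ k)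

/-- An instruction of a flow chart with labels `L`. -/
inductive Instr {K : Type} (Γ : K → Type) (L : Type) : Type
  | push (k : K) (a : Γ k) (next : L)
  | pop (k : K) (next : Option (Γ k) → L)

/-- A flow chart with a single exit, the label `none`. -/
structure Flow {K : Type} (Γ : K → Type) where
  /-- the labels -/
  Λ : Type
  [fin : Fintype Λ]
  /-- the label at which the flow chart is entered -/
  entry : Option Λ
  /-- the instructions -/
  code : Λ → Instr Γ (Option Λ)

attribute [instance] Flow.fin

variable {K : Type} [DecidableEq K] {Γ : K → Type}

/-- The effect of an instruction. -/
def Instr.exec {L : Type} (S : Stk Γ) : Instr Γ L → L × Stk Γ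
  | .push k a next => (next, update S k (a :: S k))
  | .pop k next => (next (S k).head?, update S k (S k).tail)

/-- Renaming of labels. -/
def Instr.map {L L' : Type} (g : L → L') : Instr Γ L → Instr Γ L'
  | .push k a next => .push k a (g next)
  | .pop k next => .pop k fun o => g (next o)

theorem Instr.exec_map {L L' : Type} (g : L → L') (S : Stk Γ) (i : Instr Γ L) :
    (i.map g).exec S = (g (i.exec S).1, (i.exec S).2) := by
  cases i <;> rfl

namespace Flow

/-- One step of a flow chart. -/
def step (F : Flow Γ) : Option F.Λ × Stk Γ → Option F.Λ × Stk Γ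
  | (none, S) => (none, S)
  | (some l, S) => (F.code l).exec S

/-- Started with stacks `S`, the flow chart reaches its exit with stacks `S'` in at most `t` steps. -/
def Runs (F : Flow Γ) (S S' : Stk Γ) (t : ℕ) : Prop := F.step^[t] (F.entry, S) = (none, S')

theorem iterate_step_none (F : Flow Γ) (S : Stk Γ) (t : ℕ) :
    F.step^[t] (none, S) = (none, S) := by
  induction t with
  | zero => rfl
  | succ t ih => rw [iterate_succ_apply]; exact ih

/-- The exit is a fixed point of `step`, so further steps change nothing and running times may be
rounded up freely. -/
theorem Runs.mono {F : Flow Γ} {S S' : Stk Γ} {t t' : ℕ} (h : F.Runs S S' t) (ht : t ≤ t') :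
    F.Runs S S' t' := by
  obtain ⟨d, rfl⟩ := Nat.exists_eq_add_of_le' ht
  rw [Runs, iterate_add_apply, h, iterate_step_none]

/-- Simulation of a flow chart inside another one, up to its exit. -/
theorem iterate_embed {F G : Flow Γ} (g : Option F.Λ → Option G.Λ)
    (hg : ∀ l, ∃ l', g (some l) = some l' ∧ G.code l' = (F.code l).map g) {S' : Stk Γ} (t : ℕ) :
    ∀ c, F.step^[t] c = (none, S') → ∃ t' ≤ t, G.step^[t'] (g c.1, c.2) = (g none, S') := by
  induction t with
  | zero => rintro ⟨l, S⟩ h; cases h; exact ⟨0, le_rfl, rfl⟩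
  | succ t ih =>
    rintro ⟨l, S⟩ h
    cases l with
    | none =>
      rw [iterate_step_none] at h
      cases h
      exact ⟨0, Nat.zero_le _, rfl⟩
    | some l =>
      obtain ⟨l', h1, h2⟩ := hg l
      rw [iterate_succ_apply] at h
      obtain ⟨t', ht, h3⟩ := ih _ h
      refine ⟨t' + 1, Nat.succ_le_succ ht, ?_⟩
      rw [iterate_succ_apply, ← h3]
      congr 1
      simp only [h1, step, h2, Instr.exec_map]

/-- The empty flow chart. -/
def skip : Flow Γ where
  Λ := Empty
  entry := none
  code := Empty.elim

theorem runs_skip (S : Stk Γ) : (skip : Flow Γ).Runs S S 0 := rfl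

/-- Push a symbol. -/
def push (k : K) (a : Γ k) : Flow Γ where
  Λ := Unit
  entry := some ()
  code _ := .push k a none

theorem runs_push {k : K} {a : Γ k} {S S' : Stk Γ} (h : update S k (a :: S k) = S') :
    (push k a).Runs S S' 1 := by
  subst h; rfl

/-- Sequential composition. -/
def seq (F G : Flow Γ) : Flow Γ where
  Λ := F.Λ ⊕ G.Λ
  entry := F.entry.elim (G.entry.map Sum.inr) (fun l => some (Sum.inl l))
  code := Sum.elim
    (fun l => (F.code l).map fun o => o.elim (G.entry.map Sum.inr) fun l => some (Sum.inl l))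
    (fun l => (G.code l).map (Option.map Sum.inr))

theorem Runs.seq {F G : Flow Γ} {S S' S'' : Stk Γ} {t t' : ℕ} (h : F.Runs S S' t)
    (h' : G.Runs S' S'' t') : (F.seq G).Runs S S'' (t + t') := by
  obtain ⟨u, hu, h1⟩ := iterate_embed (F := F) (G := F.seq G)
    (fun o => o.elim (G.entry.map Sum.inr) fun l => some (Sum.inl l))
    (fun l => ⟨_, rfl, rfl⟩) t _ h
  obtain ⟨u', hu', h2⟩ := iterate_embed (F := G) (G := F.seq G) (Option.map Sum.inr)
    (fun l => ⟨_, rfl, rfl⟩) t' _ h'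
  refine Runs.mono (t := u' + u) ?_ (by lia)
  rw [Runs, iterate_add_apply]
  exact (congrArg _ h1).trans h2

/-- Repeat: pop a symbol `a` from the stack `k` (and leave the loop if there is none), run `body a`,
and leave the loop if `cont a` is false. -/
def loop (k : K) [Fintype (Γ k)] (cont : Γ k → Bool) (body : Γ k → Flow Γ) : Flow Γ where
  Λ := Option (Σ a, (body a).Λ)
  entry := some none
  code := fun
    | none => .pop k fun o => o.elim none fun a =>
        (body a).entry.elim (if cont a then some none else none) fun l => some (some ⟨a, l⟩)
    | some ⟨a, l⟩ => ((body a).code l).map fun o =>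
        o.elim (if cont a then some none else none) fun l => some (some ⟨a, l⟩)

section Loop

variable {k : K} [Fintype (Γ k)] {cont : Γ k → Bool} {body : Γ k → Flow Γ}

theorem runs_loop_nil {S : Stk Γ} (h : S k = []) : (loop k cont body).Runs S S 1 := by
  show ((S k).head?.elim none _, update S k (S k).tail) = _
  rw [h]
  exact congrArg (Prod.mk none) (by rw [List.tail_nil, ← h, update_eq_self])

/-- One round of the loop. The exit of `body a` is identified with the head of the loop or with its
exit, according to `cont a`. -/
theorem loop_aux {S S' : Stk Γ} {a : Γ k} {l : List (Γ k)} {t : ℕ} (h : S k = a :: l)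
    (hb : (body a).Runs (update S k l) S' t) :
    ∃ u ≤ t + 1, (loop k cont body).step^[u] (some none, S) =
      (if cont a then some none else none, S') := by
  obtain ⟨u, hu, h1⟩ := iterate_embed (F := body a) (G := loop k cont body)
    (fun o => o.elim (if cont a then some none else none) fun l => some (some ⟨a, l⟩))
    (fun l => ⟨_, rfl, rfl⟩) t _ hb
  refine ⟨u + 1, by lia, ?_⟩
  rw [iterate_succ_apply]
  refine Eq.trans ?_ h1
  congr 1
  simp only [step, loop, Instr.exec, h]
  rfl

theorem runs_loop_stop {S S' : Stk Γ} {a : Γ k} {l : List (Γ k)} {t : ℕ} (h : S k = a :: l)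
    (hc : cont a = false) (hb : (body a).Runs (update S k l) S' t) :
    (loop k cont body).Runs S S' (t + 1) := by
  obtain ⟨u, hu, h1⟩ := loop_aux (cont := cont) h hb
  rw [hc] at h1
  exact Runs.mono h1 hu

theorem runs_loop_cons {S S' S'' : Stk Γ} {a : Γ k} {l : List (Γ k)} {t t' : ℕ} (h : S k = a :: l)
    (hc : cont a = true) (hb : (body a).Runs (update S k l) S' t)
    (h' : (loop k cont body).Runs S' S'' t') :
    (loop k cont body).Runs S S'' (t + 1 + t') := by
  obtain ⟨u, hu, h1⟩ := loop_aux (cont := cont) h hb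
  rw [hc] at h1
  refine Runs.mono (t := t' + u) ?_ (by lia)
  rw [Runs, iterate_add_apply]
  exact (congrArg _ h1).trans h'

/-- A loop that starts with `r` rounds for the same symbol `x`. -/
theorem runs_loop_iterate {x : Γ k} (St : ℕ → ℕ → Stk Γ) {t : ℕ} (hc : cont x = true)
    (hb : ∀ i r, ∃ l, St i (r + 1) k = x :: l ∧
      (body x).Runs (update (St i (r + 1)) k l) (St (i + 1) r) t) {S : Stk Γ} {u : ℕ} (r : ℕ) :
    ∀ i, (loop k cont body).Runs (St (i + r) 0) S u →
      (loop k cont body).Runs (St i r) S (r * (t + 1) + u) := by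
  induction r with
  | zero => intro i h; exact h.mono (by lia)
  | succ r ih =>
    intro i h
    obtain ⟨l, h1, h2⟩ := hb i r
    refine (runs_loop_cons h1 hc h2 (ih (i + 1) ?_)).mono ?_
    · rwa [Nat.add_right_comm, Nat.add_assoc]
    · rw [Nat.succ_mul]; lia

/-- A loop that runs through `r` copies of the symbol `x`. -/
theorem runs_loop_replicate {x : Γ k} (St : ℕ → ℕ → Stk Γ) {t : ℕ} (hc : cont x = true)
    (hb : ∀ i r, ∃ l, St i (r + 1) k = x :: l ∧
      (body x).Runs (update (St i (r + 1)) k l) (St (i + 1) r) t) (r : ℕ)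
    (h0 : St r 0 k = []) :
    (loop k cont body).Runs (St 0 r) (St r 0) (r * (t + 1) + 1) := by
  refine runs_loop_iterate St hc hb r 0 ?_
  rw [Nat.zero_add]
  exact runs_loop_nil h0

/-- A loop that empties its stack, as a fold. The invariant `I` may depend on what is left of the
stack. -/
theorem runs_loop_foldl {X : Type} (St : X → List (Γ k) → Stk Γ) (f : X → Γ k → X)
    (I : X → List (Γ k) → Prop) {t : ℕ} (hk : ∀ x l, St x l k = l)
    (hu : ∀ x l l', update (St x l) k l' = St x l')
    (hb : ∀ x a l, I x (a :: l) → cont a = true ∧ I (f x a) l ∧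
      (body a).Runs (St x l) (St (f x a) l) t) (l : List (Γ k)) :
    ∀ x, I x l → (loop k cont body).Runs (St x l) (St (l.foldl f x) [])
      (l.length * (t + 1) + 1) := by
  induction l with
  | nil => intro x _; exact (runs_loop_nil (hk x [])).mono (by lia)
  | cons a l ih =>
    intro x hx
    obtain ⟨h1, h2, h3⟩ := hb x a l hx
    refine (runs_loop_cons (hk x (a :: l)) h1 (by rw [hu]; exact h3) (ih _ h2)).mono ?_
    rw [List.length_cons, Nat.succ_mul]
    lia

/-- A loop without body empties its stack. -/
theorem runs_drain {S S' : Stk Γ} {t : ℕ} (hS : update S k [] = S') (ht : (S k).length ≤ t) :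
    (loop k (fun _ => true) fun _ => skip : Flow Γ).Runs S S' (t + 1) := by
  have h := runs_loop_foldl (k := k) (cont := fun _ => true) (body := fun _ => (skip : Flow Γ))
    (X := Unit) (fun _ l => update S k l) (fun _ _ => ()) (fun _ _ => True) (t := 0)
    (fun _ _ => update_self ..) (fun _ _ _ => update_idem ..)
    (fun _ a l _ => ⟨rfl, trivial, runs_skip _⟩) (S k) () trivial
  rw [update_eq_self, hS] at h
  exact h.mono (by lia)

end Loop

/-- Push the symbols of a list, so that the last one is on top. -/
def pushes (k : K) : List (Γ k) → Flow Γ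
  | [] => skip
  | a :: l => (push k a).seq (pushes k l)

theorem runs_pushes {k : K} (l : List (Γ k)) : ∀ {S S' : Stk Γ},
    update S k (l.reverse ++ S k) = S' → (pushes k l).Runs S S' l.length := by
  induction l with
  | nil =>
    rintro S S' rfl
    rw [List.reverse_nil, List.nil_append, update_eq_self]
    exact runs_skip S
  | cons a l ih =>
    rintro S S' rfl
    refine Runs.mono ((runs_push rfl).seq (ih ?_)) (by rw [List.length_cons, add_comm])
    simp

/-- Sequential composition of a list of flow charts. -/
def seqs : List (Flow Γ) → Flow Γ
  | [] => skip
  | F :: l => F.seq (seqs l)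

end Flow

/-! ### Compilation of flow charts into stack machines -/

section Compile

/-- The next label, as a function of the symbol that was popped. -/
def popNext {L : Type} (k : K) (next : Option (Γ k) → L) (v : Option (Σ k, Γ k)) : L :=
  next (v.bind fun s => if h : s.1 = k then some (h ▸ s.2) else none)

/-- The statement for an instruction. The state is the symbol that was popped last. -/
def Instr.toStmt {L : Type} : Instr Γ L → TM2.Stmt Γ L (Option (Σ k, Γ k))
  | .push k a next => .push k (fun _ => a) (.goto fun _ => next)
  | .pop k next => .pop k (fun _ o => o.map (Sigma.mk k)) (.goto (popNext k next))

theorem Instr.stepAux_toStmt {L : Type} (i : Instr Γ L) (v : Option (Σ k, Γ k)) (S : Stk Γ) :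
    ∃ v', TM2.stepAux i.toStmt v S = ⟨some (i.exec S).1, v', (i.exec S).2⟩ := by
  cases i with
  | push k a next => exact ⟨_, rfl⟩
  | pop k next =>
    refine ⟨(S k).head?.map (Sigma.mk k), ?_⟩
    simp only [Instr.toStmt, TM2.stepAux, Instr.exec, popNext]
    congr 3
    cases (S k).head? <;> simp

variable [Fintype K] [∀ k, Fintype (Γ k)]

/-- The machine of a flow chart with input stack `k₀` and output stack `k₁`. -/
def Flow.toTM (F : Flow Γ) (k₀ k₁ : K) : FinTM2 where
  K := K
  k₀ := k₀
  k₁ := k₁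
  Γ := Γ
  Λ := Option F.Λ
  main := F.entry
  σ := Option (Σ k, Γ k)
  initialState := none
  m := fun
    | none => .load (fun _ => none) .halt
    | some l => (F.code l).toStmt

/-- The additional step is spent at the exit label: it resets the state to `none`, since a machine
must halt in its initial state. -/
theorem Flow.toTM_evals (F : Flow Γ) (k₀ k₁ : K) {S' : Stk Γ} (t : ℕ) :
    ∀ (l : Option F.Λ) (v : Option (Σ k, Γ k)) (S : Stk Γ), F.step^[t] (l, S) = (none, S') →
      ∃ t' ≤ t + 1, (flip bind (F.toTM k₀ k₁).step)^[t']
        (some (⟨some l, v, S⟩ : TM2.Cfg Γ (Option F.Λ) (Option (Σ k, Γ k)))) =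
        some (⟨none, none, S'⟩ : TM2.Cfg Γ (Option F.Λ) (Option (Σ k, Γ k))) := by
  induction t with
  | zero =>
    intro l v S h
    cases h
    exact ⟨1, le_rfl, rfl⟩
  | succ t ih =>
    intro l v S h
    cases l with
    | none =>
      rw [Flow.iterate_step_none] at h
      cases h
      exact ⟨1, by lia, rfl⟩
    | some l =>
      rw [iterate_succ_apply] at h
      obtain ⟨v', hv⟩ := (F.code l).stepAux_toStmt v S
      obtain ⟨t', ht, h1⟩ := ih _ v' _ h
      refine ⟨t' + 1, by lia, ?_⟩
      rw [iterate_succ_apply]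
      refine Eq.trans ?_ h1
      congr 1
      exact congrArg some hv

theorem initList_eq (tm : FinTM2) (s : List (tm.Γ tm.k₀)) :
    initList tm s = ⟨some tm.main, tm.initialState, update (fun _ => []) tm.k₀ s⟩ := by
  have : (initList tm s).stk = update (fun _ => []) tm.k₀ s := by
    funext k
    by_cases hk : k = tm.k₀
    · subst hk
      rw [update_self, initList_stk_self]
    · rw [update_of_ne hk, initList_stk_of_ne _ _ hk]
  rw [← this]; rfl

theorem haltList_eq (tm : FinTM2) (s : List (tm.Γ tm.k₁)) :
    haltList tm s = ⟨none, tm.initialState, update (fun _ => []) tm.k₁ s⟩ := by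
  have : (haltList tm s).stk = update (fun _ => []) tm.k₁ s := by
    funext k
    by_cases hk : k = tm.k₁
    · subst hk
      rw [update_self, haltList_stk_self]
    · rw [update_of_ne hk, haltList_stk_of_ne _ _ hk]
  rw [← this]; rfl

theorem Flow.polyTime (F : Flow Γ) (k₀ k₁ : K) {α β : Type} {ea : α → List (Γ k₀)}
    {eb : β → List (Γ k₁)} {f : α → β} (p : Polynomial ℕ)
    (h : ∀ a, F.Runs (update (fun _ => []) k₀ (ea a)) (update (fun _ => []) k₁ (eb (f a)))
      (p.eval (ea a).length)) : PolyTime ea eb f := by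
  refine ⟨⟨⟨F.toTM k₀ k₁, Equiv.refl _, Equiv.refl _⟩, p + 1, fun a => ?_⟩⟩
  have hex := Flow.toTM_evals F k₀ k₁ _ _ none _ (h a)
  refine ⟨⟨hex.choose, ?_⟩, by simpa using hex.choose_spec.1⟩
  have hid : ∀ (k : K) (l : List (Γ k)), List.map (Equiv.refl (Γ k)).invFun l = l :=
    fun k l => List.map_id l
  have hs := hex.choose_spec.2
  refine Eq.trans ?_ (hs.trans ?_)
  · refine congrArg (fun c => (flip bind (F.toTM k₀ k₁).step)^[hex.choose] (some c)) ?_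
    refine (congrArg (initList (F.toTM k₀ k₁)) (hid k₀ _)).trans ?_
    exact initList_eq (F.toTM k₀ k₁) _
  · refine congrArg some ?_
    refine Eq.trans ?_ (congrArg (haltList (F.toTM k₀ k₁)) (hid k₁ _)).symm
    exact (haltList_eq (F.toTM k₀ k₁) _).symm

end Compile

end CubicGap

namespace CubicGap

open Function

/-! ## The assembler: from strings of gates to polynomials -/

/-- Alphabet for circuits over Hadamard, Z, CZ and CCZ gates. The symbols `vo`, `vc` enclose an
argument of a diagonal gate, `fo`, `fc` a diagonal gate, and `ho`, `hc` the argument of a Hadamard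
gate. The symbol `wire` stands for an additional qubit, `layer` for Hadamard gates on all qubits. -/
inductive Sym : Type
  | tick | wire | layer | vo | vc | ho | hc | fo | fc

instance : Fintype Sym :=
  ⟨⟨([.tick, .wire, .layer, .vo, .vc, .ho, .hc, .fo, .fc] : List Sym), by simp⟩, fun x => by cases x <;> simp⟩

instance : Fintype PolySym :=
  ⟨⟨([.tick, .comma, .semicolon] : List PolySym), by simp⟩, fun x => by cases x <;> simp⟩

/-- The state of the assembler: the argument that is being read, the number of variables, the
current variables of the wires, and the monomials. -/
structure Asm where
  a : ℕ
  n : ℕ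
  cur : List ℕ
  out : List PolySym

/-- The monomials of a layer of Hadamard gates. -/
def layerOut (n : ℕ) : List ℕ → List PolySym
  | [] => []
  | c :: l => PolySym.num c ++ PolySym.num n ++ [.semicolon] ++ layerOut (n + 1) l

/-- Reading a symbol. -/
def Asm.step (s : Asm) : Sym → Asm
  | .tick => { s with a := s.a + 1 }
  | .wire => { s with cur := s.n :: s.cur, n := s.n + 1 }
  | .layer =>
    { s with n := s.n + s.cur.length
             cur := List.range' s.n s.cur.length
             out := s.out ++ layerOut s.n s.cur }
  | .vc => { s with a := 0, out := s.out ++ (s.cur.drop s.a).head?.elim [] PolySym.num }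
  | .hc => match s.cur.drop s.a with
    | [] => { s with a := 0 }
    | c :: l =>
      { a := 0
        n := s.n + 1
        cur := s.cur.take s.a ++ s.n :: l
        out := s.out ++ (PolySym.num c ++ PolySym.num s.n ++ [.semicolon]) }
  | .fc => { s with out := s.out ++ [.semicolon] }
  | _ => s

/-- The string for a polynomial that is assembled from a string of gates. -/
def assemble (w : List Sym) : List PolySym :=
  let s := w.foldl Asm.step ⟨0, 0, [], []⟩
  PolySym.num s.n ++ s.out

/-- The stacks of the assembler. -/
inductive AsmK : Type
  | inp | out | rev | A | T | N | D | E
  deriving DecidableEq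

instance : Fintype AsmK :=
  ⟨⟨([.inp, .out, .rev, .A, .T, .N, .D, .E] : List AsmK), by simp⟩, fun x => by cases x <;> simp⟩

/-- The alphabets of the stacks of the assembler. -/
def AsmΓ : AsmK → Type
  | .inp => Sym
  | .out => PolySym
  | .rev => PolySym
  | .A => Unit
  | .T => Unit
  | .N => Unit
  | .D => Bool
  | .E => Bool

instance (k : AsmK) : Fintype (AsmΓ k) := by
  cases k <;> unfold AsmΓ <;> infer_instance

/-- Stack contents of the assembler. -/
def asmStk (inp : List Sym) (out rev : List PolySym) (a t n : ℕ) (d e : List Bool) : Stk AsmΓ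
  | .inp => inp
  | .out => out
  | .rev => rev
  | .A => List.replicate a ()
  | .T => List.replicate t ()
  | .N => List.replicate n ()
  | .D => d
  | .E => e

namespace Asm

open CubicGap.Flow

/-- A number in unary on a stack of the assembler. -/
def bits (c : ℕ) : List Bool := List.replicate c true ++ [false]

/-- The current variables on a stack of the assembler. -/
def enc (cur : List ℕ) : List Bool := cur.flatMap bits

@[simp] theorem enc_nil : enc [] = [] := rfl

@[simp] theorem enc_cons (c : ℕ) (l : List ℕ) : enc (c :: l) = bits c ++ enc l := rfl

theorem enc_append (l l' : List ℕ) : enc (l ++ l') = enc l ++ enc l' := List.flatMap_append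

theorem length_enc_le {l : List ℕ} {b : ℕ} (h : ∀ c ∈ l, c ≤ b) :
    (enc l).length ≤ l.length * (b + 1) := by
  induction l with
  | nil => simp
  | cons c l ih =>
    have h1 := ih fun c hc => h c (by simp [hc])
    have h2 := h c (by simp)
    simp only [enc_cons, bits, List.length_append, List.length_replicate, List.length_cons,
      List.length_nil, Nat.succ_mul]
    lia

theorem reverse_bits (c : ℕ) : (bits c).reverse = false :: List.replicate c true := by
  simp [bits]

theorem _root_.CubicGap.PolySym.reverse_num (c : ℕ) :
    (PolySym.num c).reverse = .comma :: List.replicate c .tick := by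
  simp [PolySym.num]

section

variable {inp : List Sym} {out rev : List PolySym} {a t n : ℕ} {d e : List Bool}

theorem update_inp {x : List Sym} : update (asmStk inp out rev a t n d e) .inp x =
    asmStk x out rev a t n d e := by
  funext k; cases k <;> rfl

theorem update_D {x : List Bool} : update (asmStk inp out rev a t n d e) .D x =
    asmStk inp out rev a t n x e := by
  funext k; cases k <;> rfl

theorem update_E {x : List Bool} : update (asmStk inp out rev a t n d e) .E x =
    asmStk inp out rev a t n d x := by
  funext k; cases k <;> rfl

theorem update_A {x : ℕ} : update (asmStk inp out rev a t n d e) .A (List.replicate x ()) =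
    asmStk inp out rev x t n d e := by
  funext k; cases k <;> rfl

theorem update_T {x : ℕ} : update (asmStk inp out rev a t n d e) .T (List.replicate x ()) =
    asmStk inp out rev a x n d e := by
  funext k; cases k <;> rfl

theorem update_N {x : ℕ} : update (asmStk inp out rev a t n d e) .N (List.replicate x ()) =
    asmStk inp out rev a t x d e := by
  funext k; cases k <;> rfl

theorem update_rev {x : List PolySym} : update (asmStk inp out rev a t n d e) .rev x =
    asmStk inp out x a t n d e := by
  funext k; cases k <;> rfl

theorem runs_push_out (x : PolySym) : (push .out x : Flow AsmΓ).Runs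
    (asmStk inp out rev a t n d e) (asmStk inp (x :: out) rev a t n d e) 1 :=
  runs_push (by funext k; cases k <;> rfl)

theorem runs_push_rev (x : PolySym) : (push .rev x : Flow AsmΓ).Runs
    (asmStk inp out rev a t n d e) (asmStk inp out (x :: rev) a t n d e) 1 :=
  runs_push (by funext k; cases k <;> rfl)

theorem runs_push_D (x : Bool) : (push .D x : Flow AsmΓ).Runs
    (asmStk inp out rev a t n d e) (asmStk inp out rev a t n (x :: d) e) 1 :=
  runs_push (by funext k; cases k <;> rfl)

theorem runs_push_E (x : Bool) : (push .E x : Flow AsmΓ).Runs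
    (asmStk inp out rev a t n d e) (asmStk inp out rev a t n d (x :: e)) 1 :=
  runs_push (by funext k; cases k <;> rfl)

theorem runs_push_A : (push .A () : Flow AsmΓ).Runs
    (asmStk inp out rev a t n d e) (asmStk inp out rev (a + 1) t n d e) 1 :=
  runs_push (by funext k; cases k <;> rfl)

theorem runs_push_T : (push .T () : Flow AsmΓ).Runs
    (asmStk inp out rev a t n d e) (asmStk inp out rev a (t + 1) n d e) 1 :=
  runs_push (by funext k; cases k <;> rfl)

theorem runs_push_N : (push .N () : Flow AsmΓ).Runs
    (asmStk inp out rev a t n d e) (asmStk inp out rev a t (n + 1) d e) 1 :=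
  runs_push (by funext k; cases k <;> rfl)

end

/-- Run `F` once for each tick on `N`. -/
def forN (F : Flow AsmΓ) : Flow AsmΓ :=
  (loop .N (fun _ => true) fun _ => (push .T ()).seq F).seq
    (loop .T (fun _ => true) fun _ => push .N ())

/-- A stack can be read only by destroying it, so the ticks of `N` are parked on `T` and then moved
back. The arguments `rev`, `d` and `e` give the stacks after i rounds. -/
theorem runs_forN {F : Flow AsmΓ} {inp out a} (rev : ℕ → List PolySym)
    (d : ℕ → List Bool) (e : ℕ → List Bool) {u : ℕ}
    (h : ∀ i n t, F.Runs (asmStk inp out (rev i) a t n (d i) (e i))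
      (asmStk inp out (rev (i + 1)) a t n (d (i + 1)) (e (i + 1))) u) (n : ℕ) :
    (forN F).Runs (asmStk inp out (rev 0) a 0 n (d 0) (e 0))
      (asmStk inp out (rev n) a 0 n (d n) (e n)) (n * (u + 4) + 2) := by
  refine Runs.mono (Runs.seq
    (runs_loop_replicate (k := AsmK.N) (x := ())
      (fun i r => asmStk inp out (rev i) a i r (d i) (e i)) rfl (t := 1 + u) ?_ n rfl)
    (runs_loop_replicate (k := AsmK.T) (x := ())
      (fun i r => asmStk inp out (rev n) a r i (d n) (e n)) rfl (t := 1) ?_ n rfl)) ?_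
  · intro i r
    refine ⟨List.replicate r (), rfl, ?_⟩
    rw [update_N]
    exact runs_push_T.seq (h i r (i + 1))
  · intro i r
    refine ⟨List.replicate r (), rfl, ?_⟩
    rw [update_T]
    exact runs_push_N
  · ring_nf; lia

/-- Move entries from `D` to `E`, as many as there are ticks on `A`. -/
def seek : Flow AsmΓ :=
  loop .A (fun _ => true) fun _ => loop .D (fun b : Bool => b) fun b => push .E b

theorem runs_move {inp out rev a t n e} (c : ℕ) (d : List Bool) :
    (loop .D (fun b : Bool => b) fun b => push .E b : Flow AsmΓ).Runs
      (asmStk inp out rev a t n (bits c ++ d) e)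
      (asmStk inp out rev a t n d ((bits c).reverse ++ e)) (2 * c + 2) := by
  refine Runs.mono (runs_loop_iterate (k := AsmK.D) (cont := fun b : Bool => b)
    (body := fun b => push .E b) (x := true)
    (fun i r => asmStk inp out rev a t n (bits r ++ d) (List.replicate i true ++ e))
    (t := 1) rfl (fun i r => ⟨bits r ++ d, rfl, ?_⟩) c 0
    (runs_loop_stop (k := AsmK.D) (a := false) (l := d) (t := 1) rfl rfl ?_)) (by lia)
  · rw [update_D]; exact runs_push_E _
  · rw [update_D, reverse_bits, Nat.zero_add]; exact runs_push_E _

/-- The entries passed over lie reversed on `E`, from where `rewind` restores them. If there are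
fewer than `a` entries, the surplus ticks of `A` are consumed without effect. -/
theorem runs_seek {inp out rev t n b} (a : ℕ) : ∀ (cur : List ℕ) (e : List Bool),
    (∀ c ∈ cur, c ≤ b) → seek.Runs (asmStk inp out rev a t n (enc cur) e)
      (asmStk inp out rev 0 t n (enc (cur.drop a)) ((enc (cur.take a)).reverse ++ e))
      (a * (2 * b + 3) + 1) := by
  induction a with
  | zero =>
    intro cur e _
    exact Runs.mono (runs_loop_nil rfl) (by lia)
  | succ a ih =>
    intro cur e hb
    cases cur with
    | nil =>
      have h0 := ih [] e (by simp)
      rw [List.drop_nil, List.take_nil] at h0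
      refine Runs.mono (runs_loop_cons (k := AsmK.A) (a := ()) (l := List.replicate a ()) rfl rfl
        (t := 1) (S' := asmStk inp out rev a t n (enc []) e) ?_ h0) ?_
      · rw [update_A]
        exact runs_loop_nil rfl
      · rw [Nat.succ_mul]; lia
    | cons c cur =>
      have h0 := ih cur ((bits c).reverse ++ e) fun c hc => hb c (by simp [hc])
      rw [List.take_succ_cons, enc_cons, enc_cons, List.reverse_append, List.append_assoc]
      refine Runs.mono (runs_loop_cons (k := AsmK.A) (a := ()) (l := List.replicate a ()) rfl rfl
        (t := 2 * c + 2) ?_ h0) ?_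
      · rw [update_A]
        exact runs_move c _
      · have := hb c (by simp)
        rw [Nat.succ_mul]; lia

/-- Move everything from `E` to `D`. -/
def rewind : Flow AsmΓ := loop .E (fun _ => true) fun b : Bool => push .D b

theorem runs_rewind {inp out rev a t n} (e : List Bool) : ∀ (d : List Bool),
    rewind.Runs (asmStk inp out rev a t n d e) (asmStk inp out rev a t n (e.reverse ++ d) [])
      (e.length * 2 + 1) := by
  induction e with
  | nil => intro d; exact runs_loop_nil rfl
  | cons x e ih =>
    intro d
    rw [List.reverse_cons, List.append_assoc]
    refine Runs.mono (runs_loop_cons (k := AsmK.E) (a := x) (l := e) rfl rfl (t := 1) ?_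
      (ih (x :: d))) ?_
    · rw [update_E]; exact runs_push_D _
    · rw [List.length_cons]; lia

/-- Move an entry from `D` to `E` and write it on `rev`. -/
def fetch : Flow AsmΓ :=
  loop .D (fun b : Bool => b) fun b : Bool =>
    (push .E b).seq (push .rev (if b then PolySym.tick else PolySym.comma))

theorem runs_fetch_nil {inp out rev a t n e} : fetch.Runs (asmStk inp out rev a t n [] e)
    (asmStk inp out rev a t n [] e) 1 :=
  runs_loop_nil rfl

theorem runs_fetch {inp out rev a t n e} (c : ℕ) (d : List Bool) :
    fetch.Runs (asmStk inp out rev a t n (bits c ++ d) e)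
      (asmStk inp out ((PolySym.num c).reverse ++ rev) a t n d ((bits c).reverse ++ e))
      (3 * c + 3) := by
  refine Runs.mono (runs_loop_iterate (k := AsmK.D) (cont := fun b : Bool => b)
    (body := fun b : Bool =>
      (push .E b).seq (push .rev (if b then PolySym.tick else PolySym.comma))) (x := true)
    (fun i r => asmStk inp out (List.replicate i PolySym.tick ++ rev) a t n (bits r ++ d)
      (List.replicate i true ++ e))
    (t := 2) rfl (fun i r => ⟨bits r ++ d, rfl, ?_⟩) c 0
    (runs_loop_stop (k := AsmK.D) (a := false) (l := d) (t := 2) rfl rfl ?_)) (by lia)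
  · rw [update_D]; exact (runs_push_E _).seq (runs_push_rev _)
  · rw [update_D, reverse_bits, PolySym.reverse_num, Nat.zero_add]
    exact (runs_push_E _).seq (runs_push_rev _)

/-- Write an entry of `D` and a new variable on `rev`, and put the new variable on `E`; here for one
symbol of the entry. -/
def renewBody : Bool → Flow AsmΓ
  | true => push .rev PolySym.tick
  | false => (push .rev PolySym.comma).seq
      ((forN ((push .rev PolySym.tick).seq (push .E true))).seq ((push .E false).seq
        ((push .rev PolySym.comma).seq ((push .rev PolySym.semicolon).seq (push .N ())))))

/-- The terminator of the old entry triggers the work: each tick of `N` is copied both to the output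
and to `E`, so the new variable appears in the monomial and becomes the current one. -/
theorem runs_renewBody_false {inp out rev a n d e} :
    (renewBody false).Runs (asmStk inp out rev a 0 n d e)
      (asmStk inp out (.semicolon :: ((PolySym.num n).reverse ++ .comma :: rev)) a 0 (n + 1) d
        ((bits n).reverse ++ e)) (6 * n + 7) := by
  have h := runs_forN (inp := inp) (out := out) (a := a)
    (F := (push .rev PolySym.tick).seq (push .E true)) (u := 2)
    (fun i => List.replicate i .tick ++ .comma :: rev) (fun _ => d)
    (fun i => List.replicate i true ++ e)
    (fun i n t => (runs_push_rev _).seq (runs_push_E _)) n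
  have h1 := (runs_push_rev .comma).seq (h.seq ((runs_push_E false).seq
    ((runs_push_rev .comma).seq ((runs_push_rev .semicolon).seq runs_push_N))))
  rw [reverse_bits, PolySym.reverse_num]
  exact Runs.mono h1 (by lia)

/-- Replace entries of `D` by new variables. -/
def renew (cont : Bool → Bool) : Flow AsmΓ := loop .D cont renewBody

theorem runs_renew_nil {inp out rev a t n e} (cont : Bool → Bool) :
    (renew cont).Runs (asmStk inp out rev a t n [] e) (asmStk inp out rev a t n [] e) 1 :=
  runs_loop_nil rfl

/-- The ticks of the old entry are written to the output but not to `E`; the old variable is thereby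
dropped from the list of current ones. -/
theorem runs_renew_ticks {cont : Bool → Bool} (hc : cont true = true) {inp out rev a n d e S u}
    (c : ℕ) (h : (renew cont).Runs
      (asmStk inp out (List.replicate c .tick ++ rev) a 0 n (false :: d) e) S u) :
    (renew cont).Runs (asmStk inp out rev a 0 n (bits c ++ d) e) S (c * 2 + u) := by
  refine runs_loop_iterate (k := AsmK.D) (cont := cont) (body := renewBody) (x := true)
    (fun i r => asmStk inp out (List.replicate i .tick ++ rev) a 0 n (bits r ++ d) e)
    (t := 1) hc (fun i r => ⟨bits r ++ d, rfl, ?_⟩) c 0 ?_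
  · rw [update_D]; exact runs_push_rev _
  · rw [Nat.zero_add]; exact h

/-- With the identity as `cont`, the loop stops at the terminator of the first entry, which is what
a single Hadamard gate needs. A layer uses the constant `true` instead. -/
theorem runs_renew_one {inp out rev a n d e} (c : ℕ) :
    (renew fun b => b).Runs (asmStk inp out rev a 0 n (bits c ++ d) e)
      (asmStk inp out ((PolySym.num c ++ PolySym.num n ++ [PolySym.semicolon]).reverse ++ rev) a 0
        (n + 1) d ((bits n).reverse ++ e)) (c * 2 + (6 * n + 8)) := by
  refine runs_renew_ticks rfl c (runs_loop_stop (k := AsmK.D) (a := false) (l := d) rfl rfl ?_)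
  rw [update_D]
  convert! runs_renewBody_false using 2
  simp [PolySym.reverse_num]

theorem runs_renew_all {inp out a b} (cur : List ℕ) : ∀ (rev n e), (∀ c ∈ cur, c ≤ b) →
    n + cur.length ≤ b →
    (renew fun _ => true).Runs (asmStk inp out rev a 0 n (enc cur) e)
      (asmStk inp out ((layerOut n cur).reverse ++ rev) a 0 (n + cur.length)
        [] ((enc (List.range' n cur.length)).reverse ++ e)) (cur.length * (8 * b + 8) + 1) := by
  induction cur with
  | nil => intro rev n e _ _; exact Runs.mono (runs_loop_nil rfl) (by lia)
  | cons c cur ih =>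
    intro rev n e hc hn
    rw [List.length_cons] at hn
    have h0 := ih (PolySym.semicolon :: ((PolySym.num n).reverse ++ PolySym.comma ::
        (List.replicate c PolySym.tick ++ rev))) (n + 1) ((bits n).reverse ++ e)
        (fun c h => hc c (by simp [h])) (by lia)
    refine Runs.mono (runs_renew_ticks rfl c (runs_loop_cons (k := AsmK.D) (a := false)
      (l := enc cur) (t := 6 * n + 7) rfl rfl (S' := asmStk inp out (PolySym.semicolon ::
        ((PolySym.num n).reverse ++ PolySym.comma :: (List.replicate c PolySym.tick ++ rev))) a 0
        (n + 1) (enc cur) ((bits n).reverse ++ e)) ?_ (t' := cur.length * (8 * b + 8) + 1) ?_)) ?_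
    · rw [update_D]; exact runs_renewBody_false
    · convert! h0 using 2
      · simp [layerOut, PolySym.reverse_num]
      · simp; lia
      · simp [List.range'_succ]
    · have := hc c (by simp)
      rw [List.length_cons, Nat.succ_mul]; lia

/-- Processing a symbol. -/
def flow : Sym → Flow AsmΓ
  | .tick => push .A ()
  | .wire => (push .D false).seq ((forN (push .D true)).seq (push .N ()))
  | .layer => (renew fun _ => true).seq rewind
  | .vc => seek.seq (fetch.seq rewind)
  | .hc => seek.seq ((renew fun b => b).seq rewind)
  | .fc => push .rev PolySym.semicolon
  | _ => skip

/-- The stacks that represent a state of the assembler. -/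
def stk (s : Asm) (inp : List Sym) : Stk AsmΓ :=
  asmStk inp [] s.out.reverse s.a 0 s.n (enc s.cur) []

/-- Quadratic time suffices: `D` holds fewer than b entries of length at most b + 1, and a symbol
causes a bounded number of passes over them, or the writing of O(b) symbols for each. -/
theorem runs_flow {b : ℕ} (s : Asm) (inp : List Sym) (x : Sym) (ha : s.a ≤ b)
    (hc : ∀ c ∈ s.cur, c < s.n) (hl : s.cur.length < b) (hn : s.n + s.cur.length < b) :
    (flow x).Runs (s.stk inp) ((s.step x).stk inp) (30 * (b + 1) * (b + 1)) := by
  have hc' : ∀ c ∈ s.cur, c ≤ b := fun c h => by have := hc c h; lia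
  obtain ⟨a, n, cur, out⟩ := s
  have hlen' : ∀ k, (enc (cur.take k)).length ≤ cur.length * (b + 1) := fun k =>
    (length_enc_le (b := b) (fun c h => hc' c (List.mem_of_mem_take h))).trans
      (Nat.mul_le_mul_right _ (by simp))
  dsimp only at ha hc hl hn hc'
  cases x with
  | tick => exact Runs.mono runs_push_A (by nlinarith)
  | wire =>
    have h := (runs_push_D false).seq ((runs_forN (inp := inp) (out := []) (a := a)
      (fun _ => out.reverse) (fun i => List.replicate i true ++ false :: enc cur) (fun _ => [])
      (fun _ _ _ => runs_push_D _) n).seq runs_push_N)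
    refine Runs.mono (t := 1 + (n * (1 + 4) + 2 + 1)) ?_ (by nlinarith)
    convert! h using 1
    simp [stk, step, bits]
  | layer =>
    have h := (runs_renew_all (inp := inp) (out := []) (a := a) (b := b) cur out.reverse n [] hc'
      (by lia)).seq (runs_rewind _ _)
    have hlen : (enc (List.range' n cur.length)).length ≤ cur.length * (b + 1) := by
      have := length_enc_le (l := List.range' n cur.length) (b := b)
        (fun c h => by rw [List.mem_range'_1] at h; lia)
      simpa using this
    refine Runs.mono (t := ?_) ?_ ?_
    rotate_left
    · convert! h using 1
      simp [stk, step]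
    · simp only [List.append_nil, List.length_reverse]
      nlinarith
  | vc =>
    have h := runs_seek (inp := inp) (out := []) (rev := out.reverse) (t := 0) (n := n) a cur [] hc'
    have hlen := hlen' a
    have hp := List.take_append_drop a cur
    cases hd : cur.drop a with
    | nil =>
      rw [hd, List.append_nil] at hp
      rw [hd, hp] at h
      have h1 := h.seq (runs_fetch_nil.seq (runs_rewind _ _))
      refine Runs.mono (t := ?_) ?_ ?_
      rotate_left
      · convert! h1 using 1
        simp [stk, step, hd]
      · simp only [List.append_nil, List.length_reverse]
        rw [hp] at hlen
        nlinarith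
    | cons c l =>
      rw [hd, enc_cons] at h
      have hc1 := hc' c (by rw [← hp, hd]; simp)
      have h1 := h.seq ((runs_fetch c (enc l)).seq (runs_rewind _ _))
      refine Runs.mono (t := ?_) ?_ ?_
      rotate_left
      · convert! h1 using 1
        have : enc cur = enc (cur.take a) ++ (bits c ++ enc l) := by
          rw [← enc_cons, ← enc_append, ← hd, hp]
        simp [stk, step, hd, this]
      · simp only [List.append_nil, List.length_reverse, List.length_append, bits,
          List.length_replicate, List.length_cons, List.length_nil]
        nlinarith
  | hc =>
    have h := runs_seek (inp := inp) (out := []) (rev := out.reverse) (t := 0) (n := n) a cur [] hc'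
    have hlen := hlen' a
    have hp := List.take_append_drop a cur
    cases hd : cur.drop a with
    | nil =>
      rw [hd, List.append_nil] at hp
      rw [hd, hp] at h
      have h1 := h.seq ((runs_renew_nil fun b => b).seq (runs_rewind _ _))
      refine Runs.mono (t := ?_) ?_ ?_
      rotate_left
      · convert! h1 using 1
        simp [stk, step, hd]
      · simp only [List.append_nil, List.length_reverse]
        rw [hp] at hlen
        nlinarith
    | cons c l =>
      rw [hd, enc_cons] at h
      have hc1 := hc' c (by rw [← hp, hd]; simp)
      have h1 := h.seq ((runs_renew_one c).seq (runs_rewind _ _))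
      refine Runs.mono (t := ?_) ?_ ?_
      rotate_left
      · convert! h1 using 1
        simp [stk, step, hd, enc_append]
      · simp only [List.append_nil, List.length_reverse, List.length_append, bits,
          List.length_replicate, List.length_cons, List.length_nil]
        nlinarith
  | fc =>
    refine Runs.mono (t := 1) ?_ (by nlinarith)
    have := runs_push_rev (inp := inp) (out := []) (rev := out.reverse) (a := a) (t := 0) (n := n)
      (d := enc cur) (e := []) PolySym.semicolon
    simpa [stk, step, flow] using this
  | vo => exact Runs.mono (runs_skip _) (Nat.zero_le _)
  | ho => exact Runs.mono (runs_skip _) (Nat.zero_le _)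
  | fo => exact Runs.mono (runs_skip _) (Nat.zero_le _)

theorem length_layerOut_le {b : ℕ} (cur : List ℕ) : ∀ n, (∀ c ∈ cur, c ≤ b) →
    n + cur.length ≤ b → (layerOut n cur).length ≤ cur.length * (2 * b + 3) := by
  induction cur with
  | nil => simp [layerOut]
  | cons c cur ih =>
    intro n hc hn
    rw [List.length_cons] at hn
    have h := ih (n + 1) (fun c h => hc c (by simp [h])) (by lia)
    have := hc c (by simp)
    simp only [layerOut, PolySym.num, List.length_append, List.length_replicate, List.length_cons,
      List.length_nil, Nat.succ_mul]
    lia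

/-- A bound for the variables of the polynomial for a string of length `L`. -/
def bound (L : ℕ) : ℕ := (L + 2) * (L + 2)

/-- An invariant of the assembler, for an input of length `L` of which `r` symbols are left;
each symbol may add `W` symbols to the output. -/
structure Inv (L W : ℕ) (s : Asm) (r : ℕ) : Prop where
  a_le : s.a + r ≤ L
  cur_le : s.cur.length + r ≤ L
  n_le : s.n + r * (L + 1) ≤ L * (L + 1)
  cur_lt : ∀ c ∈ s.cur, c < s.n
  out_le : s.out.length + r * W ≤ L * W

/-- A symbol creates at most one variable per wire, hence at most L, and L symbols keep the number
of variables below L(L + 1). The costliest symbol for the output is `layer`, with a monomial of at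
most 2b + 3 symbols for each wire. -/
theorem Inv.step {L W : ℕ} {s : Asm} {r : ℕ} (hW : bound L * (2 * bound L + 3) ≤ W)
    (h : Inv L W s (r + 1)) (x : Sym) : Inv L W (s.step x) r := by
  obtain ⟨h1, h2, h3, h4, h5⟩ := h
  obtain ⟨a, n, cur, out⟩ := s
  dsimp only at h1 h2 h3 h4 h5
  have hL : L * (L + 1) + L + 2 ≤ bound L := by unfold bound; nlinarith
  generalize bound L = b at *
  rw [Nat.succ_mul] at h3 h5
  have hb : 2 * b + 3 ≤ b * (2 * b + 3) := by nlinarith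
  have hn : n + cur.length ≤ b := by nlinarith
  have hc : ∀ c ∈ cur, c ≤ b := fun c h => by have := h4 c h; lia
  cases x with
  | tick => refine ⟨?_, ?_, ?_, h4, ?_⟩ <;> simp only [Asm.step] <;> lia
  | wire =>
    refine ⟨by simp only [Asm.step]; lia, by simp only [Asm.step, List.length_cons]; lia,
      by simp only [Asm.step]; lia, ?_, by simp only [Asm.step]; lia⟩
    intro c hc
    simp only [Asm.step, List.mem_cons] at hc ⊢
    rcases hc with rfl | hc
    · lia
    · have := h4 c hc; lia
  | layer =>
    refine ⟨by simp only [Asm.step]; lia, by simp only [Asm.step, List.length_range']; lia,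
      by simp only [Asm.step]; lia, ?_, ?_⟩
    · intro c hc
      simp only [Asm.step, List.mem_range'_1] at hc ⊢
      lia
    · have h6 := length_layerOut_le cur n hc hn
      have h7 : cur.length * (2 * b + 3) ≤ b * (2 * b + 3) := Nat.mul_le_mul_right _ (by lia)
      simp only [Asm.step, List.length_append]
      lia
  | vc =>
    refine ⟨by simp only [Asm.step]; lia, by simp only [Asm.step]; lia,
      by simp only [Asm.step]; lia, h4, ?_⟩
    have h6 : ((cur.drop a).head?.elim [] PolySym.num).length ≤ b + 1 := by
      cases hd : cur.drop a with
      | nil => simp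
      | cons c l =>
        have := hc c (List.mem_of_mem_drop (by rw [hd]; simp))
        simp [PolySym.num, this]
    simp only [Asm.step, List.length_append]
    lia
  | hc =>
    have hp := List.take_append_drop a cur
    cases hd : cur.drop a with
    | nil =>
      simp only [Asm.step, hd]
      exact ⟨by simp only; lia, by simp only; lia, by simp only; lia, h4, by simp only; lia⟩
    | cons c l =>
      rw [hd] at hp
      have h6 := hc c (by rw [← hp]; simp)
      have h7 : (cur.take a ++ n :: l).length = cur.length := by
        conv_rhs => rw [← hp]
        simp
      simp only [Asm.step, hd]
      refine ⟨by simp only; lia, by simp only [h7]; lia, by simp only; lia, ?_, ?_⟩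
      · intro c' hc'
        simp only [List.mem_append, List.mem_cons] at hc' ⊢
        have : c' ∈ cur ∨ c' = n := by rw [← hp]; simp only [List.mem_append, List.mem_cons]; tauto
        rcases this with h | rfl
        · have := h4 c' h; lia
        · lia
      · simp only [PolySym.num, List.length_append, List.length_replicate, List.length_cons,
          List.length_nil]
        lia
  | fc =>
    refine ⟨?_, ?_, ?_, h4, ?_⟩ <;>
      simp only [Asm.step, List.length_append, List.length_singleton] <;> lia
  | vo => refine ⟨?_, ?_, ?_, h4, ?_⟩ <;> simp only [Asm.step] <;> lia
  | ho => refine ⟨?_, ?_, ?_, h4, ?_⟩ <;> simp only [Asm.step] <;> lia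
  | fo => refine ⟨?_, ?_, ?_, h4, ?_⟩ <;> simp only [Asm.step] <;> lia

/-- The assembler. -/
def program : Flow AsmΓ :=
  (loop .inp (fun _ => true) flow).seq ((loop .A (fun _ => true) fun _ => skip).seq
    ((loop .D (fun _ => true) fun _ => skip).seq
      ((loop .rev (fun _ => true) fun x : PolySym => push .out x).seq ((push .out PolySym.comma).seq
        (loop .N (fun _ => true) fun _ => push .out PolySym.tick)))))

theorem runs_loop_rev {n} (rev : List PolySym) : ∀ out,
    (loop .rev (fun _ => true) fun x : PolySym => push .out x : Flow AsmΓ).Runs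
      (asmStk [] out rev 0 0 n [] []) (asmStk [] (rev.reverse ++ out) [] 0 0 n [] [])
      (rev.length * 2 + 1) := by
  induction rev with
  | nil => intro out; exact runs_loop_nil rfl
  | cons x rev ih =>
    intro out
    rw [List.reverse_cons, List.append_assoc]
    refine Runs.mono (runs_loop_cons (k := AsmK.rev) (a := x) (l := rev) rfl rfl (t := 1) ?_
      (ih (x :: out))) ?_
    · rw [update_rev]; exact runs_push_out _
    · rw [List.length_cons]; lia

theorem runs_loop_N {out} (n : ℕ) :
    (loop .N (fun _ => true) fun _ => push .out PolySym.tick : Flow AsmΓ).Runs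
      (asmStk [] out [] 0 0 n [] []) (asmStk [] (List.replicate n .tick ++ out) [] 0 0 0 [] [])
      (n * 2 + 1) := by
  refine runs_loop_replicate (k := AsmK.N) (cont := fun _ => true) (x := ())
    (fun i r => asmStk [] (List.replicate i .tick ++ out) [] 0 0 r [] []) rfl (t := 1) ?_ n rfl
  intro i r
  refine ⟨List.replicate r (), rfl, ?_⟩
  rw [update_N]
  exact runs_push_out _

/-- A bound for the running time of the assembler. -/
def time (L b : ℕ) : ℕ :=
  L * (30 * (b + 1) * (b + 1) + 1) + 1 + (b + 1 + (b * (b + 1) + 1 + (L * (b * (2 * b + 3)) * 2 + 1 +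
    (1 + (b * 2 + 1)))))

/-- The encoding starts with the number of variables, which is known only at the end. The monomials
are therefore collected on `rev`, turned over onto `out`, and the number is pushed in front of them.
-/
theorem runs_program (w : List Sym) :
    program.Runs (asmStk w [] [] 0 0 0 [] []) (asmStk [] (assemble w) [] 0 0 0 [] [])
      (time w.length (bound w.length)) := by
  have hL : w.length * (w.length + 1) + w.length + 2 ≤ bound w.length := by unfold bound; nlinarith
  have hI : ∀ (l : List Sym) (s : Asm), Inv w.length (bound w.length * (2 * bound w.length + 3)) s l.length →
      Inv w.length (bound w.length * (2 * bound w.length + 3)) (l.foldl Asm.step s) 0 := by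
    intro l
    induction l with
    | nil => intro s h; exact h
    | cons x l ih => intro s h; exact ih _ (h.step le_rfl x)
  have h0 : Inv w.length (bound w.length * (2 * bound w.length + 3)) ⟨0, 0, [], []⟩ w.length := ⟨by simp, by simp, by simp, by simp, by simp⟩
  have h1 : (loop .inp (fun _ => true) flow).Runs _ ((w.foldl Asm.step ⟨0, 0, [], []⟩).stk []) _ :=
    runs_loop_foldl (k := AsmK.inp) (cont := fun _ => true) (body := flow)
    (fun (s : Asm) (l : List Sym) => s.stk l) Asm.step (fun s l => Inv w.length (bound w.length * (2 * bound w.length + 3)) s l.length)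
    (t := 30 * (bound w.length + 1) * (bound w.length + 1)) (fun _ _ => rfl)
    (fun _ _ _ => update_inp) (by
      intro s x l h
      refine ⟨rfl, h.step le_rfl x, ?_⟩
      obtain ⟨h1, h2, h3, h4, h5⟩ := h
      refine runs_flow s l x ?_ h4 ?_ ?_
      · lia
      · lia
      · nlinarith) w ⟨0, 0, [], []⟩ h0
  have h2 := hI w _ h0
  have hout : assemble w = PolySym.num (w.foldl Asm.step ⟨0, 0, [], []⟩).n ++
    (w.foldl Asm.step ⟨0, 0, [], []⟩).out := rfl
  rw [hout]
  generalize hs : w.foldl Asm.step ⟨0, 0, [], []⟩ = s at *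
  obtain ⟨a, n, cur, out⟩ := s
  obtain ⟨h3, h4, h5, h6, h7⟩ := h2
  dsimp only at h3 h4 h5 h6 h7
  have hlen := length_enc_le (l := cur) (b := bound w.length) (fun c h => by have := h6 c h; lia)
  have hlen' : cur.length * (bound w.length + 1) ≤ bound w.length * (bound w.length + 1) :=
    Nat.mul_le_mul_right _ (by lia)
  have hA : (loop .A (fun _ => true) fun _ => skip : Flow AsmΓ).Runs
      (asmStk [] [] out.reverse a 0 n (enc cur) []) (asmStk [] [] out.reverse 0 0 n (enc cur) [])
      (bound w.length + 1) := by
    exact runs_drain (update_A (x := 0)) 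
      ((List.length_replicate (n := a)).le.trans (by lia))
  have hD : (loop .D (fun _ => true) fun _ => skip : Flow AsmΓ).Runs
      (asmStk [] [] out.reverse 0 0 n (enc cur) []) (asmStk [] [] out.reverse 0 0 n [] [])
      (bound w.length * (bound w.length + 1) + 1) := by
    exact runs_drain update_D (hlen.trans hlen')
  have hF := h1.seq (hA.seq (hD.seq ((runs_loop_rev out.reverse []).seq
    ((runs_push_out .comma).seq (runs_loop_N n)))))
  rw [List.reverse_reverse, List.append_nil, List.length_reverse] at hF
  have he : PolySym.num n ++ out = List.replicate n .tick ++ .comma :: out := by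
    simp [PolySym.num]
  rw [he]
  have hn : n ≤ bound w.length := by lia
  rw [Nat.zero_mul, Nat.add_zero] at h7
  refine Runs.mono hF ?_
  unfold time
  gcongr
  exact le_rfl

theorem _root_.CubicGap.polyTime_assemble : PolyTime id id assemble := by
  refine program.polyTime (k₀ := AsmK.inp) (k₁ := AsmK.out) (ea := fun w : List Sym => w)
    (eb := fun w : List PolySym => w) (p := ?_) (fun w => ?_)
  · exact let L := Polynomial.X
      let b := (L + 2) * (L + 2)
      L * (30 * (b + 1) * (b + 1) + 1) + 1 + (b + 1 + (b * (b + 1) + 1 +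
        (L * (b * (2 * b + 3)) * 2 + 1 + (1 + (b * 2 + 1)))))
  · refine Runs.mono (t := time w.length (bound w.length)) ?_ ?_
    · convert runs_program w using 1
      · funext k; cases k <;> rfl
      · funext k; cases k <;> rfl
    · simp [time, bound]
      exact le_rfl

end Asm

end CubicGap

namespace CubicGap

open Function

/-! ## From quantum circuits to circuits over Hadamard, Z, CZ and CCZ gates -/

namespace Gate

/-- The gate on other qubits. -/
def map {l l' : ℕ} (f : Fin l ↪ Fin l') : Gate l → Gate l'
  | H i => H (f i)
  | Z i => Z (f i)
  | CZ i j hij => CZ (f i) (f j) (f.injective.ne hij)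
  | CCZ i j k hij hik hjk =>
    CCZ (f i) (f j) (f k) (f.injective.ne hij) (f.injective.ne hik) (f.injective.ne hjk)

/-- The gate with its arguments in reverse order. -/
def flip {l : ℕ} : Gate l → Gate l
  | H i => H i
  | Z i => Z i
  | CZ i j hij => CZ j i hij.symm
  | CCZ i j k hij hik hjk => CCZ k j i hjk.symm hik.symm hij.symm

end Gate

/-- An argument of a diagonal gate. -/
def Sym.var (i : ℕ) : List Sym := .vo :: (List.replicate i .tick ++ [.vc])

/-- The string for a Hadamard gate. -/
def Sym.had (i : ℕ) : List Sym := .ho :: (List.replicate i .tick ++ [.hc])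

/-- The string that describes a gate. -/
def Gate.encode {l : ℕ} : Gate l → List Sym
  | H i => Sym.had i
  | Z i => .fo :: (Sym.var i ++ [.fc])
  | CZ i j _ => .fo :: (Sym.var i ++ (Sym.var j ++ [.fc]))
  | CCZ i j k _ _ _ => .fo :: (Sym.var i ++ (Sym.var j ++ (Sym.var k ++ [.fc])))

/-- A gate as a sequence of real gates, up to a factor; the additional qubit `0` is 0 for the real
part of a state and 1 for its imaginary part. -/
def QGate.realize {l : ℕ} : QGate l → List (Gate (l + 1))
  | hadamard a => [.H a.succ]
  -- Without normalisation H Z H = 2X. Controlled by `a`, the product first applies Z and then X to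
  -- qubit 0, which sends (re, im) to (-im, re): multiplication by i.
  | phase a => [.CZ a.succ 0 (Fin.succ_ne_zero a), .H 0, .CZ a.succ 0 (Fin.succ_ne_zero a), .H 0]
  -- Conjugation by H on the target turns the phase of CCZ into a controlled negation, up to the
  -- factor 2.
  | toffoli a b c hab hac hbc =>
    [.H c.succ, .CCZ a.succ b.succ c.succ ((Fin.succ_injective l).ne hab)
      ((Fin.succ_injective l).ne hac) ((Fin.succ_injective l).ne hbc), .H c.succ]

/-- The qubits of three copies of a circuit. -/
def copyEmb (m : ℕ) (j : Fin 3) : Fin m ↪ Fin (m * 3) :=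
  ⟨fun q => finProdFinEquiv (q, j), fun a b h => by simpa using h⟩

theorem copyEmb_val {m : ℕ} (j : Fin 3) (q : Fin m) :
    (copyEmb m j q : ℕ) = 3 * (q : ℕ) + (j : ℕ) := by
  exact (add_comm _ _ : (j : ℕ) + 3 * (q : ℕ) = _)

/-- A list of gates, applied to each of three copies. -/
def triple {m : ℕ} (G : List (Gate m)) : List (Gate (m * 3)) :=
  [(0 : Fin 3), 1, 2].flatMap fun j => G.map (Gate.map (copyEmb m j))

/-- The phase that is negative if the majority of the copies of a qubit are 1. -/
def majority {m : ℕ} (q : Fin m) : List (Gate (m * 3)) :=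
  [.CZ (copyEmb m 0 q) (copyEmb m 1 q) (by simp [Fin.ext_iff, copyEmb_val]),
   .CZ (copyEmb m 1 q) (copyEmb m 2 q) (by simp [Fin.ext_iff, copyEmb_val]),
   .CZ (copyEmb m 0 q) (copyEmb m 2 q) (by simp [Fin.ext_iff, copyEmb_val])]

/-- The gates for three copies of a circuit. -/
def QCircuit.tripled (C : QCircuit) : List (Gate ((C.qubits + 1) * 3)) :=
  C.gates.flatMap fun g => triple g.realize

/-- The exchange of opening and closing symbols. -/
def Sym.swap : Sym → Sym
  | .vo => .vc
  | .vc => .vo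
  | .ho => .hc
  | .hc => .ho
  | .fo => .fc
  | .fc => .fo
  | s => s

/-- The string for the circuit that estimates the majority of three runs of a quantum circuit. -/
def QCircuit.transpile (C : QCircuit) : List Sym :=
  -- Reversal makes every closing symbol an opening one, and `Sym.swap` repairs this. The mirrored
  -- string describes the gates in reverse order, each with its arguments reversed.
  let w := Sym.layer :: C.tripled.flatMap Gate.encode
  List.replicate ((C.qubits + 1) * 3) .wire ++
    (w ++ ((majority (Fin.succ ⟨0, C.qubits_pos⟩)).flatMap Gate.encode ++
      (w.map Sym.swap).reverse))

/-! ## The machine for the transformation of circuits -/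

/-- The stacks of the machine. -/
inductive TrK : Type
  | inp | out | rev | T
  | R (i : Fin 3)
  deriving DecidableEq, Fintype

/-- The alphabets of the stacks. -/
def TrΓ : TrK → Type
  | .inp => CircSym
  | .out => Sym
  | .rev => Sym
  | .T => Unit
  | .R _ => Unit

instance : Fintype CircSym :=
  ⟨⟨([.tick, .comma, .hadamard, .phase, .toffoli] : List CircSym), by simp⟩,
    fun x => by cases x <;> simp⟩

instance (k : TrK) : Fintype (TrΓ k) := by
  cases k <;> unfold TrΓ <;> infer_instance

/-- Stack contents. -/
def trStk (inp : List CircSym) (out rev : List Sym) (t : ℕ) (r : Fin 3 → ℕ) : Stk TrΓ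
  | .inp => inp
  | .out => out
  | .rev => rev
  | .T => List.replicate t ()
  | .R i => List.replicate (r i) ()

namespace Tr

open CubicGap.Flow

section

variable {inp : List CircSym} {out rev : List Sym} {t : ℕ} {r : Fin 3 → ℕ}

theorem update_inp {x : List CircSym} : update (trStk inp out rev t r) .inp x =
    trStk x out rev t r := by
  funext k; cases k <;> rfl

theorem update_rev {x : List Sym} : update (trStk inp out rev t r) .rev x =
    trStk inp out x t r := by
  funext k; cases k <;> rfl

theorem update_out {x : List Sym} : update (trStk inp out rev t r) .out x =
    trStk inp x rev t r := by
  funext k; cases k <;> rfl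

theorem update_T {x : ℕ} : update (trStk inp out rev t r) .T (List.replicate x ()) =
    trStk inp out rev x r := by
  funext k; cases k <;> rfl

theorem update_R {i : Fin 3} {x : ℕ} :
    update (trStk inp out rev t r) (.R i) (List.replicate x ()) =
      trStk inp out rev t (update r i x) := by
  funext k
  cases k with
  | R j =>
    by_cases h : j = i
    · subst h; simp [trStk]
    · rw [update_of_ne (by simpa using h)]; simp [trStk, update_of_ne h]
  | _ => rfl

theorem runs_push_out (x : Sym) : (push .out x : Flow TrΓ).Runs
    (trStk inp out rev t r) (trStk inp (x :: out) rev t r) 1 :=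
  runs_push update_out

theorem runs_push_rev (x : Sym) : (push .rev x : Flow TrΓ).Runs
    (trStk inp out rev t r) (trStk inp out (x :: rev) t r) 1 :=
  runs_push update_rev

theorem runs_push_T : (push .T () : Flow TrΓ).Runs
    (trStk inp out rev t r) (trStk inp out rev (t + 1) r) 1 :=
  runs_push (update_T (x := t + 1))

theorem runs_push_R (i : Fin 3) : (push (.R i) () : Flow TrΓ).Runs
    (trStk inp out rev t r) (trStk inp out rev t (update r i (r i + 1))) 1 :=
  runs_push (update_R (x := r i + 1))

end

/-- Run `F` once for each tick in a register. -/
def forR (i : Fin 3) (F : Flow TrΓ) : Flow TrΓ :=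
  (loop (.R i) (fun _ => true) fun _ => (push .T ()).seq F).seq
    (loop .T (fun _ => true) fun _ => push (.R i) ())

theorem runs_forR {i : Fin 3} {F : Flow TrΓ} {inp r} (out rev : ℕ → List Sym) {u : ℕ}
    (h : ∀ j t r, F.Runs (trStk inp (out j) (rev j) t r)
      (trStk inp (out (j + 1)) (rev (j + 1)) t r) u) :
    (forR i F).Runs (trStk inp (out 0) (rev 0) 0 r) (trStk inp (out (r i)) (rev (r i)) 0 r)
      (r i * (u + 4) + 2) := by
  have h1 := runs_loop_replicate (k := TrK.R i) (cont := fun _ => true)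
    (body := fun _ => (push .T ()).seq F) (x := ())
    (fun j n => trStk inp (out j) (rev j) j (update r i n)) rfl (t := 1 + u) (by
      intro j n
      refine ⟨List.replicate n (), ?_, ?_⟩
      · simp only [trStk, update_self]; rfl
      · rw [update_R, update_idem]
        exact runs_push_T.seq (h j _ _)) (r i) (by simp [trStk])
  have h2 := runs_loop_replicate (k := TrK.T) (cont := fun _ => true)
    (body := fun _ => (push (.R i) () : Flow TrΓ)) (x := ())
    (fun j n => trStk inp (out (r i)) (rev (r i)) n (update r i j)) rfl (t := 1) (by
      intro j n
      refine ⟨List.replicate n (), rfl, ?_⟩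
      rw [update_T]
      have := runs_push_R (inp := inp) (out := out (r i)) (rev := rev (r i)) (t := n)
        (r := update r i j) i
      rwa [update_idem, update_self] at this) (r i) rfl
  rw [update_eq_self] at h1 h2
  exact Runs.mono (h1.seq h2) (by ring_nf; lia)

/-- Write a symbol, and its mirror image. -/
def put (x : Sym) : Flow TrΓ := (push .rev x).seq (push .out x.swap)

/-- Pushing onto a stack builds a string from its end. After all symbols of a string w have been
put, `out` carries the mirror image of w, while `rev` carries w reversed, which later yields w
itself when moved onto `out`. -/
theorem runs_put {inp out rev t r} (x : Sym) : (put x).Runs (trStk inp out rev t r)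
    (trStk inp (x.swap :: out) (x :: rev) t r) 2 :=
  (runs_push_rev x).seq (runs_push_out _)

/-- A symbol, or thrice the number in a register. -/
inductive Item : Type
  | lit (x : Sym)
  | reg (i : Fin 3)

/-- The string described by an item. -/
def Item.eval (r : Fin 3 → ℕ) : Item → List Sym
  | lit x => [x]
  | reg i => List.replicate (3 * r i) .tick

/-- Write an item. -/
def Item.flow : Item → Flow TrΓ
  | lit x => put x
  | reg i => forR i ((put .tick).seq ((put .tick).seq (put .tick)))

/-- The stacks after writing a string. -/
theorem Item.runs_flow {inp out rev r b} (hr : ∀ i, r i ≤ b) (x : Item) :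
    x.flow.Runs (trStk inp out rev 0 r)
      (trStk inp (((x.eval r).map Sym.swap).reverse ++ out) ((x.eval r).reverse ++ rev) 0 r)
      (10 * b + 2) := by
  cases x with
  | lit x => exact Runs.mono (runs_put x) (by lia)
  | reg i =>
    have h := runs_forR (i := i) (F := (put .tick).seq ((put .tick).seq (put .tick)))
      (inp := inp) (r := r) (fun j => List.replicate (3 * j) .tick ++ out)
      (fun j => List.replicate (3 * j) .tick ++ rev)
      (fun j t r => (runs_put _).seq ((runs_put _).seq (runs_put _)))
    refine Runs.mono (t := r i * (2 + (2 + 2) + 4) + 2) ?_ (by have := hr i; lia)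
    simpa [Item.eval, Item.flow, Sym.swap] using h

/-- Write a list of items. -/
def write (l : List Item) : Flow TrΓ := seqs (l.map Item.flow)

theorem runs_write {inp r b} (hr : ∀ i, r i ≤ b) (l : List Item) : ∀ out rev,
    (write l).Runs (trStk inp out rev 0 r)
      (trStk inp (((l.flatMap (Item.eval r)).map Sym.swap).reverse ++ out)
        ((l.flatMap (Item.eval r)).reverse ++ rev) 0 r) (l.length * (10 * b + 2)) := by
  induction l with
  | nil => intro out rev; exact Runs.mono (runs_skip _) (Nat.zero_le _)
  | cons x l ih =>
    intro out rev
    have h := (x.runs_flow (inp := inp) (out := out) (rev := rev) hr).seq (ih _ _)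
    refine Runs.mono (t := 10 * b + 2 + l.length * (10 * b + 2)) ?_ ?_
    · rw [List.flatMap_cons, List.map_append, List.reverse_append, List.reverse_append,
        List.append_assoc, List.append_assoc]
      exact h
    · rw [List.length_cons, add_mul, add_comm, one_mul]

theorem length_flatMap_eval_le {r b} (hr : ∀ i, r i ≤ b) (l : List Item) :
    (l.flatMap (Item.eval r)).length ≤ l.length * (3 * b + 1) := by
  induction l with
  | nil => simp
  | cons x l ih =>
    have h : (x.eval r).length ≤ 3 * b + 1 := by
      cases x with
      | lit x => simp [Item.eval]
      | reg i => simpa [Item.eval] using by have := hr i; lia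
    rw [List.flatMap_cons, List.length_append, List.length_cons, add_mul]
    lia

/-- Empty the registers. -/
def clear : Flow TrΓ :=
  (loop (.R 0) (fun _ => true) fun _ => skip).seq
    ((loop (.R 1) (fun _ => true) fun _ => skip).seq (loop (.R 2) (fun _ => true) fun _ => skip))

theorem runs_clear {inp out rev t r b} (hr : ∀ i, r i ≤ b) :
    clear.Runs (trStk inp out rev t r) (trStk inp out rev t 0) (3 * b + 3) := by
  have h (i : Fin 3) (r : Fin 3 → ℕ) (hr : r i ≤ b) :
      (loop (.R i) (fun _ => true) fun _ => skip : Flow TrΓ).Runs (trStk inp out rev t r)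
        (trStk inp out rev t (update r i 0)) (b + 1) :=
    runs_drain (update_R (x := 0)) ((List.length_replicate (n := r i)).le.trans hr)
  refine Runs.mono (t := b + 1 + (b + 1 + (b + 1))) ?_ (by lia)
  have := (h 0 r (hr 0)).seq ((h 1 _ ?_).seq (h 2 _ ?_))
  · have h0 : update (update (update r 0 0) 1 0) 2 0 = (0 : Fin 3 → ℕ) := by
      funext i; fin_cases i <;> simp
    rwa [h0] at this
  · simpa using hr 1
  · simpa using hr 2

/-- Read a number into a register. -/
def readNum (i : Fin 3) : Flow TrΓ :=
  loop .inp (fun | CircSym.tick => true | _ => false) fun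
    | CircSym.tick => push (.R i) ()
    | _ => skip

theorem runs_readNum {inp out rev t r} (i : Fin 3) (m : ℕ) (hr : r i = 0) :
    (readNum i).Runs (trStk (CircSym.num m ++ inp) out rev t r)
      (trStk inp out rev t (update r i m)) (2 * m + 1) := by
  have h := runs_loop_iterate (k := TrK.inp)
    (cont := fun | CircSym.tick => true | _ => false)
    (body := fun | CircSym.tick => (push (.R i) () : Flow TrΓ) | _ => skip) (x := CircSym.tick)
    (fun j n => trStk (CircSym.num n ++ inp) out rev t (update r i j))
    (t := 1) rfl (fun j n => ⟨CircSym.num n ++ inp, rfl, by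
      rw [update_inp]
      have := runs_push_R (inp := CircSym.num n ++ inp) (out := out) (rev := rev) (t := t)
        (r := update r i j) i
      rwa [update_idem, update_self] at this⟩) m 0
    (runs_loop_stop (k := TrK.inp) (a := CircSym.comma) (l := inp) (t := 0) rfl rfl
      (by rw [update_inp, Nat.zero_add]; exact runs_skip _))
  rw [← hr, update_eq_self] at h
  exact Runs.mono h (by lia)

/-- The number of a wire in copy `j`: for the qubit in a register, or the additional qubit. -/
def wireItems : Option (Fin 3) → Fin 3 → List Item
  | none, j => List.replicate j (.lit .tick)
  | some i, j => .reg i :: List.replicate (3 + j) (.lit .tick)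

/-- The items for a Hadamard gate. -/
def hadItems (o : Option (Fin 3)) (j : Fin 3) : List Item :=
  .lit .ho :: (wireItems o j ++ [.lit .hc])

/-- The items for an argument of a diagonal gate. -/
def varItems (j : Fin 3) (o : Option (Fin 3)) : List Item :=
  .lit .vo :: (wireItems o j ++ [.lit .vc])

/-- The items for a diagonal gate. -/
def diagItems (l : List (Option (Fin 3))) (j : Fin 3) : List Item :=
  .lit .fo :: (l.flatMap (varItems j) ++ [.lit .fc])

/-- The items for the three copies of a gate. -/
def gateItems : CircSym → List Item
  | .hadamard => [0, 1, 2].flatMap (hadItems (some 0))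
  | .phase => [0, 1, 2].flatMap fun j =>
    diagItems [some 0, none] j ++ hadItems none j ++ (diagItems [some 0, none] j ++ hadItems none j)
  | .toffoli => [0, 1, 2].flatMap fun j =>
    hadItems (some 2) j ++ (diagItems [some 0, some 1, some 2] j ++ hadItems (some 2) j)
  | _ => []

theorem length_gateItems_le (x : CircSym) : (gateItems x).length ≤ 120 := by
  cases x <;> decide

theorem flatMap_replicate_lit (r : Fin 3 → ℕ) (n : ℕ) (x : Sym) :
    (List.replicate n (Item.lit x)).flatMap (Item.eval r) = List.replicate n x := by
  induction n with
  | zero => rfl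
  | succ n ih => rw [List.replicate_succ, List.flatMap_cons, ih]; rfl

/-- The number of the wire that is described by `wireItems`. -/
def wireNum (r : Fin 3 → ℕ) : Option (Fin 3) → Fin 3 → ℕ
  | none, j => j
  | some i, j => 3 * (r i + 1) + j

theorem eval_wireItems (r : Fin 3 → ℕ) (o : Option (Fin 3)) (j : Fin 3) :
    (wireItems o j).flatMap (Item.eval r) = List.replicate (wireNum r o j) .tick := by
  cases o with
  | none => exact flatMap_replicate_lit ..
  | some i =>
    rw [wireItems, List.flatMap_cons, flatMap_replicate_lit]
    simp only [Item.eval, List.replicate_append_replicate, wireNum]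
    congr 1; ring

theorem eval_hadItems (r : Fin 3 → ℕ) (o : Option (Fin 3)) (j : Fin 3) :
    (hadItems o j).flatMap (Item.eval r) = Sym.had (wireNum r o j) := by
  rw [hadItems, List.flatMap_cons, List.flatMap_append, eval_wireItems]
  rfl

theorem eval_varItems (r : Fin 3 → ℕ) (o : Option (Fin 3)) (j : Fin 3) :
    (varItems j o).flatMap (Item.eval r) = Sym.var (wireNum r o j) := by
  rw [varItems, List.flatMap_cons, List.flatMap_append, eval_wireItems]
  rfl

theorem eval_diagItems (r : Fin 3 → ℕ) (l : List (Option (Fin 3))) (j : Fin 3) :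
    (diagItems l j).flatMap (Item.eval r) =
      .fo :: (l.flatMap (fun o => Sym.var (wireNum r o j)) ++ [.fc]) := by
  rw [diagItems, List.flatMap_cons, List.flatMap_append, List.flatMap_assoc]
  simp only [eval_varItems]
  rfl

/-- The machine code for a gate. -/
def gateFlow : CircSym → Flow TrΓ
  | .hadamard => (readNum 0).seq ((write (gateItems .hadamard)).seq clear)
  | .phase => (readNum 0).seq ((write (gateItems .phase)).seq clear)
  | .toffoli => (readNum 0).seq ((readNum 1).seq ((readNum 2).seq
      ((write (gateItems .toffoli)).seq clear)))
  | _ => skip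

/-- A bound for the time spent on a gate. -/
def gateTime (b : ℕ) : ℕ := 6 * b + 3 + 120 * (10 * b + 2) + (3 * b + 3)

/-- The first symbol of a gate is split off because the main loop pops it in order to choose the
branch. The length bound is included since it is read off from the same list of items. -/
theorem runs_gate {m b : ℕ} (hm : m ≤ b) (g : QGate m) : ∃ x l, g.encode = x :: l ∧
    (x = .hadamard ∨ x = .phase ∨ x = .toffoli) ∧
    ((triple g.realize).flatMap Gate.encode).length ≤ 120 * (3 * b + 1) ∧ ∀ inp out rev,
    (gateFlow x).Runs (trStk (l ++ inp) out rev 0 0)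
      (trStk inp ((((triple g.realize).flatMap Gate.encode).map Sym.swap).reverse ++ out)
        (((triple g.realize).flatMap Gate.encode).reverse ++ rev) 0 0) (gateTime b) := by
  cases g with
  | hadamard a =>
    have hr : ∀ i, (update 0 0 (a : ℕ) : Fin 3 → ℕ) i ≤ b := by
      intro i; fin_cases i <;> simp; lia
    have he : (gateItems .hadamard).flatMap (Item.eval (update 0 0 (a : ℕ))) =
        (triple (QGate.hadamard a).realize).flatMap Gate.encode := by
      simp [gateItems, eval_hadItems, triple, QGate.realize, Gate.encode, Gate.map, copyEmb_val,
        wireNum, List.flatMap_append]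
    refine ⟨_, _, rfl, by simp, ?_, fun inp out rev => ?_⟩
    · rw [← he]
      exact (length_flatMap_eval_le hr _).trans (Nat.mul_le_mul_right _ (length_gateItems_le _))
    have h := (runs_readNum (inp := inp) (out := out) (rev := rev) (t := 0) (r := 0) 0 a rfl).seq
      ((runs_write (inp := inp) hr (gateItems .hadamard) out rev).seq (runs_clear hr))
    rw [he] at h
    refine Runs.mono h ?_
    have := length_gateItems_le .hadamard
    unfold gateTime
    have := Nat.mul_le_mul_right (10 * b + 2) this
    have := a.2
    lia
  | phase a =>
    have hr : ∀ i, (update 0 0 (a : ℕ) : Fin 3 → ℕ) i ≤ b := by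
      intro i; fin_cases i <;> simp; lia
    have he : (gateItems .phase).flatMap (Item.eval (update 0 0 (a : ℕ))) =
        (triple (QGate.phase a).realize).flatMap Gate.encode := by
      simp [gateItems, eval_hadItems, eval_diagItems, triple, QGate.realize, Gate.encode, Gate.map,
        copyEmb_val, wireNum, List.flatMap_append]
    refine ⟨_, _, rfl, by simp, ?_, fun inp out rev => ?_⟩
    · rw [← he]
      exact (length_flatMap_eval_le hr _).trans (Nat.mul_le_mul_right _ (length_gateItems_le _))
    have h := (runs_readNum (inp := inp) (out := out) (rev := rev) (t := 0) (r := 0) 0 a rfl).seq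
      ((runs_write (inp := inp) hr (gateItems .phase) out rev).seq (runs_clear hr))
    rw [he] at h
    refine Runs.mono h ?_
    have := length_gateItems_le .phase
    unfold gateTime
    have := Nat.mul_le_mul_right (10 * b + 2) this
    have := a.2
    lia
  | toffoli a b' c hab hac hbc =>
    have hr : ∀ i, (update (update (update 0 0 (a : ℕ)) 1 (b' : ℕ)) 2 (c : ℕ) : Fin 3 → ℕ) i ≤ b := by
      intro i; fin_cases i <;> simp <;> lia
    have he : (gateItems .toffoli).flatMap
        (Item.eval (update (update (update 0 0 (a : ℕ)) 1 (b' : ℕ)) 2 (c : ℕ))) =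
        (triple (QGate.toffoli a b' c hab hac hbc).realize).flatMap Gate.encode := by
      simp [gateItems, eval_hadItems, eval_diagItems, triple, QGate.realize, Gate.encode, Gate.map,
        copyEmb_val, wireNum, List.flatMap_append]
    refine ⟨_, _, rfl, by simp, ?_, fun inp out rev => ?_⟩
    · rw [← he]
      exact (length_flatMap_eval_le hr _).trans (Nat.mul_le_mul_right _ (length_gateItems_le _))
    have h := (runs_readNum (inp := CircSym.num b' ++ (CircSym.num c ++ inp)) (out := out)
        (rev := rev) (t := 0) (r := 0) 0 a rfl).seq
      ((runs_readNum (inp := CircSym.num c ++ inp) 1 b' rfl).seq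
        ((runs_readNum (inp := inp) 2 c rfl).seq
      ((runs_write (inp := inp) hr (gateItems .toffoli) out rev).seq (runs_clear hr))))
    rw [he] at h
    simp only [List.append_assoc]
    refine Runs.mono h ?_
    have := length_gateItems_le .toffoli
    unfold gateTime
    have := Nat.mul_le_mul_right (10 * b + 2) this
    have := a.2
    have := b'.2
    have := c.2
    lia

theorem runs_gates {m b : ℕ} (hm : m ≤ b) (l : List (QGate m)) : ∀ out rev,
    (loop .inp (fun _ => true) gateFlow).Runs (trStk (l.flatMap QGate.encode) out rev 0 0)
      (trStk [] ((((l.flatMap fun g => triple g.realize).flatMap Gate.encode).map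
          Sym.swap).reverse ++ out)
        (((l.flatMap fun g => triple g.realize).flatMap Gate.encode).reverse ++ rev) 0 0)
      (l.length * (gateTime b + 1) + 1) := by
  induction l with
  | nil => intro out rev; exact Runs.mono (runs_loop_nil rfl) (by simp)
  | cons g l ih =>
    intro out rev
    obtain ⟨x, s, h1, -, -, h3⟩ := runs_gate hm g
    have h4 := runs_loop_cons (k := TrK.inp) (cont := fun _ => true) (body := gateFlow) (a := x)
      (l := s ++ l.flatMap QGate.encode)
      (S := trStk (x :: (s ++ l.flatMap QGate.encode)) out rev 0 0) rfl rfl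
      (by rw [update_inp]; exact h3 _ _ _) (ih _ _)
    refine Runs.mono (t := gateTime b + 1 + (l.length * (gateTime b + 1) + 1)) ?_ ?_
    · simpa [h1] using h4
    · rw [List.length_cons, Nat.succ_mul]; lia

theorem length_gates_le {m b : ℕ} (hm : m ≤ b) (l : List (QGate m)) :
    ((l.flatMap fun g => triple g.realize).flatMap Gate.encode).length ≤
      l.length * (120 * (3 * b + 1)) := by
  induction l with
  | nil => simp
  | cons g l ih =>
    obtain ⟨x, s, -, -, h, -⟩ := runs_gate hm g
    rw [List.flatMap_cons, List.flatMap_append, List.length_append, List.length_cons]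
    have := Nat.succ_mul l.length (120 * (3 * b + 1))
    lia

/-- The string for the majority gates. -/
def majorityString : List Sym := (majority (m := 2) 1).flatMap Gate.encode

/-- The measured qubit is qubit 1 after the additional qubit is inserted, and its copies are the
wires 3, 4, 5 whatever the size of the circuit. The string is therefore constant and can be built
into the machine. -/
theorem encode_majority {m : ℕ} (h : 0 < m) :
    (majority (Fin.succ ⟨0, h⟩)).flatMap Gate.encode = majorityString := by
  simp [majority, majorityString, Gate.encode, copyEmb_val]
  rfl

/-- Write three wires, without mirror image. -/
def pushWires : Flow TrΓ := (push .rev Sym.wire).seq ((push .rev Sym.wire).seq (push .rev Sym.wire))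

/-- Write a string in front of the output. -/
def pushOut (l : List Sym) : Flow TrΓ := pushes .out (List.reverse (α := Sym) l)

theorem runs_pushOut {out rev : List Sym} (l : List Sym) : (pushOut l).Runs
    (trStk [] out rev 0 0) (trStk [] (l ++ out) rev 0 0) l.length := by
  have h := runs_pushes (k := TrK.out) (List.reverse (α := Sym) l)
    (S := trStk [] out rev 0 0) (S' := trStk [] (l ++ out) rev 0 0) (by
      refine (update_out (x := (l.reverse.reverse ++ out : List Sym))).trans ?_
      rw [List.reverse_reverse])
  exact h.mono (List.length_reverse (as := l)).le

/-- The machine for the transformation of circuits. -/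
def program : Flow TrΓ :=
  (readNum 0).seq ((forR 0 (pushWires)).seq
    (clear.seq ((pushWires).seq ((put .layer).seq
      ((loop .inp (fun _ => true) gateFlow).seq ((pushOut majorityString).seq
        (loop .rev (fun _ => true) fun x : Sym => push .out x)))))))

theorem runs_loop_rev (rev : List Sym) : ∀ out,
    (loop .rev (fun _ => true) fun x : Sym => push .out x : Flow TrΓ).Runs
      (trStk [] out rev 0 0) (trStk [] (rev.reverse ++ out) [] 0 0) (rev.length * 2 + 1) := by
  induction rev with
  | nil => intro out; exact runs_loop_nil rfl
  | cons x rev ih =>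
    intro out
    rw [List.reverse_cons, List.append_assoc]
    refine Runs.mono (runs_loop_cons (k := TrK.rev) (a := x) (l := rev) rfl rfl (t := 1) ?_
      (ih (x :: out))) ?_
    · rw [update_rev]; exact runs_push_out _
    · rw [List.length_cons]; lia

/-- A bound for the running time. -/
def time (L : ℕ) : ℕ :=
  2 * L + 1 + (L * (3 + 4) + 2 + (3 * L + 3 + (3 + (2 + (L * (gateTime L + 1) + 1 +
    (majorityString.length + ((L * (120 * (3 * L + 1)) + (3 * L + 4)) * 2 + 1)))))))

theorem length_gates_le_length (C : QCircuit) : C.gates.length ≤ C.encode.length := by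
  have h (l : List (QGate C.qubits)) : l.length ≤ (l.flatMap QGate.encode).length := by
    induction l with
    | nil => simp
    | cons g l ih =>
      obtain ⟨x, s, h, -⟩ := runs_gate le_rfl g
      rw [List.flatMap_cons, List.length_append, h, List.length_cons, List.length_cons]
      lia
  have := h C.gates
  simp only [QCircuit.encode, List.length_append]
  lia

theorem qubits_le_length (C : QCircuit) : C.qubits ≤ C.encode.length := by
  simp only [QCircuit.encode, CircSym.num, List.length_append, List.length_replicate]
  lia

theorem transpile_eq (C : QCircuit) : C.transpile =
    ((Sym.layer :: C.tripled.flatMap Gate.encode).reverse ++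
      List.replicate (3 * C.qubits + 3) Sym.wire).reverse ++ (majorityString ++
        ((Sym.layer :: C.tripled.flatMap Gate.encode).map Sym.swap).reverse) := by
  have : (C.qubits + 1) * 3 = 3 * C.qubits + 3 := by ring
  rw [QCircuit.transpile, encode_majority, List.reverse_append, List.reverse_reverse,
    List.reverse_replicate, List.append_assoc]
  congr 2

theorem runs_wires {inp : List CircSym} {out rev : List Sym} {t : ℕ} {r : Fin 3 → ℕ} :
    pushWires.Runs (trStk inp out rev t r)
      (trStk inp out (.wire :: .wire :: .wire :: rev) t r) 3 :=
  (runs_push_rev _).seq ((runs_push_rev _).seq (runs_push_rev _))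

/-- The output arises back to front: the mirror image is written while the gates are read, the
majority string is put before it, and emptying `rev` supplies the wires and the gates in their
original order. -/
theorem runs_program (C : QCircuit) : program.Runs (trStk C.encode [] [] 0 0)
    (trStk [] C.transpile [] 0 0) (time C.encode.length) := by
  have hr : ∀ i, (update 0 0 C.qubits : Fin 3 → ℕ) i ≤ C.qubits := by
    intro i; fin_cases i <;> simp
  have hloop : Runs _ _ _ _ :=
    runs_forR (i := 0) (F := pushWires)
      (inp := C.gates.flatMap QGate.encode) (r := update 0 0 C.qubits) (fun _ => [])
      (fun j => List.replicate (3 * j) .wire) (fun j t r => runs_wires)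
  have hgates := runs_gates le_rfl C.gates (.layer :: [])
    (.layer :: List.replicate (3 * C.qubits + 3) .wire)
  have h0 := runs_readNum (inp := C.gates.flatMap QGate.encode) (out := []) (rev := []) (t := 0)
    (r := 0) 0 C.qubits rfl
  have hput := runs_put (inp := C.gates.flatMap QGate.encode) (out := []) (t := 0) (r := 0)
    (rev := .wire :: .wire :: .wire :: List.replicate (3 * C.qubits) .wire) .layer
  rw [update_self] at hloop
  have h := h0.seq (hloop.seq ((runs_clear hr).seq (runs_wires.seq (hput.seq (hgates.seq
    ((runs_pushOut majorityString).seq (runs_loop_rev _ _)))))))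
  have hlen := length_gates_le le_rfl C.gates
  have hq := qubits_le_length C
  have hg := length_gates_le_length C
  rw [transpile_eq]
  generalize C.encode.length = L at *
  have h1 : gateTime C.qubits ≤ gateTime L := by
    unfold gateTime; lia
  have h2 : C.gates.length * (120 * (3 * C.qubits + 1)) ≤ L * (120 * (3 * L + 1)) := by gcongr
  have h4 : C.gates.length * (gateTime C.qubits + 1) ≤ L * (gateTime L + 1) := by gcongr
  have h5 : C.tripled.flatMap Gate.encode =
    (C.gates.flatMap fun g => triple g.realize).flatMap Gate.encode := rfl
  rw [h5]
  unfold program time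
  generalize (C.gates.flatMap fun g => triple g.realize).flatMap Gate.encode = w at *
  generalize majorityString = M at *
  refine Runs.mono (t := ?_) ?_ ?_
  rotate_left
  · convert h using 2
    · rfl
    · simp [Sym.swap]
  · simp only [List.length_append, List.length_reverse, List.length_cons, List.length_replicate]
    lia

theorem _root_.CubicGap.polyTime_transpile : PolyTime QCircuit.encode id QCircuit.transpile := by
  refine program.polyTime (k₀ := TrK.inp) (k₁ := TrK.out) (ea := QCircuit.encode)
    (eb := fun w : List Sym => w) (p := ?_) (fun C => ?_)
  · exact let L := Polynomial.X
      2 * L + 1 + (L * (3 + 4) + 2 + (3 * L + 3 + (3 + (2 + (L *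
      (6 * L + 3 + 120 * (10 * L + 2) + (3 * L + 3) + 1) + 1 + (Polynomial.C majorityString.length +
        ((L * (120 * (3 * L + 1)) + (3 * L + 4)) * 2 + 1)))))))
  · refine Runs.mono (t := time C.encode.length) ?_ ?_
    · convert runs_program C using 1
      · funext k; cases k <;> rfl
      · funext k; cases k <;> rfl
    · simp [time, gateTime]
      exact le_rfl

end Tr

end CubicGap

namespace CubicGap

open Function

/-! ## The sign of the answer -/

/-- The stacks of the machine that reads the sign of the answer. -/
inductive SgnK : Type
  | inp | out
  deriving DecidableEq

instance : Fintype SgnK := ⟨{.inp, .out}, fun x => by cases x <;> simp⟩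

/-- The alphabets of the stacks. -/
def SgnΓ : SgnK → Type
  | .inp => Option Bool
  | .out => Bool

instance (k : SgnK) : Fintype (SgnΓ k) := by
  cases k <;> unfold SgnΓ <;> infer_instance

/-- Stack contents. -/
def sgnStk (inp : List (Option Bool)) (out : List Bool) : Stk SgnΓ
  | .inp => inp
  | .out => out

namespace Sgn

open CubicGap.Flow

theorem update_inp {inp x : List (Option Bool)} {out : List Bool} :
    update (sgnStk inp out) .inp x = sgnStk x out := by
  funext k; cases k <;> rfl

/-- The machine that reads the sign of the answer. -/
def program : Flow SgnΓ :=
  (loop .inp (fun x : Option Bool => x.isSome) fun _ => skip).seq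
    ((loop .inp (fun _ => false) fun x : Option Bool => push .out (x.getD false)).seq
      (loop .inp (fun _ => true) fun _ => skip))

theorem runs_loop_some (l : List Bool) (inp : List (Option Bool)) :
    (loop .inp (fun x : Option Bool => x.isSome) fun _ => skip : Flow SgnΓ).Runs
      (sgnStk (l.map some ++ none :: inp) []) (sgnStk inp []) (l.length + 1) := by
  induction l with
  | nil =>
    refine runs_loop_stop (k := SgnK.inp) (a := (none : Option Bool)) (l := inp) rfl rfl ?_
    rw [update_inp]
    exact runs_skip _
  | cons x l ih =>
    refine Runs.mono (runs_loop_cons (k := SgnK.inp) (a := some x) (l := l.map some ++ none :: inp)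
      rfl rfl (t := 0) ?_ ih) (by rw [List.length_cons]; lia)
    rw [update_inp]
    exact runs_skip _

/-- The sign bit follows the first separator, so no arithmetic is needed: skip to it, copy it,
discard the rest. -/
theorem runs_program (l : List Bool) (b : Bool) (inp : List (Option Bool)) :
    program.Runs (sgnStk (l.map some ++ none :: some b :: inp) []) (sgnStk [] [b])
      (l.length + 1 + (2 + (inp.length + 1))) := by
  refine (runs_loop_some l _).seq (Runs.seq (S' := sgnStk inp [b]) ?_ ?_)
  · refine runs_loop_stop (k := SgnK.inp) (a := some b) (l := inp) (t := 1) rfl rfl ?_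
    rw [update_inp]
    exact runs_push (by funext k; cases k <;> rfl)
  · exact runs_drain update_inp le_rfl

theorem _root_.CubicGap.polyTime_neg : PolyTime encodeAnswer Computability.encodeBool
    (fun p : List Bool × ℚ => decide (p.2 < 0)) := by
  refine program.polyTime (k₀ := SgnK.inp) (k₁ := SgnK.out) (ea := encodeAnswer)
    (eb := Computability.encodeBool) (p := Polynomial.X + 4) (fun p => ?_)
  have he : encodeAnswer p = p.1.map some ++ none :: some (decide (p.2 < 0)) ::
      ((Computability.encodeNat p.2.num.natAbs).map some ++
        none :: (Computability.encodeNat p.2.den).map some) := by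
    simp [encodeAnswer]
  rw [he]
  generalize (Computability.encodeNat p.2.num.natAbs).map some ++
    none :: (Computability.encodeNat p.2.den).map some = w
  refine Runs.mono (t := ?_) ?_ ?_
  rotate_left
  · convert runs_program p.1 (decide (p.2 < 0)) w using 1
    · funext k; cases k <;> rfl
    · funext k; cases k <;> rfl
  · have hl : (p.1.map some ++ none :: some (decide (p.2 < 0)) :: w).length =
        p.1.length + (w.length + 2) := by simp
    have hp (n : ℕ) : Polynomial.eval n (Polynomial.X + 4) = n + 4 := by simp
    exact le_trans (by lia) ((Nat.add_le_add_right hl.ge 4).trans (hp _).ge)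

end Sgn

end CubicGap

namespace CubicGap

open Function

/-! ## The polynomial of a circuit -/

/-- The sign that belongs to a bit. -/
def sgn (b : Bool) : ℝ := if b then -1 else 1

@[simp] theorem sgn_false : sgn false = 1 := rfl

@[simp] theorem sgn_true : sgn true = -1 := rfl

namespace Gate

variable {l : ℕ}

/-- A gate as an operator on real states; Hadamard gates are not normalised. -/
def op : Gate l → ((Fin l → Bool) → ℝ) → (Fin l → Bool) → ℝ
  | H i, ψ => fun y => ψ (update y i false) + sgn (y i) * ψ (update y i true)
  | Z i, ψ => fun y => sgn (y i) * ψ y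
  | CZ i j _, ψ => fun y => sgn (y i && y j) * ψ y
  | CCZ i j k _ _ _, ψ => fun y => sgn (y i && (y j && y k)) * ψ y

/-- The number of variables and the current variables of the wires after a gate. -/
def next : Gate l → ℕ × (Fin l → ℕ) → ℕ × (Fin l → ℕ)
  | H i, s => (s.1 + 1, update s.2 i s.1)
  | _, s => s

/-- The monomial of a gate. -/
def term : Gate l → ℕ × (Fin l → ℕ) → List ℕ
  | H i, s => [s.2 i, s.1]
  | Z i, s => [s.2 i]
  | CZ i j _, s => [s.2 i, s.2 j]
  | CCZ i j k _ _ _, s => [s.2 i, s.2 j, s.2 k]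

/-- Whether the gate is a Hadamard gate. -/
def isH : Gate l → Bool
  | H _ => true
  | _ => false

end Gate

namespace InternalCircuit

variable {l : ℕ}

/-- The monomials of a circuit. -/
def monomials : InternalCircuit l → ℕ × (Fin l → ℕ) → List (List ℕ)
  | [], _ => []
  | g :: C, s => g.term s :: monomials C (g.next s)

/-- The number of Hadamard gates. -/
def numH (C : InternalCircuit l) : ℕ := C.countP Gate.isH

/-- The operator of a circuit that is applied to a state from the right. -/
def op (C : InternalCircuit l) (ψ : (Fin l → Bool) → ℝ) : (Fin l → Bool) → ℝ := C.foldr Gate.op ψ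

/-- The segments that start with the Hadamard gates of the circuit. -/
def newSegments : InternalCircuit l → (Fin l → ℕ) → List (Fin l × ℕ)
  | [], _ => []
  | Gate.H i :: C, t => (i, t i + 1) :: newSegments C (update t i (t i + 1))
  | _ :: C, t => newSegments C t

/-- The current variables make sense. -/
structure Good (s : ℕ × (Fin l → ℕ)) : Prop where
  inj : Injective s.2
  lt : ∀ i, s.2 i < s.1

theorem Good.next {s : ℕ × (Fin l → ℕ)} (h : Good s) (g : Gate l) : Good (g.next s) := by
  cases g with
  | H i =>
    refine ⟨fun a b hab => ?_, fun a => ?_⟩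
    · simp only [Gate.next, update_apply] at hab
      have ha := h.lt a
      have hb := h.lt b
      split_ifs at hab with h1 h2 h2
      · rw [h1, h2]
      · lia
      · lia
      · exact h.inj hab
    · simp only [Gate.next, update_apply]
      have := h.lt a
      split_ifs <;> lia
  | _ => exact h

/-- Distinct wires have distinct current variables, and the variable created by a Hadamard gate
exceeds all earlier ones; so no monomial contains a square. -/
theorem term_ok {s : ℕ × (Fin l → ℕ)} (h : Good s) (g : Gate l) :
    g.term s ≠ [] ∧ (g.term s).length ≤ 3 ∧ (g.term s).Nodup ∧
      ∀ k ∈ g.term s, k < (g.next s).1 := by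
  have h1 := h.lt
  have h2 : ∀ {i j}, s.2 i = s.2 j ↔ i = j := h.inj.eq_iff
  cases g with
  | H i =>
    have := h1 i
    simp [Gate.term, Gate.next]
    lia
  | Z i => simp [Gate.term, Gate.next, h1]
  | CZ i j hij => simp [Gate.term, Gate.next, h1, h2, hij]
  | CCZ i j k hij hik hjk => simp [Gate.term, Gate.next, h1, h2, hij, hik, hjk]

theorem next_fst_add (g : Gate l) (s : ℕ × (Fin l → ℕ)) (C : InternalCircuit l) :
    (g.next s).1 + numH C = s.1 + numH (g :: C) := by
  cases g <;> simp [Gate.next, numH, Gate.isH, List.countP_cons]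
  lia

theorem monomials_ok (C : InternalCircuit l) : ∀ {s : ℕ × (Fin l → ℕ)}, Good s →
    ∀ t ∈ C.monomials s, t ≠ [] ∧ t.length ≤ 3 ∧ t.Nodup ∧ ∀ k ∈ t, k < s.1 + numH C := by
  induction C with
  | nil => intro s _ t ht; simp [monomials] at ht
  | cons g C ih =>
    intro s hs t ht
    rw [← next_fst_add]
    rw [monomials, List.mem_cons] at ht
    rcases ht with rfl | ht
    · obtain ⟨h1, h2, h3, h4⟩ := term_ok hs g
      exact ⟨h1, h2, h3, fun k hk => (h4 k hk).trans_le (Nat.le_add_right _ _)⟩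
    · exact ih (hs.next g) t ht

/-! ### Labels -/

theorem length_newSegments (C : InternalCircuit l) : ∀ t, (C.newSegments t).length = numH C := by
  induction C with
  | nil => intro t; rfl
  | cons g C ih =>
    intro t
    cases g <;> simp [newSegments, numH, Gate.isH, List.countP_cons, ih]

theorem mem_newSegments (C : InternalCircuit l) : ∀ (t : Fin l → ℕ) (q : Fin l) (m : ℕ),
    (q, m) ∈ C.newSegments t ↔ t q < m ∧ m ≤ t q + C.hadamards q := by
  induction C with
  | nil => intro t q m; simp [newSegments, hadamards]
  | cons g C ih =>
    intro t q m
    cases g with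
    | H i =>
      by_cases h : i = q
      · subst h
        simp only [newSegments, List.mem_cons, Prod.mk.injEq, true_and, ih, update_self]
        simp only [hadamards, List.countP_cons, Gate.IsHadamardOn, decide_true, if_true]
        lia
      · have h' : q ≠ i := fun e => h e.symm
        simp [newSegments, ih, hadamards, Gate.IsHadamardOn, h, h']
    | _ => simp [newSegments, ih, hadamards, Gate.IsHadamardOn]

theorem nodup_newSegments (C : InternalCircuit l) : ∀ t, (C.newSegments t).Nodup := by
  induction C with
  | nil => intro t; exact List.nodup_nil
  | cons g C ih =>
    intro t
    cases g with
    | H i =>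
      refine List.nodup_cons.2 ⟨fun h => ?_, ih _⟩
      rw [mem_newSegments, update_self] at h
      lia
    | _ => exact ih t

-- New variables are numbered in the order of the Hadamard gates, which is also the order of
-- `newSegments`. The invariant is that the current variable of wire i is labelled by its current
-- segment (i, t i).
open MvPolynomial in
theorem sum_monomials (e : ℕ → Fin l × ℕ) (C : InternalCircuit l) :
    ∀ (s : ℕ × (Fin l → ℕ)) (t : Fin l → ℕ), (∀ i, e (s.2 i) = (i, t i)) →
      (∀ k (hk : k < (C.newSegments t).length), e (s.1 + k) = (C.newSegments t)[k]) →
      ((C.monomials s).map fun m => (m.map fun k => (X (e k) : MvPolynomial _ (ZMod 2))).prod).sum =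
        C.segmentPolyFrom t := by
  induction C with
  | nil => intro s t _ _; rfl
  | cons g C ih =>
    intro s t h1 h2
    rw [monomials, List.map_cons, List.sum_cons]
    cases g with
    | H i =>
      have h3 := h2 0 (by simp [newSegments])
      simp only [newSegments, List.getElem_cons_zero, Nat.add_zero] at h3
      rw [ih (Gate.next (Gate.H i) s) (update t i (t i + 1)), segmentPolyFrom]
      · simp [Gate.term, h1, h3]
      · intro j
        by_cases h : j = i
        · subst h; simp [Gate.next, h3]
        · simp [Gate.next, h, h1]
      · intro k hk
        have h4 := h2 (k + 1) (by simp only [newSegments, List.length_cons]; lia)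
        simp only [newSegments, List.getElem_cons_succ] at h4
        rw [← h4]
        congr 1
        simp only [Gate.next]
        lia
    | Z i =>
      rw [ih (Gate.next (Gate.Z i) s) t h1 h2, segmentPolyFrom]
      simp [Gate.term, h1]
    | CZ i j hij =>
      rw [ih (Gate.next (Gate.CZ i j hij) s) t h1 h2, segmentPolyFrom]
      simp [Gate.term, h1]
    | CCZ i j k hij hik hjk =>
      rw [ih (Gate.next (Gate.CCZ i j k hij hik hjk) s) t h1 h2, segmentPolyFrom]
      simp [Gate.term, h1, mul_assoc]

/-! ### Sums over assignments -/

/-- The sum over the values of the `h` variables from `n` on. -/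
def sumVars : ℕ → ℕ → ((ℕ → Bool) → ℝ) → (ℕ → Bool) → ℝ
  | _, 0, F, x => F x
  | n, h + 1, F, x => sumVars (n + 1) h F (update x n false) + sumVars (n + 1) h F (update x n true)

theorem sumVars_mul {c F : (ℕ → Bool) → ℝ} (h : ℕ) : ∀ {n : ℕ},
    (∀ x m b, n ≤ m → c (update x m b) = c x) → ∀ x,
    sumVars n h (fun x => c x * F x) x = c x * sumVars n h F x := by
  induction h with
  | zero => intro n _ x; rfl
  | succ h ih =>
    intro n hc x
    have := fun x => ih (n := n + 1) (fun x m b hm => hc x m b (by lia)) x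
    rw [sumVars, sumVars, this, this, hc _ _ _ le_rfl, hc _ _ _ le_rfl, mul_add]

/-- An assignment to all variables. -/
def total {n : ℕ} (x : Fin n → Bool) : ℕ → Bool := fun k => if h : k < n then x ⟨k, h⟩ else false

theorem sum_sumVars (F : (ℕ → Bool) → ℝ) (h : ℕ) : ∀ {n m : ℕ}, n + h = m →
    ∑ x : Fin m → Bool, F (total x) = ∑ x : Fin n → Bool, sumVars n h F (total x) := by
  induction h with
  | zero => rintro n m rfl; rfl
  | succ h ih =>
    intro n m hm
    rw [ih (n := n + 1) (by lia), ← (Fin.snocEquiv fun _ => Bool).sum_comp, Fintype.sum_prod_type,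
      Finset.sum_comm]
    refine Finset.sum_congr rfl fun x _ => ?_
    have hx (b : Bool) : total (Fin.snocEquiv (fun _ : Fin (n + 1) => Bool) (b, x)) =
        update (total x) n b := by
      funext k
      rcases lt_trichotomy k n with hk | rfl | hk
      · simp [total, Fin.snocEquiv, Fin.snoc, hk, hk.ne, Nat.lt_succ_of_lt hk]
      · simp [total, Fin.snocEquiv, Fin.snoc]
      · simp [total, hk.ne', not_lt_of_gt hk, Nat.not_lt.2 hk]
    rw [Fintype.sum_bool, hx, hx, sumVars, add_comm]

/-- The path sum. The sign of the first gate involves no variable created after it, so it can be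
pulled out of the remaining sum. For a Hadamard gate the next summation variable is the new bit of
its wire, and summing (-1)^(old · new) over it is the unnormalised Hadamard matrix. -/
theorem sumVars_monomials (C : InternalCircuit l) : ∀ {s : ℕ × (Fin l → ℕ)}, Good s → ∀ x,
    sumVars s.1 (numH C) (fun x => ((C.monomials s).map fun t => sgn (t.all x)).prod) x =
      op C (fun _ => 1) fun i => x (s.2 i) := by
  induction C with
  | nil => intro s _ x; rfl
  | cons g C ih =>
    intro s hs x
    have h1 : (fun x : ℕ → Bool => ((monomials (g :: C) s).map fun t => sgn (t.all x)).prod) =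
        fun x => sgn ((g.term s).all x) *
          ((monomials C (g.next s)).map fun t => sgn (t.all x)).prod := rfl
    have h2 : ∀ x m b, (g.next s).1 ≤ m →
        sgn ((g.term s).all (update x m b)) = sgn ((g.term s).all x) := by
      intro x m b hm
      congr 1
      rw [Bool.eq_iff_iff, List.all_eq_true, List.all_eq_true]
      refine forall₂_congr fun k hk => ?_
      rw [update_of_ne]
      have := (term_ok hs g).2.2.2 k hk
      lia
    have h3 : op (g :: C) (fun _ => 1) = g.op (op C fun _ => 1) := rfl
    rw [h1, h3]
    have h4 := fun x => (sumVars_mul (c := fun x => sgn ((g.term s).all x)) (F := fun x => ((monomials C (g.next s)).map fun t =>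
      sgn (t.all x)).prod) (numH C) h2 x).trans (congrArg _ (ih (hs.next g) x))
    cases g with
    | H i =>
      have h5 : numH (Gate.H i :: C) = numH C + 1 := by simp [numH, Gate.isH, List.countP_cons]
      have h6 (b : Bool) : (fun j => update x s.1 b (update s.2 i s.1 j)) =
          update (fun j => x (s.2 j)) i b := by
        funext j
        by_cases h : j = i
        · subst h; simp
        · have := (hs.lt j).ne
          simp [h, this]
      have h7 := (hs.lt i).ne
      rw [h5, sumVars]
      refine (congrArg₂ _ (h4 _) (h4 _)).trans ?_
      simp only [Gate.next, h6, Gate.term, Gate.op]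
      simp [h7]
    | Z i => refine (h4 x).trans ?_; simp [Gate.term, Gate.op, Gate.next]
    | CZ i j hij => refine (h4 x).trans ?_; simp [Gate.term, Gate.op, Gate.next]
    | CCZ i j k hij hik hjk => refine (h4 x).trans ?_; simp [Gate.term, Gate.op, Gate.next]

/-- The variables with which a circuit starts. -/
def start (l : ℕ) : ℕ × (Fin l → ℕ) := (l, fun i => (i.rev : ℕ))

theorem good_start : Good (start l) :=
  ⟨fun _ _ h => Fin.rev_injective (Fin.ext h), fun i => i.rev.2⟩

end InternalCircuit

/-- The string for a monomial. -/
def monomialString (t : List ℕ) : List PolySym := t.flatMap PolySym.num ++ [.semicolon]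

theorem sign_sum_eq_prod (x : ℕ → Bool) (T : List (List ℕ)) :
    (if (T.map fun t => (t.map fun k => if x k then (1 : ZMod 2) else 0).prod).sum = 0
      then (1 : ℝ) else -1) = (T.map fun t => sgn (t.all x)).prod := by
  have h (t : List ℕ) : (t.map fun k => if x k then (1 : ZMod 2) else 0).prod =
      if t.all x then 1 else 0 := by
    induction t with
    | nil => rfl
    | cons k t ih => rw [List.map_cons, List.prod_cons, ih]; cases hk : x k <;> simp [hk]
  have h1 (b : Bool) (z : ZMod 2) : (if (if b then (1 : ZMod 2) else 0) + z = 0 then (1 : ℝ)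
      else -1) = sgn b * if z = 0 then 1 else -1 := by
    have hz : z = 0 ∨ z = 1 := by revert z; decide
    have h2 : (1 : ZMod 2) + 1 = 0 := by decide
    rcases hz with rfl | rfl <;> cases b <;> simp [h2]
  simp only [h]
  induction T with
  | nil => simp
  | cons t T ih => rw [List.map_cons, List.sum_cons, h1, ih, List.map_cons, List.prod_cons]

-- The dictionary between circuits and polynomials: each wire contributes one initial variable and
-- each Hadamard gate one more, and the gap is the matrix element of the circuit between two
-- all-ones vectors.
open MvPolynomial InternalCircuit in
theorem exists_cubicPoly {l : ℕ} (C : InternalCircuit l) (hC : ∀ q, ∃ g ∈ C, g.ActsOn q) :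
    ∃ P : CubicPoly, P.n = l + C.numH ∧
      P.encode = PolySym.num P.n ++ (C.monomials (start l)).flatMap monomialString ∧
      C.Corresponds P.poly ∧ (gap P.poly : ℝ) = ∑ y, C.op (fun _ => 1) y := by
  have hok := monomials_ok C (good_start (l := l))
  obtain ⟨T, hT⟩ : ∃ T : List (List (Fin (l + C.numH))),
      T.map (List.map Fin.val) = C.monomials (start l) := by
    have : C.monomials (start l) ∈ Set.range (List.map (List.map (Fin.val (n := l + C.numH)))) := by
      rw [Set.range_list_map]
      intro t ht
      rw [Set.range_list_map]
      exact fun k hk => ⟨⟨k, (hok t ht).2.2.2 k hk⟩, rfl⟩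
    exact this
  let P : CubicPoly := ⟨l + C.numH, T, fun t ht => by
    obtain ⟨h1, h2, h3, -⟩ := hok (t.map Fin.val) (hT ▸ List.mem_map_of_mem ht)
    exact ⟨by simpa using h1, by simpa using h2, h3.of_map _⟩⟩
  refine ⟨P, rfl, ?_, ⟨hC, ?_⟩, ?_⟩
  · rw [← hT, CubicPoly.encode, List.flatMap_map]
    simp [monomialString, List.flatMap_map, P, List.flatMap_assoc]
  -- The segments in the order of their variables. The initial ones are reversed to match `start`,
  -- as the assembler puts each new wire in front of the earlier ones.
  · let L : List (Fin l × ℕ) := List.ofFn (fun k : Fin l => (k.rev, 0)) ++ C.newSegments fun _ => 0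
    have hL : L.length = l + C.numH := by simp [L, length_newSegments]
    have hnodup : L.Nodup := by
      refine List.Nodup.append (List.nodup_ofFn.2 fun i j h => ?_) (nodup_newSegments _ _) ?_
      · exact Fin.rev_injective (congrArg Prod.fst h)
      · rintro ⟨q, m⟩ h1 h2
        rw [mem_newSegments] at h2
        rw [List.mem_ofFn] at h1
        obtain ⟨i, hi⟩ := h1
        simp only [Prod.mk.injEq] at hi
        lia
    have hmem : ∀ s, s ∈ L ↔ s ∈ C.segments := by
      rintro ⟨q, m⟩
      simp only [L, List.mem_append, mem_newSegments, List.mem_ofFn, segments, Set.mem_ofPred_eq,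
        Prod.mk.injEq]
      constructor
      · rintro (⟨i, rfl, rfl⟩ | h)
        · exact Nat.zero_le _
        · lia
      · intro h
        rcases Nat.eq_zero_or_pos m with rfl | hm
        · exact Or.inl ⟨q.rev, Fin.rev_rev q, rfl⟩
        · exact Or.inr ⟨hm, by lia⟩
    have h0 : ∀ k : Fin (l + C.numH), (k : ℕ) < L.length := fun k => by rw [hL]; exact k.2
    let e : Fin (l + C.numH) → Fin l × ℕ := fun k => L[(k : ℕ)]'(h0 k)
    refine ⟨e, fun i j h => ?_, ?_, ?_⟩
    · exact Fin.ext ((hnodup.getElem_inj_iff).1 h)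
    · ext s
      rw [← hmem, List.mem_iff_getElem]
      constructor
      · rintro ⟨k, rfl⟩; exact ⟨k, h0 k, rfl⟩
      · rintro ⟨k, hk, rfl⟩; exact ⟨⟨k, hL.subst (motive := fun m => k < m) hk⟩, rfl⟩
    -- Extending the labelling to all natural numbers needs a default segment, which exists only if
    -- there is a wire.
    · rcases Nat.eq_zero_or_pos l with rfl | hl
      · have : C = [] := by
          refine List.eq_nil_iff_forall_not_mem.2 fun g _ => ?_
          cases g with
          | H i => exact i.elim0
          | Z i => exact i.elim0
          | CZ i => exact i.elim0
          | CCZ i => exact i.elim0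
        subst this
        have : T = [] := by simpa [monomials] using hT
        simp [CubicPoly.poly, P, this, segmentPoly, segmentPolyFrom]
      let e' : ℕ → Fin l × ℕ := fun k => L.getD k (⟨0, hl⟩, 0)
      have he : ∀ k : Fin (l + C.numH), e' k = e k := fun k => List.getD_eq_getElem _ _ (h0 k)
      rw [segmentPoly, ← sum_monomials e' C (start l), ← hT]
      · simp only [CubicPoly.poly, P, map_list_sum, List.map_map]
        congr 2
        funext t
        simp [map_list_prod, Function.comp_def, he]
      · intro i
        have : (start l).2 i < L.length := by rw [hL]; have := i.rev.2; simp [start]; lia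
        simp only [e']
        rw [List.getD_eq_getElem _ _ this]
        have h5 : ((start l).2 i) < (List.ofFn fun k : Fin l => (k.rev, 0)).length := by
          rw [List.length_ofFn]; exact i.rev.2
        rw [List.getElem_append_left h5, List.getElem_ofFn]
        exact congrArg (Prod.mk · 0) (Fin.rev_rev i)
      · intro k hk
        have : l + k < L.length := by simp [L]; lia
        simp only [e', start]
        rw [List.getD_eq_getElem _ _ this]
        simp [L]
  · have h1 := sum_sumVars (fun x => ((C.monomials (start l)).map fun t => sgn (t.all x)).prod)
      C.numH (n := l) rfl
    have h2 := fun x => sumVars_monomials C (good_start (l := l)) x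
    have h3 : ∀ x : Fin l → Bool, sumVars l C.numH
        (fun x => ((C.monomials (start l)).map fun t => sgn (t.all x)).prod) (total x) =
          C.op (fun _ => 1) fun i => x i.rev := by
      intro x
      refine (h2 _).trans ?_
      congr 1
      funext i
      have : l - (i + 1) < l := by have := i.2; lia
      simp [start, total, this]
      rfl
    simp only [h3] at h1
    -- The reversed numbering of the wires only permutes the assignments.
    have h4 : ∑ x : Fin l → Bool, C.op (fun _ => 1) (fun i => x i.rev) =
        ∑ y, C.op (fun _ => 1) y :=
      (Fin.revPerm.arrowCongr (Equiv.refl Bool)).sum_comp (C.op fun _ => 1)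
    rw [h4] at h1
    rw [← h1, gap]
    push_cast
    let b : Bool ≃ ZMod 2 :=
      ⟨fun b => if b then 1 else 0, fun z => z = 1, by decide, by decide⟩
    rw [← ((Equiv.refl (Fin (l + C.numH))).arrowCongr b).sum_comp]
    refine Finset.sum_congr rfl fun x _ => ?_
    rw [← sign_sum_eq_prod, ← hT]
    have h6 (k : Fin (l + C.numH)) : total x k = x k := by simp [total]
    have h7 : eval ((Equiv.refl (Fin (l + C.numH))).arrowCongr b x) P.poly =
        ((T.map (List.map Fin.val)).map fun t =>
          (t.map fun k => if total x k then (1 : ZMod 2) else 0).prod).sum := by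
      simp only [CubicPoly.poly, P, map_list_sum, List.map_map]
      congr 2
      funext t
      simp only [Function.comp_def, map_list_prod, List.map_map, eval_X, h6]
      rfl
    rw [h7]

end CubicGap

namespace CubicGap

open Function

/-! ## The string of a circuit -/

namespace Gate

variable {l : ℕ}

theorem encode_flip (g : Gate l) : (g.encode.map Sym.swap).reverse = g.flip.encode := by
  cases g <;> simp [encode, flip, Sym.had, Sym.var, Sym.swap]

end Gate

namespace InternalCircuit

variable {l : ℕ}

/-- A column of Hadamard gates. -/
def layer (l : ℕ) : InternalCircuit l := (List.finRange l).map Gate.H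

/-- The number of variables and the current variables after a circuit. -/
def run (C : InternalCircuit l) (s : ℕ × (Fin l → ℕ)) : ℕ × (Fin l → ℕ) :=
  C.foldl (fun s g => g.next s) s

/-- The assembler turns the string into the monomials of the circuit. -/
def Describes (w : List Sym) (C : InternalCircuit l) : Prop :=
  ∀ s out, w.foldl Asm.step ⟨0, s.1, List.ofFn s.2, out⟩ =
    ⟨0, (C.run s).1, List.ofFn (C.run s).2, out ++ (C.monomials s).flatMap monomialString⟩

theorem monomials_append (C D : InternalCircuit l) : ∀ s,
    monomials (C ++ D) s = monomials C s ++ monomials D (run C s) := by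
  induction C with
  | nil => intro s; rfl
  | cons g C ih => intro s; exact congrArg _ (ih _)

theorem Describes.append {w w' : List Sym} {C D : InternalCircuit l} (h : Describes w C)
    (h' : Describes w' D) : Describes (w ++ w') (C ++ D) := by
  intro s out
  rw [List.foldl_append, h, h', monomials_append, run, run, run, List.foldl_append,
    List.flatMap_append, List.append_assoc]

theorem step_ticks (a i n : ℕ) (cur : List ℕ) (out : List PolySym) :
    (List.replicate i Sym.tick).foldl Asm.step ⟨a, n, cur, out⟩ = ⟨a + i, n, cur, out⟩ := by
  induction i generalizing a with
  | zero => rfl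
  | succ i ih =>
    rw [List.replicate_succ, List.foldl_cons]
    refine (ih (a + 1)).trans ?_
    rw [Nat.add_right_comm, Nat.add_assoc]

theorem step_var (i : Fin l) (n : ℕ) (cur : Fin l → ℕ) (out : List PolySym) :
    (Sym.var i).foldl Asm.step ⟨0, n, List.ofFn cur, out⟩ =
      ⟨0, n, List.ofFn cur, out ++ PolySym.num (cur i)⟩ := by
  rw [Sym.var, List.foldl_cons, List.foldl_append]
  refine (congrArg (List.foldl Asm.step · [Sym.vc]) (step_ticks 0 i n (List.ofFn cur) out)).trans ?_
  simp [Asm.step]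

theorem describes_gate (g : Gate l) : Describes g.encode [g] := by
  intro s out
  have hfo (c : List ℕ) (o : List PolySym) : Asm.step ⟨0, s.1, c, o⟩ .fo = ⟨0, s.1, c, o⟩ := rfl
  have hfc (c : List ℕ) (o : List PolySym) :
    Asm.step ⟨0, s.1, c, o⟩ .fc = ⟨0, s.1, c, o ++ [.semicolon]⟩ := rfl
  cases g with
  | H i =>
    rw [Gate.encode, Sym.had, List.foldl_cons, List.foldl_append]
    refine (congrArg (List.foldl Asm.step · [Sym.hc])
      (step_ticks 0 i s.1 (List.ofFn s.2) out)).trans ?_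
    have h : (List.ofFn s.2).drop i = s.2 i :: (List.ofFn s.2).drop (i + 1) := by
      rw [List.drop_eq_getElem_cons (by simp)]
      simp
    simp only [List.foldl_cons, List.foldl_nil, Asm.step, Nat.zero_add, h, run, Gate.next,
      monomials, Gate.term]
    congr 1
    · apply List.ext_getElem
      · simp; lia
      · intro k h1 h2
        rw [List.getElem_ofFn, List.getElem_append]
        have hi : (List.take i (List.ofFn s.2)).length = i := by simp
        rcases lt_trichotomy k i with hk | rfl | hk
        · simp [hi, hk, Fin.ext_iff, hk.ne]
        · simp [hi]
        · obtain ⟨d, rfl⟩ := Nat.exists_eq_add_of_lt hk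
          have h4 : i + d + 1 - i = d + 1 := by lia
          have h5 : ¬(i + d + 1 < i) := by lia
          rw [update_of_ne fun e => hk.ne' (congrArg Fin.val e)]
          simp [hi, h4, add_right_comm, h5]
    · simp [monomialString]
  | Z i =>
    simp [Gate.encode, hfo, hfc, step_var, run, Gate.next, monomials, Gate.term, monomialString]
  | CZ i j hij =>
    simp [Gate.encode, hfo, hfc, step_var, run, Gate.next, monomials, Gate.term, monomialString]
  | CCZ i j k hij hik hjk =>
    simp [Gate.encode, hfo, hfc, step_var, run, Gate.next, monomials, Gate.term, monomialString]

theorem describes_nil : Describes [] ([] : InternalCircuit l) := by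
  intro s out
  simp [run, monomials]

theorem describes_gates (C : InternalCircuit l) : Describes (C.flatMap Gate.encode) C := by
  induction C with
  | nil => exact describes_nil
  | cons g C ih => exact (describes_gate g).append ih

/-- A Hadamard gate on one wire leaves the current variables of the others alone, so a layer may
read all old variables at once. -/
theorem monomials_hadamards (L : List (Fin l)) (hL : L.Nodup) : ∀ s,
    (monomials (L.map Gate.H) s).flatMap monomialString = layerOut s.1 (L.map s.2) := by
  induction L with
  | nil => intro s; rfl
  | cons i L ih =>
    intro s
    rw [List.nodup_cons] at hL
    rw [List.map_cons, monomials, List.flatMap_cons, ih hL.2, List.map_cons, layerOut]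
    have : L.map (update s.2 i s.1) = L.map s.2 := by
      refine List.map_congr_left fun j hj => update_of_ne ?_ _ _
      rintro rfl
      exact hL.1 hj
    simp [Gate.next, this, Gate.term, monomialString]

theorem run_hadamards_fst (L : List (Fin l)) : ∀ s,
    (run (L.map Gate.H) s).1 = s.1 + L.length := by
  induction L with
  | nil => intro s; rfl
  | cons i L ih =>
    intro s
    refine (ih _).trans ?_
    simp only [Gate.next, List.length_cons]
    lia

theorem run_hadamards_of_notMem (L : List (Fin l)) (i : Fin l) (hi : i ∉ L) : ∀ s,
    (run (L.map Gate.H) s).2 i = s.2 i := by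
  induction L with
  | nil => intro s; rfl
  | cons j L ih =>
    intro s
    rw [List.mem_cons, not_or] at hi
    refine (ih hi.2 _).trans ?_
    exact update_of_ne hi.1 _ _

theorem run_hadamards_getElem (L : List (Fin l)) (hL : L.Nodup) : ∀ s k (hk : k < L.length),
    (run (L.map Gate.H) s).2 L[k] = s.1 + k := by
  induction L with
  | nil => intro s k hk; simp at hk
  | cons i L ih =>
    intro s k hk
    rw [List.nodup_cons] at hL
    cases k with
    | zero =>
      refine (run_hadamards_of_notMem L i hL.1 _).trans ?_
      exact update_self ..
    | succ k =>
      refine (ih hL.2 _ k (by simpa using hk)).trans ?_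
      simp only [Gate.next]
      lia

theorem describes_layer : Describes [Sym.layer] (layer l) := by
  intro s out
  have h (i : Fin l) : (run (layer l) s).2 i = s.1 + i := by
    have := run_hadamards_getElem (List.finRange l) (List.nodup_finRange l) s i (by simp)
    rwa [List.getElem_finRange] at this
  have h1 : List.range' s.1 l = List.ofFn (run (layer l) s).2 := by
    refine List.ext_getElem (by simp) fun k _ _ => ?_
    simp [h]
  have h2 := monomials_hadamards (List.finRange l) (List.nodup_finRange l) s
  have h3 := run_hadamards_fst (List.finRange l) s
  rw [List.length_finRange] at h3
  simp only [List.foldl_cons, List.foldl_nil, Asm.step, List.length_ofFn]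
  rw [layer, h2, h3, ← layer, h1, ← List.ofFn_eq_map]

/-- Each new wire goes to the front of the list, so wire i of l starts with the variable l - 1 - i.
-/
theorem fold_wires (l : ℕ) : (List.replicate l Sym.wire).foldl Asm.step ⟨0, 0, [], []⟩ =
    ⟨0, l, List.ofFn (start l).2, []⟩ := by
  induction l with
  | zero => rfl
  | succ l ih =>
    rw [List.replicate_succ', List.foldl_append, ih]
    simp [Asm.step, List.ofFn_succ, start]

theorem run_fst (C : InternalCircuit l) : ∀ s, (run C s).1 = s.1 + numH C := by
  induction C with
  | nil => intro s; rfl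
  | cons g C ih => intro s; exact (ih _).trans (next_fst_add g s C)

theorem assemble_eq {w : List Sym} {C : InternalCircuit l} (h : Describes w C) :
    assemble (List.replicate l Sym.wire ++ w) = PolySym.num (l + C.numH) ++
      (C.monomials (start l)).flatMap monomialString := by
  have h1 := h (start l) []
  rw [assemble, List.foldl_append, fold_wires]
  have h2 : (start l).1 = l := rfl
  rw [h2] at h1
  rw [h1, run_fst]
  rfl

end InternalCircuit

/-- The circuit over Hadamard, Z, CZ and CCZ gates that estimates the majority of three runs of a
quantum circuit. -/
def QCircuit.sandwich (C : QCircuit) : InternalCircuit ((C.qubits + 1) * 3) :=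
  InternalCircuit.layer _ ++ C.tripled ++ (majority (Fin.succ ⟨0, C.qubits_pos⟩) ++
    (C.tripled.reverse.map Gate.flip ++ InternalCircuit.layer _))

open InternalCircuit in
theorem assemble_transpile (C : QCircuit) : assemble C.transpile =
    PolySym.num ((C.qubits + 1) * 3 + C.sandwich.numH) ++
      (C.sandwich.monomials (start _)).flatMap monomialString := by
  have h (G : InternalCircuit ((C.qubits + 1) * 3)) :
      (((G.flatMap Gate.encode).map Sym.swap).reverse) =
        (G.reverse.map Gate.flip).flatMap Gate.encode := by
    induction G with
    | nil => rfl
    | cons g G ih =>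
      rw [List.flatMap_cons, List.map_append, List.reverse_append, ih, Gate.encode_flip]
      simp
  rw [QCircuit.transpile]
  refine assemble_eq ?_
  refine (describes_layer.append (describes_gates _)).append ((describes_gates _).append ?_)
  rw [List.map_cons, List.reverse_cons, h]
  exact (describes_gates _).append describes_layer

theorem sandwich_actsOn (C : QCircuit) (q : Fin ((C.qubits + 1) * 3)) :
    ∃ g ∈ C.sandwich, g.ActsOn q :=
  ⟨.H q, by simp [QCircuit.sandwich, InternalCircuit.layer], rfl⟩

end CubicGap

namespace CubicGap

open Function

/-! ## Operators of circuits -/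

theorem sgn_mul_self (b : Bool) : sgn b * sgn b = 1 := by cases b <;> simp

/-- Flipping bit i pairs the assignments. This reduces identities for a Hadamard gate on wire i to
pointwise identities for a 2 × 2 matrix. -/
theorem two_mul_sum_update {m : ℕ} (i : Fin m) (F : (Fin m → Bool) → ℝ) :
    2 * ∑ y, F y = ∑ y, (F (update y i false) + F (update y i true)) := by
  have hinv : Involutive fun y : Fin m → Bool => update y i (!y i) := fun y => by simp
  have h : ∑ y, F (update y i (!y i)) = ∑ y, F y := Equiv.sum_comp (hinv.toPerm _) F
  rw [two_mul]
  nth_rw 2 [← h]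
  rw [← Finset.sum_add_distrib]
  refine Finset.sum_congr rfl fun y _ => ?_
  cases hy : y i
  · rw [← hy, update_eq_self, hy]; rfl
  · rw [← hy, update_eq_self, hy, add_comm]; rfl

/-- The state `|0…0⟩`. -/
def zeroState (m : ℕ) : (Fin m → Bool) → ℝ := fun y => if ∀ i, y i = false then 1 else 0

namespace Gate

variable {m : ℕ}

theorem sum_mul_op (g : Gate m) (φ ψ : (Fin m → Bool) → ℝ) :
    ∑ y, φ y * g.op ψ y = ∑ y, g.op φ y * ψ y := by
  cases g with
  | H i =>
    refine mul_left_cancel₀ (two_ne_zero (α := ℝ)) ?_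
    rw [two_mul_sum_update i, two_mul_sum_update i]
    refine Finset.sum_congr rfl fun y _ => ?_
    simp [op]
    ring
  | _ => exact Finset.sum_congr rfl fun y _ => by simp only [op]; ring

theorem sum_op_sq (g : Gate m) (ψ : (Fin m → Bool) → ℝ) :
    ∑ y, g.op ψ y ^ 2 = (if g.isH then 2 else 1) * ∑ y, ψ y ^ 2 := by
  have h (b : Bool) : sgn b ^ 2 = 1 := by rw [sq, sgn_mul_self]
  cases g with
  | H i =>
    refine mul_left_cancel₀ (two_ne_zero (α := ℝ)) ?_
    rw [isH, if_pos rfl, two_mul_sum_update i, two_mul_sum_update i, Finset.mul_sum]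
    refine Finset.sum_congr rfl fun y _ => ?_
    simp [op]
    ring
  | _ => simp [op, isH, mul_pow, h]

theorem op_flip (g : Gate m) : g.flip.op = g.op := by
  cases g with
  | CZ i j hij => funext ψ y; simp only [flip, op, Bool.and_comm]
  | CCZ i j k => funext ψ y; simp only [flip, op]; congr 2; cases y i <;> cases y j <;> cases y k <;> rfl
  | _ => rfl

theorem op_smul (g : Gate m) (c : ℝ) (ψ : (Fin m → Bool) → ℝ) : g.op (c • ψ) = c • g.op ψ := by
  cases g <;> funext y <;> simp only [op, Pi.smul_apply, smul_eq_mul] <;> ring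

end Gate

namespace InternalCircuit

variable {m : ℕ}

/-- The action of a circuit on a state. -/
def evolve (C : InternalCircuit m) (ψ : (Fin m → Bool) → ℝ) : (Fin m → Bool) → ℝ :=
  C.foldl (fun ψ g => g.op ψ) ψ

theorem op_reverse (C : InternalCircuit m) (ψ : (Fin m → Bool) → ℝ) :
    op C.reverse ψ = evolve C ψ := List.foldr_reverse ..

theorem op_append (C D : InternalCircuit m) (ψ : (Fin m → Bool) → ℝ) :
    op (C ++ D) ψ = op C (op D ψ) := List.foldr_append ..

theorem evolve_append (C D : InternalCircuit m) (ψ : (Fin m → Bool) → ℝ) :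
    evolve (C ++ D) ψ = evolve D (evolve C ψ) := List.foldl_append ..

theorem op_map_flip (C : InternalCircuit m) (ψ : (Fin m → Bool) → ℝ) :
    op (C.map Gate.flip) ψ = op C ψ := by
  rw [op, List.foldr_map]
  simp only [Gate.op_flip]
  rfl

/-- Every gate is a symmetric matrix. Moving the gates to the other factor one at a time reverses
their order, which turns `op` into `evolve`. -/
theorem sum_mul_op (C : InternalCircuit m) : ∀ φ ψ : (Fin m → Bool) → ℝ,
    ∑ y, φ y * op C ψ y = ∑ y, evolve C φ y * ψ y := by
  induction C with
  | nil => intro φ ψ; rfl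
  | cons g C ih => intro φ ψ; exact (g.sum_mul_op φ _).trans (ih _ _)

theorem sum_evolve_sq (C : InternalCircuit m) : ∀ ψ : (Fin m → Bool) → ℝ,
    ∑ y, evolve C ψ y ^ 2 = 2 ^ numH C * ∑ y, ψ y ^ 2 := by
  induction C with
  | nil => intro ψ; simp [evolve, numH]
  | cons g C ih =>
    intro ψ
    refine (ih _).trans ?_
    rw [g.sum_op_sq, numH, numH, List.countP_cons, pow_add, mul_assoc]
    congr 2
    cases g.isH <;> simp

theorem evolve_smul (C : InternalCircuit m) (c : ℝ) : ∀ ψ : (Fin m → Bool) → ℝ,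
    evolve C (c • ψ) = c • evolve C ψ := by
  induction C with
  | nil => intro ψ; rfl
  | cons g C ih => intro ψ; refine (congrArg (evolve C) (g.op_smul c ψ)).trans (ih _)

/-- On the constant function 1, a Hadamard gate gives 1 + 1 where its bit is 0 and 1 - 1 where it is
1. -/
theorem op_hadamards (L : List (Fin m)) (hL : L.Nodup) : op (L.map Gate.H) (fun _ => 1) =
    fun y => if ∀ i ∈ L, y i = false then 2 ^ L.length else 0 := by
  induction L with
  | nil => simp [op]
  | cons i L ih =>
    rw [List.nodup_cons] at hL
    have h := ih hL.2
    refine (congrArg (Gate.H i).op h).trans ?_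
    funext y
    have h1 (b : Bool) : (∀ j ∈ L, update y i b j = false) ↔ ∀ j ∈ L, y j = false := by
      refine forall₂_congr fun j hj => ?_
      rw [update_of_ne]
      rintro rfl
      exact hL.1 hj
    simp only [Gate.op, h1, List.forall_mem_cons, List.length_cons]
    by_cases h2 : ∀ j ∈ L, y j = false
    · cases hy : y i
      · simp only [if_pos h2, sgn_false, true_and]
        ring
      · simp [if_pos h2]
    · simp only [h2, and_false, if_false]
      ring

theorem op_layer : op (layer m) (fun _ => 1) = (2 : ℝ) ^ m • zeroState m := by
  rw [layer, op_hadamards _ (List.nodup_finRange m)]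
  funext y
  simp [zeroState]

theorem evolve_layer : evolve (layer m) (fun _ => 1) = (2 : ℝ) ^ m • zeroState m := by
  rw [← op_reverse, layer, ← List.map_reverse, op_hadamards _ (by simpa using List.nodup_finRange m)]
  funext y
  simp [zeroState]

end InternalCircuit

/-! ## Three copies -/

/-- The product of states of the copies. -/
def prodState {m : ℕ} (u : Fin 3 → (Fin m → Bool) → ℝ) : (Fin (m * 3) → Bool) → ℝ :=
  fun y => ∏ j, u j fun q => y (copyEmb m j q)

section

variable {m : ℕ}

theorem copyEmb_inj {j j' : Fin 3} {q q' : Fin m} :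
    copyEmb m j q = copyEmb m j' q' ↔ q = q' ∧ j = j' := by
  refine finProdFinEquiv.injective.eq_iff.trans ?_
  rw [Prod.mk.injEq]

theorem prodState_update (u : Fin 3 → (Fin m → Bool) → ℝ) (j : Fin 3) (w : (Fin m → Bool) → ℝ)
    (y : Fin (m * 3) → Bool) : prodState (update u j w) y = w (fun q => y (copyEmb m j q)) *
      ∏ j' ∈ Finset.univ.erase j, u j' fun q => y (copyEmb m j' q) := by
  rw [prodState, ← Finset.mul_prod_erase _ _ (Finset.mem_univ j), update_self]
  congr 1
  exact Finset.prod_congr rfl fun j' hj => by rw [update_of_ne (Finset.ne_of_mem_erase hj)]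

/-- Distinct copies use disjoint wires, so a gate on copy j changes only the factor of that copy. -/
theorem op_map_prodState (u : Fin 3 → (Fin m → Bool) → ℝ) (j : Fin 3) (g : Gate m) :
    (g.map (copyEmb m j)).op (prodState u) = prodState (update u j (g.op (u j))) := by
  funext y
  rw [prodState_update]
  have h := prodState_update u j (u j)
  rw [update_eq_self] at h
  cases g with
  | H i =>
    have h1 (b : Bool) : (fun q => update y (copyEmb m j i) b (copyEmb m j q)) =
        update (fun q => y (copyEmb m j q)) i b := by
      funext q
      simp [update_apply]
    have h2 (b : Bool) : ∏ j' ∈ Finset.univ.erase j,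
        u j' (fun q => update y (copyEmb m j i) b (copyEmb m j' q)) =
          ∏ j' ∈ Finset.univ.erase j, u j' fun q => y (copyEmb m j' q) := by
      refine Finset.prod_congr rfl fun j' hj => ?_
      congr 1
      funext q
      rw [update_of_ne]
      rw [Ne, copyEmb_inj]
      exact fun e => Finset.ne_of_mem_erase hj e.2
    simp only [Gate.map, Gate.op, h, h1, h2]
    ring
  | _ => simp only [Gate.map, Gate.op, h]; ring

open InternalCircuit

theorem evolve_map_prodState (j : Fin 3) (G : List (Gate m)) :
    ∀ u : Fin 3 → (Fin m → Bool) → ℝ, evolve (G.map (Gate.map (copyEmb m j))) (prodState u) =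
      prodState (update u j (evolve G (u j))) := by
  induction G with
  | nil => intro u; exact congrArg prodState (update_eq_self ..).symm
  | cons g G ih =>
    intro u
    refine (congrArg _ (op_map_prodState u j g)).trans ((ih _).trans ?_)
    rw [update_idem, update_self]
    rfl

theorem evolve_triple (G : List (Gate m)) (u : (Fin m → Bool) → ℝ) :
    evolve (triple G) (prodState fun _ => u) = prodState fun _ => evolve G u := by
  have : triple G = G.map (Gate.map (copyEmb m 0)) ++ (G.map (Gate.map (copyEmb m 1)) ++
    G.map (Gate.map (copyEmb m 2))) := by simp [triple]
  rw [this, evolve_append, evolve_append, evolve_map_prodState, evolve_map_prodState,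
    evolve_map_prodState]
  congr 1
  funext j
  fin_cases j <;> simp

theorem evolve_flatMap_triple {α : Type} (f : α → List (Gate m)) (l : List α) :
    ∀ u : (Fin m → Bool) → ℝ, evolve (l.flatMap fun a => triple (f a)) (prodState fun _ => u) =
      prodState fun _ => evolve (l.flatMap f) u := by
  induction l with
  | nil => intro u; rfl
  | cons a l ih =>
    intro u
    rw [List.flatMap_cons, List.flatMap_cons, evolve_append, evolve_append, evolve_triple, ih]

theorem numH_flatMap_triple {α : Type} (f : α → List (Gate m)) (l : List α) :
    numH (l.flatMap fun a => triple (f a)) = 3 * numH (l.flatMap f) := by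
  have h (j : Fin 3) (g : Gate m) : (g.map (copyEmb m j)).isH = g.isH := by cases g <;> rfl
  have h1 (G : List (Gate m)) : numH (triple G) = 3 * numH G := by
    simp [triple, numH, List.countP_map, Function.comp_def, h]
    ring
  induction l with
  | nil => rfl
  | cons a l ih =>
    rw [List.flatMap_cons, List.flatMap_cons, numH, List.countP_append, ← numH, ← numH, h1, ih,
      numH, numH, numH, List.countP_append]
    ring

theorem zeroState_eq_prodState : zeroState (m * 3) = prodState fun _ => zeroState m := by
  funext y
  have : (∀ i, y i = false) ↔ ∀ j ∈ Finset.univ, ∀ q, y (copyEmb m j q) = false := by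
    refine ⟨fun h j _ q => h _, fun h i => ?_⟩
    have := h (finProdFinEquiv.symm i).2 (Finset.mem_univ _) (finProdFinEquiv.symm i).1
    have he : copyEmb m (finProdFinEquiv.symm i).2 (finProdFinEquiv.symm i).1 = i :=
      finProdFinEquiv.apply_symm_apply i
    rwa [he] at this
  simp only [zeroState, prodState, Finset.prod_ite_zero, this]
  simp

theorem sum_prod_copies (F : Fin 3 → (Fin m → Bool) → ℝ) :
    ∑ y : Fin (m * 3) → Bool, ∏ j, F j (fun q => y (copyEmb m j q)) = ∏ j, ∑ z, F j z := by
  rw [Finset.prod_univ_sum, Fintype.piFinset_univ]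
  let e : (Fin 3 → Fin m → Bool) ≃ (Fin (m * 3) → Bool) :=
    { toFun := fun z i => z (finProdFinEquiv.symm i).2 (finProdFinEquiv.symm i).1
      invFun := fun y j q => y (copyEmb m j q)
      left_inv := fun z => by
        funext j q
        have : finProdFinEquiv.symm (copyEmb m j q) = (q, j) := finProdFinEquiv.symm_apply_apply _
        simp only [this]
      right_inv := fun y => by
        funext i
        exact congrArg y (finProdFinEquiv.apply_symm_apply i) }
  rw [← e.sum_comp]
  refine Finset.sum_congr rfl fun z _ => Finset.prod_congr rfl fun j _ => ?_
  exact congrArg (F j) (congrFun (e.symm_apply_apply z) j)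

/-- The three CZ gates multiply by (-1)^(ab + bc + ca), the sign of the majority of a, b, c. The
right side is its expansion in products of the signs of the three bits. -/
theorem op_majority (q : Fin m) (ψ : (Fin (m * 3) → Bool) → ℝ) (y : Fin (m * 3) → Bool) :
    op (majority q) ψ y = (sgn (y (copyEmb m 0 q)) + sgn (y (copyEmb m 1 q)) +
      sgn (y (copyEmb m 2 q)) - sgn (y (copyEmb m 0 q)) * sgn (y (copyEmb m 1 q)) *
        sgn (y (copyEmb m 2 q))) / 2 * ψ y := by
  simp only [majority, op, List.foldr_cons, List.foldr_nil, Gate.op]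
  cases y (copyEmb m 0 q) <;> cases y (copyEmb m 1 q) <;> cases y (copyEmb m 2 q) <;> norm_num

/-- Each product of signs factorises over the copies, into factors ∑ u² for the copies without a
sign and ∑ sgn · u² for those with one. -/
theorem sum_majority (q : Fin m) (u : (Fin m → Bool) → ℝ) :
    ∑ y, prodState (fun _ => u) y * op (majority q) (prodState fun _ => u) y =
      (3 * (∑ z, u z ^ 2) ^ 2 * (∑ z, sgn (z q) * u z ^ 2) - (∑ z, sgn (z q) * u z ^ 2) ^ 3) / 2 := by
  have h (ε : Fin 3 → Bool) := sum_prod_copies fun j z => (if ε j then sgn (z q) else 1) * u z ^ 2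
  have h0 := h ![true, false, false]
  have h1 := h ![false, true, false]
  have h2 := h ![false, false, true]
  have h3 := h ![true, true, true]
  simp only [Fin.prod_univ_three] at h0 h1 h2 h3
  simp at h0 h1 h2 h3
  have : (3 * (∑ z, u z ^ 2) ^ 2 * (∑ z, sgn (z q) * u z ^ 2) - (∑ z, sgn (z q) * u z ^ 2) ^ 3) / 2 =
    ((∑ z, sgn (z q) * u z ^ 2) * (∑ z, u z ^ 2) * (∑ z, u z ^ 2) +
      (∑ z, u z ^ 2) * (∑ z, sgn (z q) * u z ^ 2) * (∑ z, u z ^ 2) +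
      (∑ z, u z ^ 2) * (∑ z, u z ^ 2) * (∑ z, sgn (z q) * u z ^ 2) -
      (∑ z, sgn (z q) * u z ^ 2) * (∑ z, sgn (z q) * u z ^ 2) * (∑ z, sgn (z q) * u z ^ 2)) / 2 := by
    ring
  rw [this, ← h0, ← h1, ← h2, ← h3, ← Finset.sum_add_distrib, ← Finset.sum_add_distrib,
    ← Finset.sum_sub_distrib, Finset.sum_div]
  refine Finset.sum_congr rfl fun y _ => ?_
  rw [op_majority, prodState, Fin.prod_univ_three]
  ring

end

end CubicGap

namespace CubicGap

open Function InternalCircuit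

/-- The time of a computation depends only on the encoded output. -/
theorem PolyTime.congr {α β β' A B : Type} {ea : α → List A} {eb : β → List B} {eb' : β' → List B}
    {f : α → β} {f' : α → β'} (hf : PolyTime ea eb f) (h : ∀ a, eb (f a) = eb' (f' a)) :
    PolyTime ea eb' f' := by
  obtain ⟨M⟩ := hf
  refine ⟨⟨M.toTM2ComputableAux, M.time, fun a => ?_⟩⟩
  rw [← h]
  exact M.outputsFun a

/-! ## Real gates for complex gates -/

/-- A complex state as a real state with an additional qubit. -/
def realify {l : ℕ} (ψ : QState l) : (Fin (l + 1) → Bool) → ℝ :=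
  fun y => if y 0 then (ψ (Fin.tail y)).im else (ψ (Fin.tail y)).re

theorem realify_update {l : ℕ} (ψ : QState l) (y : Fin (l + 1) → Bool) (a : Fin l) (b : Bool) :
    realify ψ (update y a.succ b) = realify (fun x => ψ (update x a b)) y := by
  have : (0 : Fin (l + 1)) ≠ a.succ := (Fin.succ_ne_zero a).symm
  simp [realify, Fin.tail_update_succ, update_of_ne this]

/-- Each unnormalised Hadamard gate is √2 times a unitary, and the normalised products act on the
pair of real and imaginary parts exactly as the given gate acts on the complex state. -/
theorem evolve_realize {l : ℕ} (g : QGate l) (ψ : QState l) :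
    evolve g.realize (realify ψ) = √2 ^ numH g.realize • realify (g.apply ψ) := by
  have h2 : √2 ^ 2 = 2 := Real.sq_sqrt zero_le_two
  funext y
  cases g with
  | hadamard a =>
    have h : ((1 : ℂ) / (√2 : ℝ)) = ((1 / √2 : ℝ) : ℂ) := by push_cast; rfl
    have h0 : √2 * (1 / √2) = 1 := mul_one_div_cancel (by positivity)
    have hn : numH (QGate.hadamard a).realize = 1 := rfl
    have hy : Fin.tail y a = y a.succ := rfl
    rw [Pi.smul_apply, smul_eq_mul, hn, pow_one]
    simp only [QGate.realize, evolve, List.foldl_cons, List.foldl_nil, Gate.op,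
      realify_update]
    simp only [realify, QGate.apply, h, hy]
    generalize 1 / √2 = c at h0
    simp only [Complex.re_ofReal_mul, Complex.im_ofReal_mul, ← mul_ite, ← mul_assoc, h0]
    cases y 0 <;> cases y a.succ <;> simp
  | phase a =>
    simp only [QGate.realize, evolve, List.foldl_cons, List.foldl_nil, Gate.op,
      numH, List.countP_cons, List.countP_nil, Gate.isH, Pi.smul_apply, smul_eq_mul]
    have hy : Fin.tail y a = y a.succ := rfl
    simp [realify, QGate.apply, hy, Fin.tail_update_zero, h2]
    cases y 0 <;> cases y a.succ <;> simp <;> ring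
  | toffoli a b c hab hac hbc =>
    simp only [QGate.realize, evolve, List.foldl_cons, List.foldl_nil, Gate.op, realify_update,
      numH, List.countP_cons, List.countP_nil, Gate.isH, Pi.smul_apply, smul_eq_mul]
    have hy (q : Fin l) : Fin.tail y q = y q.succ := rfl
    have hac' : a.succ ≠ c.succ := fun h => hac (Fin.succ_injective l h)
    have hbc' : b.succ ≠ c.succ := fun h => hbc (Fin.succ_injective l h)
    simp [realify, QGate.apply, hy, h2, hac', hbc']
    cases y 0 <;> cases y a.succ <;> cases y b.succ <;> cases y c.succ <;> simp <;> ring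

theorem evolve_flatMap_realize {l : ℕ} (gs : List (QGate l)) : ∀ ψ : QState l,
    evolve (gs.flatMap QGate.realize) (realify ψ) =
      √2 ^ numH (gs.flatMap QGate.realize) • realify (gs.foldl (fun ψ g => g.apply ψ) ψ) := by
  induction gs with
  | nil => intro ψ; simp [evolve, numH]
  | cons g gs ih =>
    intro ψ
    rw [List.flatMap_cons, evolve_append, evolve_realize, evolve_smul, ih, smul_smul, numH, numH,
      numH, List.countP_append, pow_add]
    rfl

theorem realify_single {l : ℕ} :
    realify (Pi.single (fun _ => false) 1 : QState l) = zeroState (l + 1) := by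
  funext y
  have h : (∀ i, y i = false) ↔ y 0 = false ∧ Fin.tail y = fun _ => false := by
    rw [Fin.forall_fin_succ, funext_iff]
    rfl
  simp only [realify, zeroState, h, Pi.single_apply]
  cases y 0 <;> by_cases h1 : Fin.tail y = fun _ => false <;> simp [h1]

theorem sum_realify {l : ℕ} (ψ : QState l) (w : (Fin l → Bool) → ℝ) :
    ∑ y, w (Fin.tail y) * realify ψ y ^ 2 = ∑ x, w x * ‖ψ x‖ ^ 2 := by
  rw [← (Fin.consEquiv fun _ : Fin (l + 1) => Bool).sum_comp, Fintype.sum_prod_type,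
    Fintype.sum_bool, ← Finset.sum_add_distrib]
  refine Finset.sum_congr rfl fun x _ => ?_
  simp only [Fin.consEquiv, Equiv.coe_fn_mk, realify, Fin.tail_cons, Fin.cons_zero, if_true,
    Complex.sq_norm, Complex.normSq_apply]
  simp
  ring

/-! ### From the acceptance probability to the gap -/

namespace QCircuit

variable (C : QCircuit)

/-- The circuit over real gates for one copy. -/
def real : InternalCircuit (C.qubits + 1) := C.gates.flatMap QGate.realize

theorem evolve_real : evolve C.real (zeroState _) = √2 ^ numH C.real • realify C.output := by
  rw [← realify_single]
  exact evolve_flatMap_realize _ _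

/-- Unitarity is read off from the real circuit: each of its Hadamard gates doubles the squared
norm, and this cancels against the power of √2 in `evolve_real`. -/
theorem sum_norm_output : ∑ x, ‖C.output x‖ ^ 2 = 1 := by
  have h := sum_evolve_sq C.real (zeroState _)
  have h1 := sum_realify C.output fun _ => 1
  have h2 : ∑ y, zeroState (C.qubits + 1) y ^ 2 = 1 := by
    rw [Finset.sum_eq_single fun _ => false]
    · simp [zeroState]
    · intro y _ hy
      have : ¬∀ i, y i = false := fun h => hy (funext h)
      simp [zeroState, this]
    · simp
  have h3 : √2 ^ 2 = 2 := Real.sq_sqrt zero_le_two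
  simp only [one_mul] at h1
  rw [evolve_real, h2, mul_one] at h
  simp only [Pi.smul_apply, smul_eq_mul, mul_pow, ← pow_mul, mul_comm (numH _) 2, ← Finset.mul_sum]
    at h
  rw [pow_mul, h3, h1] at h
  exact mul_left_cancel₀ (pow_ne_zero (numH C.real) (two_ne_zero (α := ℝ))) (by rw [h, mul_one])

theorem acceptProb_nonneg : 0 ≤ C.acceptProb :=
  Finset.sum_nonneg fun x _ => by split_ifs <;> positivity

theorem acceptProb_le_one : C.acceptProb ≤ 1 := by
  rw [← C.sum_norm_output]
  exact Finset.sum_le_sum fun x _ => by split_ifs <;> [exact le_rfl; positivity]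

theorem sum_sgn_evolve_real :
    ∑ y, sgn (y (Fin.succ ⟨0, C.qubits_pos⟩)) * evolve C.real (zeroState _) y ^ 2 =
      2 ^ numH C.real * (1 - 2 * C.acceptProb) := by
  have h1 := sum_realify C.output fun x => sgn (x ⟨0, C.qubits_pos⟩)
  have h3 : √2 ^ 2 = 2 := Real.sq_sqrt zero_le_two
  have h4 : ∑ x, sgn (x ⟨0, C.qubits_pos⟩) * ‖C.output x‖ ^ 2 = 1 - 2 * C.acceptProb := by
    rw [← C.sum_norm_output, acceptProb, Finset.mul_sum, ← Finset.sum_sub_distrib]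
    refine Finset.sum_congr rfl fun x _ => ?_
    cases x ⟨0, C.qubits_pos⟩ <;> simp
    ring
  rw [← h4, ← h1, evolve_real, Finset.mul_sum]
  refine Finset.sum_congr rfl fun y _ => ?_
  rw [Pi.smul_apply, smul_eq_mul, mul_pow, ← pow_mul, mul_comm (numH _) 2, pow_mul, h3, Fin.tail]
  ring

theorem sum_evolve_real : ∑ y, evolve C.real (zeroState _) y ^ 2 = 2 ^ numH C.real := by
  have h1 := sum_realify C.output fun _ => 1
  simp only [one_mul, C.sum_norm_output] at h1
  rw [evolve_real]
  simp only [Pi.smul_apply, smul_eq_mul, mul_pow, ← pow_mul, mul_comm (numH _) 2, ← Finset.mul_sum,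
    h1]
  rw [pow_mul, Real.sq_sqrt zero_le_two, mul_one]

/-- By symmetry of the gates, both halves of the circuit turn the all-ones vector into the same
state, 2^l times three copies of the final state of the real circuit. What remains is the
expectation of the majority sign in that state, with weights 2^h and 2^h (1 - 2p) in each copy. -/
theorem sum_op_sandwich : ∑ y, C.sandwich.op (fun _ => 1) y =
    4 ^ ((C.qubits + 1) * 3) * 8 ^ numH C.real *
      ((3 * (1 - 2 * C.acceptProb) - (1 - 2 * C.acceptProb) ^ 3) / 2) := by
  have h1 : evolve C.tripled (zeroState _) = prodState fun _ => evolve C.real (zeroState _) := by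
    rw [zeroState_eq_prodState]
    exact evolve_flatMap_triple QGate.realize C.gates _
  have h2 : evolve (layer _ ++ C.tripled) (fun _ => 1) =
      (2 : ℝ) ^ ((C.qubits + 1) * 3) • prodState fun _ => evolve C.real (zeroState _) := by
    rw [evolve_append, evolve_layer, evolve_smul, h1]
  have h3 : op (C.tripled.reverse.map Gate.flip ++ layer _) (fun _ => 1) =
      (2 : ℝ) ^ ((C.qubits + 1) * 3) • prodState fun _ => evolve C.real (zeroState _) := by
    rw [op_append, op_layer, op_map_flip, op_reverse, evolve_smul, h1]
  have h4 := InternalCircuit.sum_mul_op (layer _ ++ C.tripled) (fun _ => 1)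
    (op (majority (Fin.succ ⟨0, C.qubits_pos⟩))
      (op (C.tripled.reverse.map Gate.flip ++ layer _) fun _ => 1))
  simp only [one_mul] at h4
  rw [← op_append, ← op_append] at h4
  rw [List.append_assoc] at h4
  rw [sandwich]
  refine h4.trans ?_
  rw [h2, h3]
  have h5 := sum_majority (Fin.succ ⟨0, C.qubits_pos⟩) (evolve C.real (zeroState _))
  rw [sum_sgn_evolve_real, sum_evolve_real] at h5
  have h6 (y) : op (majority (Fin.succ ⟨0, C.qubits_pos⟩))
      ((2 : ℝ) ^ ((C.qubits + 1) * 3) • prodState fun _ => evolve C.real (zeroState _)) y =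
      2 ^ ((C.qubits + 1) * 3) * op (majority (Fin.succ ⟨0, C.qubits_pos⟩))
        (prodState fun _ => evolve C.real (zeroState _)) y := by
    rw [op_majority, op_majority, Pi.smul_apply, smul_eq_mul]
    ring
  simp only [h6, Pi.smul_apply, smul_eq_mul, mul_mul_mul_comm, ← Finset.mul_sum]
  rw [h5]
  have h7 (n : ℕ) : (4 : ℝ) ^ n = (2 ^ n) ^ 2 := by
    rw [← pow_mul, mul_comm, pow_mul]
    norm_num
  have h8 (n : ℕ) : (8 : ℝ) ^ n = (2 ^ n) ^ 3 := by
    rw [← pow_mul, mul_comm, pow_mul]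
    norm_num
  rw [h7, h8]
  ring

/-- Two layers, and two passes through three copies; the majority gates are diagonal. -/
theorem numH_sandwich : C.sandwich.numH = 2 * ((C.qubits + 1) * 3) + 6 * numH C.real := by
  have h1 : numH (layer ((C.qubits + 1) * 3)) = (C.qubits + 1) * 3 := by
    simp [numH, layer, List.countP_map, Function.comp_def, Gate.isH]
  have h2 : numH C.tripled = 3 * numH C.real := numH_flatMap_triple _ _
  have h3 : numH (C.tripled.reverse.map Gate.flip) = numH C.tripled := by
    have (g : Gate ((C.qubits + 1) * 3)) : g.flip.isH = g.isH := by cases g <;> rfl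
    simp [numH, List.countP_map, Function.comp_def, this]
  have h4 : numH (majority (Fin.succ ⟨0, C.qubits_pos⟩)) = 0 := by
    simp [numH, majority, Gate.isH]
  have happ {m : ℕ} (D E : InternalCircuit m) : numH (D ++ E) = numH D + numH E :=
    List.countP_append
  rw [sandwich, happ, happ, happ, happ, h1, h3, h2, h4]
  ring

theorem exists_query : ∃ P : CubicPoly, P.encode = assemble C.transpile ∧
    ∀ a : ℚ, |(a : ℝ) - (gap P.poly : ℝ)| ≤
      1 / 3 * (2 : ℝ) ^ (((P.n : ℝ) + (circuitWidth P.poly : ℝ)) / 2) →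
      (2 / 3 ≤ C.acceptProb → a < 0) ∧ (C.acceptProb ≤ 1 / 3 → 0 < a) := by
  obtain ⟨P, hn, henc, hcorr, hgap⟩ := exists_cubicPoly C.sandwich (sandwich_actsOn C)
  refine ⟨P, by rw [henc, hn, assemble_transpile], fun a ha => ?_⟩
  have hw : circuitWidth P.poly ≤ (C.qubits + 1) * 3 := Nat.sInf_le ⟨_, hcorr⟩
  have hpow : (2 : ℝ) ^ (((P.n : ℝ) + (circuitWidth P.poly : ℝ)) / 2) ≤
      4 ^ ((C.qubits + 1) * 3) * 8 ^ numH C.real := by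
    have h1 : (4 : ℝ) ^ ((C.qubits + 1) * 3) * 8 ^ numH C.real =
        2 ^ (((2 * ((C.qubits + 1) * 3) + 3 * numH C.real : ℕ) : ℝ)) := by
      rw [Real.rpow_natCast, pow_add, pow_mul 2 2, pow_mul 2 3]
      norm_num
    rw [h1]
    refine Real.rpow_le_rpow_of_exponent_le one_le_two ?_
    -- With l = 3(qubits + 1) and h Hadamard gates in the real circuit, n = 3l + 6h. An upper bound
    -- l for the width is enough because the permitted error grows with the width.
    have h2 : P.n + circuitWidth P.poly ≤ 2 * (2 * ((C.qubits + 1) * 3) + 3 * numH C.real) := by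
      have := C.numH_sandwich
      lia
    have h3 : ((P.n + circuitWidth P.poly : ℕ) : ℝ) ≤
      ((2 * (2 * ((C.qubits + 1) * 3) + 3 * numH C.real) : ℕ) : ℝ) := Nat.cast_le.2 h2
    rw [Nat.cast_add, Nat.cast_mul, Nat.cast_two] at h3
    rw [div_le_iff₀ two_pos]
    linarith
  rw [hgap, sum_op_sandwich] at ha
  have hK : (0 : ℝ) < 4 ^ ((C.qubits + 1) * 3) * 8 ^ numH C.real := by positivity
  have hp0 := C.acceptProb_nonneg
  have hp1 := C.acceptProb_le_one
  generalize C.acceptProb = p at *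
  generalize (4 : ℝ) ^ ((C.qubits + 1) * 3) * 8 ^ numH C.real = K at *
  obtain ⟨h1, h2⟩ := abs_le.1 (ha.trans (mul_le_mul_of_nonneg_left hpow (by norm_num)))
  constructor
  · intro h
    -- The expression equals 1 - 6p² + 4p³, which decreases on [0, 1] and is -13/27 at p = 2/3;
    -- symmetrically it is 13/27 at p = 1/3.
    have h3 : (3 * (1 - 2 * p) - (1 - 2 * p) ^ 3) / 2 < -1 / 3 := by
      nlinarith [mul_nonneg (sub_nonneg.2 h) (sub_nonneg.2 hp1), mul_nonneg (mul_nonneg (sub_nonneg.2 h) (sub_nonneg.2 hp1)) hp0]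
    have h4 := mul_lt_mul_of_pos_left h3 hK
    exact_mod_cast (by linarith : (a : ℝ) < 0)
  · intro h
    have h3 : 1 / 3 < (3 * (1 - 2 * p) - (1 - 2 * p) ^ 3) / 2 := by
      nlinarith [mul_nonneg (sub_nonneg.2 h) hp0, mul_nonneg (mul_nonneg (sub_nonneg.2 h) hp0) (sub_nonneg.2 hp1)]
    have h4 := mul_lt_mul_of_pos_left h3 hK
    exact_mod_cast (by linarith : 0 < (a : ℝ))

end QCircuit

end CubicGap

open CubicGap in
theorem proposition4 :
    CubicGap.EstimationBQPHard CubicGap.CubicPoly.encode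
      (fun P => (CubicGap.gap P.poly : ℝ))
      (fun P => 1 / 3 * (2 : ℝ) ^ (((P.n : ℝ) + (CubicGap.circuitWidth P.poly : ℝ)) / 2)) := by
  rintro L ⟨C, hC, hL⟩
  choose query henc hquery using fun x => (C x).exists_query
  refine ⟨query, fun p => decide (p.2 < 0), ?_, polyTime_neg, fun x a ha => ?_⟩
  -- `query` comes from a choice, but the string that encodes it is the output of the composed
  -- machines, and computability refers only to that string.
  · exact ((hC.comp polyTime_transpile).comp polyTime_assemble).congr fun x => (henc x).symm
  · obtain ⟨h1, h2⟩ := hquery x a ha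
    rw [decide_eq_true_iff]
    constructor
    · intro ha0
      by_contra hx
      exact (h2 ((hL x).2 hx)).not_gt ha0
    · intro hx
      exact h1 ((hL x).1 hx)
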